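/- All manifolds are smooth, Hausdorff, finite-dimensional and without boundary. Let $\mathcal G\rightrightarrows M$ and $\mathcal H\rightrightarrows M$ be Lie groupoids with source, target, unit, inversion and multiplication maps $s,t,1,i,m$, where $m(g,h)=gh$ is defined when $s(g)=t(h)$, and let $\Phi:\mathcal G\to\mathcal H$ be a Lie groupoid morphism covering the identity of $M$ which is a surjective submersion. A \emph{multiplicative Ehresmann connection} for $\Phi$ is a smooth vector subbundle $E\subset T\mathcal G$ with $T\mathcal G=\ker(\mathrm d\Phi)\oplus E$ which is a Lie subgroupoid $E\rightrightarrows TM$ of the tangent groupoid $T\mathcal G\rightrightarrows TM$ (whose structure maps are the differentials of those of $\mathcal G$). It is \emph{complete} if for every smooth path $h:[0,1]\to\mathcal H$ and every $g_0\in\mathcal G$ with $\Phi(g_0)=h(0)$ there is a smooth path $g:[0,1]\to\mathcal G$ with $g(0)=g_0$, $\Phi\circ g=h$ and $\dot g(\tau)\in E_{g(\tau)}$ for all $\tau\in[0,1]$. A bundle of Lie groups is a Lie groupoid $p:\mathcal K\to M$ with $s=t=p$; it is \emph{locally trivial} if every $x_0\in M$ has an open neighbourhood $U$ with a diffeomorphism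 $U\times\mathcal K_{x_0}\cong \mathcal K|_U$ over $U$ that restricts to a group isomorphism $\mathcal K_{x_0}\cong\mathcal K_x$ for each $x\in U$. The kernel $\ker\Phi=\{g\in\mathcal G:\Phi(g)\text{ is a unit}\}$ is a bundle of Lie groups over $M$. A multiplicative Ehresmann connection on a bundle of Lie groups $p:\mathcal K\to M$ is one for the morphism $p$ from $\mathcal K$ to the identity groupoid $M\rightrightarrows M$. \textbf{Theorem.} (1) A multiplicative Ehresmann connection for $\Phi$ is complete if and only if $\ker\Phi$ is a locally trivial bundle of Lie groups. (2) Let $p:\mathcal K\to M$ be a bundle of connected Lie groups. If $M$ is second countable, then $\mathcal K$ is locally trivial if and only if it admits a multiplicative Ehresmann connection. Moreover (for any $M$), every multiplicative Ehresmann connection on $\mathcal K$ is complete. -/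

import Mathlib

open Set Topology Manifold
open scoped ContDiff

noncomputable section

/-- A smooth Lie groupoid `G ⇉ M` between finite-dimensional manifolds without boundary.
The product `mul g h` is meaningful for `src g = tgt h`; its values on other pairs are irrelevant.
A map defined on an embedded submanifold `S` is smooth when it is `ContMDiffOn S`. -/
structure LieGroupoid {EM : Type*} [NormedAddCommGroup EM] [NormedSpace ℝ EM]
    {EG : Type*} [NormedAddCommGroup EG] [NormedSpace ℝ EG]
    (M : Type*) [TopologicalSpace M] [ChartedSpace EM M]
    (G : Type*) [TopologicalSpace G] [ChartedSpace EG G] where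
  src : G → M
  tgt : G → M
  one : M → G
  inv : G → G
  mul : G → G → G
  src_one : ∀ x, src (one x) = x
  tgt_one : ∀ x, tgt (one x) = x
  src_inv : ∀ g, src (inv g) = tgt g
  tgt_inv : ∀ g, tgt (inv g) = src g
  src_mul : ∀ g h, src g = tgt h → src (mul g h) = src h
  tgt_mul : ∀ g h, src g = tgt h → tgt (mul g h) = tgt g
  mul_assoc : ∀ g h k, src g = tgt h → src h = tgt k → mul (mul g h) k = mul g (mul h k)
  one_mul : ∀ g, mul (one (tgt g)) g = g
  mul_one : ∀ g, mul g (one (src g)) = g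
  inv_mul : ∀ g, mul (inv g) g = one (src g)
  mul_inv : ∀ g, mul g (inv g) = one (tgt g)
  isSubmersion_src : IsSubmersion 𝓘(ℝ, EG) 𝓘(ℝ, EM) ∞ src
  isSubmersion_tgt : IsSubmersion 𝓘(ℝ, EG) 𝓘(ℝ, EM) ∞ tgt
  contMDiff_one : ContMDiff 𝓘(ℝ, EM) 𝓘(ℝ, EG) ∞ one
  contMDiff_inv : ContMDiff 𝓘(ℝ, EG) 𝓘(ℝ, EG) ∞ inv
  contMDiffOn_mul : ContMDiffOn (𝓘(ℝ, EG).prod 𝓘(ℝ, EG)) 𝓘(ℝ, EG) ∞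
    (fun p : G × G => mul p.1 p.2) {p | src p.1 = tgt p.2}

namespace LieGroupoid

variable {EM : Type*} [NormedAddCommGroup EM] [NormedSpace ℝ EM]
  {EG : Type*} [NormedAddCommGroup EG] [NormedSpace ℝ EG]
  {EH : Type*} [NormedAddCommGroup EH] [NormedSpace ℝ EH]
  {M : Type*} [TopologicalSpace M] [ChartedSpace EM M]
  {G : Type*} [TopologicalSpace G] [ChartedSpace EG G]
  {H : Type*} [TopologicalSpace H] [ChartedSpace EH H]

/-- The submanifold of composable pairs. -/
def composable (𝒢 : LieGroupoid (EM := EM) (EG := EG) M G) : Set (G × G) :=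
  {p | 𝒢.src p.1 = 𝒢.tgt p.2}

/-- The multiplication of the tangent groupoid `TG ⇉ TM`: the differential of the multiplication
of `G`. It is meaningful for pairs `a`, `b` with `T src a = T tgt b`. These are exactly the tangent
vectors of the submanifold of composable pairs, and on those the value of the derivative within
this submanifold is determined. -/
def tangentMul (𝒢 : LieGroupoid (EM := EM) (EG := EG) M G)
    (a b : TangentBundle 𝓘(ℝ, EG) G) : TangentBundle 𝓘(ℝ, EG) G :=
  ⟨𝒢.mul a.1 b.1,
    mfderivWithin (𝓘(ℝ, EG).prod 𝓘(ℝ, EG)) 𝓘(ℝ, EG) (fun p : G × G => 𝒢.mul p.1 p.2)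
      𝒢.composable (a.1, b.1) ((a.2, b.2) : EG × EG)⟩

/-- Morphisms of Lie groupoids over `M` covering the identity of `M`. -/
structure Hom (𝒢 : LieGroupoid (EM := EM) (EG := EG) M G)
    (ℋ : LieGroupoid (EM := EM) (EG := EH) M H) where
  toFun : G → H
  contMDiff : ContMDiff 𝓘(ℝ, EG) 𝓘(ℝ, EH) ∞ toFun
  src_map : ∀ g, ℋ.src (toFun g) = 𝒢.src g
  tgt_map : ∀ g, ℋ.tgt (toFun g) = 𝒢.tgt g
  map_mul : ∀ g h, 𝒢.src g = 𝒢.tgt h → toFun (𝒢.mul g h) = ℋ.mul (toFun g) (toFun h)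

/-- The kernel of a morphism: the preimage of the units. -/
def Hom.ker {𝒢 : LieGroupoid (EM := EM) (EG := EG) M G}
    {ℋ : LieGroupoid (EM := EM) (EG := EH) M H} (Φ : Hom 𝒢 ℋ) : Set G :=
  {g | ∃ x, Φ.toFun g = ℋ.one x}

/-- A subset `K` of the arrows (a bundle of Lie groups over `M`, embedded in `G`) is a locally
trivial bundle of Lie groups: around every `x₀` there is an open set `U` and a diffeomorphism
`U × K_{x₀} ≃ K|_U`, `(x, k) ↦ φ x k`, with inverse `k ↦ (src k, ψ k)`, which for every `x ∈ U`
restricts to a group isomorphism `K_{x₀} ≃ K_x`. -/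
def IsLocallyTrivial (𝒢 : LieGroupoid (EM := EM) (EG := EG) M G) (K : Set G) : Prop :=
  ∀ x₀ : M, ∃ U : Set M, IsOpen U ∧ x₀ ∈ U ∧ ∃ (φ : M → G → G) (ψ : G → G),
    ContMDiffOn (𝓘(ℝ, EM).prod 𝓘(ℝ, EG)) 𝓘(ℝ, EG) ∞ (fun p : M × G => φ p.1 p.2)
      (U ×ˢ {k | k ∈ K ∧ 𝒢.src k = x₀}) ∧
    ContMDiffOn 𝓘(ℝ, EG) 𝓘(ℝ, EG) ∞ ψ {k | k ∈ K ∧ 𝒢.src k ∈ U} ∧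
    (∀ x ∈ U, ∀ k ∈ K, 𝒢.src k = x₀ → φ x k ∈ K ∧ 𝒢.src (φ x k) = x ∧ ψ (φ x k) = k) ∧
    (∀ k ∈ K, 𝒢.src k ∈ U → ψ k ∈ K ∧ 𝒢.src (ψ k) = x₀ ∧ φ (𝒢.src k) (ψ k) = k) ∧
    (∀ x ∈ U, ∀ k ∈ K, ∀ k' ∈ K, 𝒢.src k = x₀ → 𝒢.src k' = x₀ →
      φ x (𝒢.mul k k') = 𝒢.mul (φ x k) (φ x k'))

/-- A multiplicative Ehresmann connection for `Φ`: a smooth vector subbundle of `TG` complementary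
to `ker dΦ` which is a subgroupoid of `TG ⇉ TM` over `TM`. (The rank is constant since that of
`ker dΦ` is, so that smoothness amounts to local smooth sections through every vector; the source
map of the subbundle is then automatically a submersion onto `TM`, as `ker dΦ ⊆ ker d src`.) -/
structure MultiplicativeConnection [IsManifold 𝓘(ℝ, EG) ∞ G]
    {𝒢 : LieGroupoid (EM := EM) (EG := EG) M G}
    {ℋ : LieGroupoid (EM := EM) (EG := EH) M H} (Φ : Hom 𝒢 ℋ) where
  horizontal : ∀ g : G, Submodule ℝ (TangentSpace 𝓘(ℝ, EG) g)
  smooth : ∀ (g : G), ∀ v ∈ horizontal g, ∃ U : Set G, IsOpen U ∧ g ∈ U ∧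
    ∃ X : ∀ g' : G, TangentSpace 𝓘(ℝ, EG) g',
      ContMDiffOn 𝓘(ℝ, EG) 𝓘(ℝ, EG).tangent ∞
        (fun g' => (⟨g', X g'⟩ : TangentBundle 𝓘(ℝ, EG) G)) U ∧
      (∀ g' ∈ U, X g' ∈ horizontal g') ∧ X g = v
  isCompl : ∀ g : G,
    IsCompl (LinearMap.ker (mfderiv 𝓘(ℝ, EG) 𝓘(ℝ, EH) Φ.toFun g).toLinearMap) (horizontal g)
  one_mem : ∀ (x : M) (u : TangentSpace 𝓘(ℝ, EM) x),
    mfderiv 𝓘(ℝ, EM) 𝓘(ℝ, EG) 𝒢.one x u ∈ horizontal (𝒢.one x)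
  inv_mem : ∀ (g : G), ∀ v ∈ horizontal g,
    mfderiv 𝓘(ℝ, EG) 𝓘(ℝ, EG) 𝒢.inv g v ∈ horizontal (𝒢.inv g)
  mul_mem : ∀ a b : TangentBundle 𝓘(ℝ, EG) G, a.2 ∈ horizontal a.1 → b.2 ∈ horizontal b.1 →
    tangentMap 𝓘(ℝ, EG) 𝓘(ℝ, EM) 𝒢.src a = tangentMap 𝓘(ℝ, EG) 𝓘(ℝ, EM) 𝒢.tgt b →
    (𝒢.tangentMul a b).2 ∈ horizontal (𝒢.tangentMul a b).1

/-- A connection is complete if every smooth path `η : [0,1] → H` has, for every `g₀` over `η 0`,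
a horizontal lift `γ : [0,1] → G` starting at `g₀`. -/
def MultiplicativeConnection.IsComplete [IsManifold 𝓘(ℝ, EG) ∞ G]
    {𝒢 : LieGroupoid (EM := EM) (EG := EG) M G}
    {ℋ : LieGroupoid (EM := EM) (EG := EH) M H} {Φ : Hom 𝒢 ℋ}
    (E : MultiplicativeConnection Φ) : Prop :=
  ∀ η : ℝ → H, ContMDiffOn 𝓘(ℝ, ℝ) 𝓘(ℝ, EH) ∞ η (Icc 0 1) →
    ∀ g₀ : G, Φ.toFun g₀ = η 0 →
      ∃ γ : ℝ → G, ContMDiffOn 𝓘(ℝ, ℝ) 𝓘(ℝ, EG) ∞ γ (Icc 0 1) ∧ γ 0 = g₀ ∧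
        ∀ t ∈ Icc (0 : ℝ) 1, Φ.toFun (γ t) = η t ∧
          mfderivWithin 𝓘(ℝ, ℝ) 𝓘(ℝ, EG) γ (Icc 0 1) t (1 : ℝ) ∈ E.horizontal (γ t)

/-- The identity groupoid `M ⇉ M`, all of whose arrows are units. -/
def unit (M : Type*) [TopologicalSpace M] [ChartedSpace EM M] [IsManifold 𝓘(ℝ, EM) ∞ M] :
    LieGroupoid (EM := EM) (EG := EM) M M where
  src := id
  tgt := id
  one := id
  inv := id
  mul := fun x _ => x
  src_one := fun _ => rfl
  tgt_one := fun _ => rfl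
  src_inv := fun _ => rfl
  tgt_inv := fun _ => rfl
  src_mul := fun _ _ h => h
  tgt_mul := fun _ _ _ => rfl
  mul_assoc := fun _ _ _ _ _ => rfl
  one_mul := fun _ => rfl
  mul_one := fun _ => rfl
  inv_mul := fun _ => rfl
  mul_inv := fun _ => rfl
  isSubmersion_src := IsSubmersion.id
  isSubmersion_tgt := IsSubmersion.id
  contMDiff_one := contMDiff_id
  contMDiff_inv := contMDiff_id
  contMDiffOn_mul := contMDiff_fst.contMDiffOn

/-- A bundle of Lie groups over `M` is a Lie groupoid whose source and target maps coincide. -/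
def IsGroupBundle (𝒢 : LieGroupoid (EM := EM) (EG := EG) M G) : Prop := 𝒢.src = 𝒢.tgt

/-- The projection of a bundle of Lie groups, as a morphism onto the identity groupoid of the base.
A multiplicative Ehresmann connection on the bundle is one for this morphism. -/
def IsGroupBundle.proj [IsManifold 𝓘(ℝ, EM) ∞ M] [IsManifold 𝓘(ℝ, EG) ∞ G]
    {𝒢 : LieGroupoid (EM := EM) (EG := EG) M G} (h : 𝒢.IsGroupBundle) :
    Hom 𝒢 (unit (EM := EM) M) where
  toFun := 𝒢.src
  contMDiff := 𝒢.isSubmersion_src.contMDiff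
  src_map := fun _ => rfl
  tgt_map := fun g => congrFun h g
  map_mul := fun g k hgk => (𝒢.src_mul g k hgk).trans (by rw [hgk]; exact congrFun h k)

end LieGroupoid

end

/-!
A connection for `Φ` is a horizontal distribution on `G` complementary to `ker dΦ`, so that in
charts its horizontal lifts solve an ordinary differential equation
(`LieGroupoid.MultiplicativeConnection.exists_lift_in_charts`). Lifts are therefore unique and
smooth, and the end point of a lift depends smoothly on its initial point and on the parameters of a
family of paths. The smooth dependence comes from the inverse function theorem, applied to the
integral equation on a space of continuous functions (`exists_contDiffOn_solution`). The only
question is whether lifts exist over the whole interval, and multiplicativity decides it, since the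
pointwise product of two lifts is a lift of the product (`LieGroupoid.IsLift.mul`).

*Completeness implies local triviality.* The units along the radii of a chart ball around `x₀` lift
from every point of the kernel over `x₀`. The end points of the lifts trivialize the kernel over the
ball; they depend smoothly on the initial point, lifting the reversed radii gives the inverse, and
products of lifts are lifts (`LieGroupoid.MultiplicativeConnection.IsComplete.isLocallyTrivial`).

*Local triviality implies completeness.* Given a path `ξ` in `M` starting at `x`, the elements of
the kernel over `x` from which the path of units over `ξ` lifts form a subgroup that contains a
neighbourhood of the unit. It contains therefore every connected set through the unit
(`LieGroupoid.exists_isLift_of_isPreconnected`). If the kernel is trivialized along `ξ`, the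
components of its fibres are identified with each other, and one local lift in each component
suffices: any other element of the component differs from it by an element joined to the unit
(`LieGroupoid.exists_isLift_of_trivialization`). Finally, a lift of an arbitrary path `η` in `H` is
the product of a local lift through any point over `η t`, which exists since `Φ` is surjective, with
a lift of the units over the sources of `η`
(`LieGroupoid.MultiplicativeConnection.isComplete_of_exists_isLift_one`).

*Bundles of connected Lie groups.* The subgroup above is the whole fibre, so that every connection
is complete, and a bundle with a connection is locally trivial by the first implication. Conversely,
a local trivialization gives a flat multiplicative connection over an open set. All the conditions on
the lift operators of a multiplicative connection are affine, so that the flat connections are glued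
by a partition of unity on `M` (`LieGroupoid.IsMultiplicativeLift.sum`).
-/

noncomputable section

/-! ### Superposition operators on spaces of continuous functions -/

/-- A function that is smooth near `x` agrees near `x` with a globally smooth function. -/
theorem ContDiffOn.exists_contDiff_eventuallyEq {E F : Type*} [NormedAddCommGroup E]
    [NormedSpace ℝ E] [FiniteDimensional ℝ E] [NormedAddCommGroup F] [NormedSpace ℝ F]
    {f : E → F} {s : Set E} {x : E} (hf : ContDiffOn ℝ ∞ f s) (hs : s ∈ 𝓝 x) :
    ∃ g : E → F, ContDiff ℝ ∞ g ∧ g =ᶠ[𝓝 x] f := by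
  obtain ⟨r, hr, hrs⟩ := Metric.nhds_basis_closedBall.mem_iff.1 (interior_mem_nhds.2 hs)
  let b : ContDiffBump x := ⟨r / 2, r, by positivity, by linarith⟩
  refine ⟨fun y => b y • f y, ?_, ?_⟩
  · rw [contDiff_iff_contDiffAt]
    intro y
    by_cases hy : y ∈ interior s
    · exact b.contDiff.contDiffAt.smul (hf.contDiffAt (mem_interior_iff_mem_nhds.1 hy))
    · have : y ∉ tsupport b := fun h => hy (hrs (b.tsupport_eq ▸ h))
      refine contDiffAt_const (c := (0 : F)) |>.congr_of_eventuallyEq ?_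
      filter_upwards [notMem_tsupport_iff_eventuallyEq.1 this] with z hz
      simp [hz]
  · filter_upwards [b.eventuallyEq_one] with y hy
    simp [hy]

section Superposition

/-- Pointwise evaluation of a continuous family of operators on a continuous family of vectors. -/
def ContinuousMap.applyL (K : Type*) [TopologicalSpace K] [CompactSpace K]
    (E F : Type*) [NormedAddCommGroup E] [NormedSpace ℝ E]
    [NormedAddCommGroup F] [NormedSpace ℝ F] :
    C(K, E →L[ℝ] F) →L[ℝ] C(K, E) →L[ℝ] C(K, F) :=
  LinearMap.mkContinuous₂
    (LinearMap.mk₂ ℝ (fun (A : C(K, E →L[ℝ] F)) (u : C(K, E)) =>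
      (⟨fun τ => A τ (u τ), A.continuous.clm_apply u.continuous⟩ : C(K, F)))
      (fun _ _ _ => by ext; simp) (fun _ _ _ => by ext; simp)
      (fun _ _ _ => by ext; simp) (fun _ _ _ => by ext; simp)) 1
    (fun A u => by
      rw [ContinuousMap.norm_le _ (by positivity)]
      intro τ
      rw [one_mul]
      exact (ContinuousLinearMap.le_opNorm _ _).trans
        (mul_le_mul (A.norm_coe_le_norm τ) (u.norm_coe_le_norm τ) (norm_nonneg _) (norm_nonneg A)))

variable {K : Type*} [TopologicalSpace K] [CompactSpace K]

@[simp] theorem ContinuousMap.applyL_apply {E F : Type*} [NormedAddCommGroup E] [NormedSpace ℝ E]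
    [NormedAddCommGroup F] [NormedSpace ℝ F] (A : C(K, E →L[ℝ] F)) (u : C(K, E)) (τ : K) :
    ContinuousMap.applyL K E F A u τ = A τ (u τ) := rfl

/-- The derivative of `u ↦ f ∘ u` is multiplication by `f' ∘ u`. The mean value inequality is
uniform in the parameter, since `w ↦ f' ∘ w` is continuous for the uniform distance. -/
theorem ContinuousMap.hasFDerivAt_comp_left {E F : Type*} [NormedAddCommGroup E] [NormedSpace ℝ E]
    [NormedAddCommGroup F] [NormedSpace ℝ F] {f : C(E, F)} {f' : C(E, E →L[ℝ] F)}
    (hf : ∀ x, HasFDerivAt f (f' x) x) (u : C(K, E)) :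
    HasFDerivAt (fun u : C(K, E) => f.comp u) (ContinuousMap.applyL K E F (f'.comp u)) u := by
  rw [hasFDerivAt_iff_isLittleO, Asymptotics.isLittleO_iff]
  intro ε hε
  have hc : Continuous fun w : C(K, E) => f'.comp w := ContinuousMap.continuous_postcomp f'
  obtain ⟨δ, hδ, hball⟩ := (Metric.continuousAt_iff (α := C(K, E))
    (β := C(K, E →L[ℝ] F)) (f := fun w => f'.comp w) (a := u)).1 hc.continuousAt ε hε
  filter_upwards [Metric.ball_mem_nhds u hδ] with v hv
  rw [ContinuousMap.norm_le _ (by positivity)]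
  intro τ
  refine le_trans ?_ (mul_le_mul_of_nonneg_left ((v - u).norm_coe_le_norm τ) hε.le)
  refine (convex_segment (u τ) (v τ)).norm_image_sub_le_of_norm_hasFDerivWithin_le'
    (f := f) (f' := fun x => f' x) (φ := f' (u τ)) (fun x _ => (hf x).hasFDerivWithinAt) ?_
    (left_mem_segment ℝ _ _) (right_mem_segment ℝ _ _)
  intro x hx
  rw [segment_eq_image'] at hx
  obtain ⟨θ, hθ, rfl⟩ := hx
  -- the point of the segment is the value at `τ` of the function `u + θ (v - u)` close to `u`
  have h1 : dist (u + θ • (v - u)) u < δ := by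
    rw [dist_eq_norm, add_sub_cancel_left, norm_smul, Real.norm_of_nonneg hθ.1]
    rw [Metric.mem_ball, dist_eq_norm] at hv
    nlinarith [hθ.2, norm_nonneg (v - u)]
  have h2 := (ContinuousMap.dist_apply_le_dist τ).trans (hball h1).le
  rwa [dist_eq_norm] at h2

/-- The finite-order case of `ContinuousMap.contDiff_comp_left`, with a target whose universe
contains that of the spaces of operators `E →L[ℝ] F` met in the induction. -/
theorem ContinuousMap.contDiff_comp_left_aux.{u, v} {E : Type u} [NormedAddCommGroup E]
    [NormedSpace ℝ E] (n : ℕ) : ∀ {F : Type (max u v)} [NormedAddCommGroup F]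
    [NormedSpace ℝ F] (f : C(E, F)), ContDiff ℝ n f →
    ContDiff ℝ n (fun u : C(K, E) => f.comp u) := by
  induction n with
  | zero =>
    intro F _ _ f _
    exact contDiff_zero.2 (ContinuousMap.continuous_postcomp f)
  | succ n ih =>
    intro F _ _ f hf
    rw [Nat.cast_add, Nat.cast_one] at hf ⊢
    have h := contDiff_succ_iff_fderiv.1 hf
    let f' : C(E, E →L[ℝ] F) := ⟨fderiv ℝ f, h.2.2.continuous⟩
    have hd : ∀ u : C(K, E), HasFDerivAt (fun u : C(K, E) => f.comp u)
        (ContinuousMap.applyL K E F (f'.comp u)) u :=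
      ContinuousMap.hasFDerivAt_comp_left fun x => (h.1 x).hasFDerivAt
    refine contDiff_succ_iff_fderiv.2 ⟨fun u => (hd u).differentiableAt, by simp, ?_⟩
    rw [show fderiv ℝ (fun u : C(K, E) => f.comp u) =
      fun u => ContinuousMap.applyL K E F (f'.comp u) from funext fun u => (hd u).fderiv]
    exact (ContinuousMap.applyL K E F).contDiff.comp (ih f' h.2.2)

/-- Composition from the left with a smooth map is smooth on spaces of continuous functions: its
derivative is again of this form. -/
theorem ContinuousMap.contDiff_comp_left.{u, v} {E : Type u} {F : Type v} [NormedAddCommGroup E]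
    [NormedSpace ℝ E] [NormedAddCommGroup F] [NormedSpace ℝ F] (f : C(E, F)) (hf : ContDiff ℝ ∞ f) :
    ContDiff ℝ ∞ (fun u : C(K, E) => f.comp u) := by
  rw [contDiff_infty]
  intro n
  -- the induction on `n` passes to targets `E →L[ℝ] F`, which forces a common universe
  let e : ULift.{u} F ≃L[ℝ] F := ContinuousLinearEquiv.ulift
  let g : C(E, ULift.{u} F) := ⟨fun x => e.symm (f x), e.symm.continuous.comp f.continuous⟩
  have hg : ContDiff ℝ n g := e.symm.contDiff.comp (contDiff_infty.1 hf n)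
  have h : ContDiff ℝ n (fun u : C(K, E) => g.comp u) :=
    ContinuousMap.contDiff_comp_left_aux.{_, u, v} n g hg
  exact ((e : ULift.{u} F →L[ℝ] F).compLeftContinuous ℝ K).contDiff.comp h

end Superposition

/-! ### Smooth dependence of solutions on initial values and coefficients -/

/-- The inverse function theorem with a local inverse that is smooth on its whole domain, which is
obtained by restriction to the open set of points where the derivative is invertible. -/
theorem ContDiff.exists_openPartialHomeomorph_contDiffOn_symm {X Y : Type*} [NormedAddCommGroup X]
    [NormedSpace ℝ X] [CompleteSpace X] [NormedAddCommGroup Y] [NormedSpace ℝ Y]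
    {f : X → Y} (hf : ContDiff ℝ ∞ f) {a : X} {e : X ≃L[ℝ] Y}
    (he : HasFDerivAt f (e : X →L[ℝ] Y) a) :
    ∃ h : OpenPartialHomeomorph X Y, a ∈ h.source ∧ ⇑h = f ∧ ContDiffOn ℝ ∞ h.symm h.target := by
  let h₀ := hf.contDiffAt.toOpenPartialHomeomorph f he (by simp)
  let s : Set X := {x | fderiv ℝ f x ∈ range ((↑) : (X ≃L[ℝ] Y) → X →L[ℝ] Y)}
  have hs : IsOpen s :=
    ContinuousLinearEquiv.isOpen.preimage (hf.continuous_fderiv (by simp))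
  refine ⟨h₀.restrOpen s hs, ⟨hf.contDiffAt.mem_toOpenPartialHomeomorph_source he (by simp), ?_⟩,
    rfl, ?_⟩
  · exact ⟨e, he.fderiv.symm⟩
  · intro y hy
    have hy' := (h₀.restrOpen s hs).map_target hy
    obtain ⟨e', he'⟩ := hy'.2
    refine ((h₀.restrOpen s hs).contDiffAt_symm hy (f₀' := e') ?_ hf.contDiffAt).contDiffWithinAt
    rw [he']
    exact (hf.differentiable (by simp) _).hasFDerivAt

section Volterra

open unitInterval MeasureTheory

variable {E : Type*} [NormedAddCommGroup E] [NormedSpace ℝ E]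

/-- Integration from `0`, on the space of continuous functions on the unit interval. -/
def volterra (E : Type*) [NormedAddCommGroup E] [NormedSpace ℝ E] : C(I, E) →L[ℝ] C(I, E) :=
  LinearMap.mkContinuous
    { toFun := fun u => ⟨fun τ => ∫ r in (0 : ℝ)..τ, u (projIcc 0 1 zero_le_one r),
        (intervalIntegral.continuous_primitive (fun a b => Continuous.intervalIntegrable
          (u.continuous.comp continuous_projIcc) a b) 0).comp continuous_subtype_val⟩
      map_add' := fun u v => by
        ext τ
        exact intervalIntegral.integral_add
          ((u.continuous.comp continuous_projIcc).intervalIntegrable _ _)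
          ((v.continuous.comp continuous_projIcc).intervalIntegrable _ _)
      map_smul' := fun c u => by
        ext τ
        exact intervalIntegral.integral_smul c _ } 1
    (fun u => by
      rw [ContinuousMap.norm_le _ (by positivity)]
      intro τ
      refine (intervalIntegral.norm_integral_le_of_norm_le_const (C := ‖u‖)
        fun r _ => u.norm_coe_le_norm _).trans ?_
      rw [sub_zero, abs_of_nonneg τ.2.1]
      nlinarith [norm_nonneg u, τ.2.2])

theorem volterra_apply (u : C(I, E)) (τ : I) :
    volterra E u τ = ∫ r in (0 : ℝ)..τ, u (projIcc 0 1 zero_le_one r) := rfl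

theorem volterra_zero (u : C(I, E)) : volterra E u 0 = 0 := by
  simp [volterra_apply]

theorem hasDerivWithinAt_volterra [CompleteSpace E] (u : C(I, E)) {τ : ℝ} (hτ : τ ∈ Icc (0 : ℝ) 1) :
    HasDerivWithinAt (fun τ => volterra E u (projIcc 0 1 zero_le_one τ))
      (u (projIcc 0 1 zero_le_one τ)) (Icc 0 1) τ := by
  have hc : Continuous fun r => u (projIcc 0 1 zero_le_one r) :=
    u.continuous.comp continuous_projIcc
  have h := (intervalIntegral.integral_hasDerivAt_right (hc.intervalIntegrable 0 τ)
    hc.stronglyMeasurable.stronglyMeasurableAtFilter hc.continuousAt).hasDerivWithinAt (s := Icc 0 1)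
  refine h.congr_of_mem (fun r hr => ?_) hτ
  rw [volterra_apply, projIcc_of_mem _ hr]

variable {F : Type*} [NormedAddCommGroup F] [NormedSpace ℝ F]

/-- The equation `u' = L(u) c` on the unit interval has, for initial values close to `y₀` and small
coefficient functions `c`, a solution that depends smoothly on both. It is obtained from the
inverse function theorem at `c = 0`, where the linearised equation is `u' = L(y₀) c`. -/
theorem exists_contDiffOn_solution [CompleteSpace E] [CompleteSpace F] {L : E → F →L[ℝ] E}
    (hL : ContDiff ℝ ∞ L) (y₀ : E) {O : Set E} (hO : O ∈ 𝓝 y₀) :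
    ∃ (N : Set (E × C(I, F))) (S : E × C(I, F) → C(I, E)), IsOpen N ∧ (y₀, 0) ∈ N ∧
      ContDiffOn ℝ ∞ S N ∧ ∀ p ∈ N, S p 0 = p.1 ∧ ∀ τ : I, S p τ ∈ O ∧
        HasDerivWithinAt (fun r => S p (projIcc 0 1 zero_le_one r))
          (L (S p τ) (p.2 τ)) (Icc 0 1) τ := by
  let Lc : C(E, F →L[ℝ] E) := ⟨L, hL.continuous⟩
  let cst : E →L[ℝ] C(I, E) := ContinuousLinearMap.const ℝ I
  -- the second component of `Ψ ((y, c), u)` vanishes if and only if `u = y + ∫ L(u) c`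
  let Ψ : (E × C(I, F)) × C(I, E) → (E × C(I, F)) × C(I, E) := fun q =>
    (q.1, q.2 - cst q.1.1 -
      volterra E (ContinuousMap.applyL I F E (Lc.comp q.2) q.1.2))
  have hLc : ContDiff ℝ ∞ fun q : (E × C(I, F)) × C(I, E) => Lc.comp q.2 :=
    (ContinuousMap.contDiff_comp_left Lc hL).comp contDiff_snd
  have hΨ : ContDiff ℝ ∞ Ψ := by
    have : ContDiff ℝ ∞ fun q : (E × C(I, F)) × C(I, E) =>
        ContinuousMap.applyL I F E (Lc.comp q.2) q.1.2 :=
      ((ContinuousMap.applyL I F E).contDiff.comp hLc).clm_apply (by fun_prop)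
    fun_prop
  let A : E × C(I, F) →L[ℝ] C(I, E) := cst ∘L .fst ℝ _ _ +
    volterra E ∘L (ContinuousMap.applyL I F E (Lc.comp (cst y₀))) ∘L .snd ℝ _ _
  let e : ((E × C(I, F)) × C(I, E)) ≃L[ℝ] ((E × C(I, F)) × C(I, E)) :=
    ContinuousLinearEquiv.equivOfInverse
      ((ContinuousLinearMap.fst ℝ _ _).prod (.snd ℝ _ _ - A ∘L .fst ℝ _ _))
      ((ContinuousLinearMap.fst ℝ _ _).prod (.snd ℝ _ _ + A ∘L .fst ℝ _ _))
      (fun q => by ext <;> simp) (fun q => by ext <;> simp)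
  let a : (E × C(I, F)) × C(I, E) := ((y₀, 0), cst y₀)
  have he : HasFDerivAt Ψ (e : _ →L[ℝ] _) a := by
    obtain ⟨D, hD⟩ := (hLc.differentiable (by simp) a)
    have h1 : HasFDerivAt (fun q : (E × C(I, F)) × C(I, E) =>
        ContinuousMap.applyL I F E (Lc.comp q.2) q.1.2) _ a :=
      HasFDerivAt.clm_apply ((ContinuousMap.applyL I F E).hasFDerivAt.comp a hD)
        (hasFDerivAt_fst.snd)
    have h2 : HasFDerivAt Ψ _ a := hasFDerivAt_fst.prodMk
      ((hasFDerivAt_snd.sub (cst.hasFDerivAt.comp a hasFDerivAt_fst.fst)).sub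
        ((volterra E).hasFDerivAt.comp a h1))
    refine h2.congr_fderiv ?_
    ext q <;> simp [e, A, a, cst, sub_sub]
  obtain ⟨h, hah, hh, hsymm⟩ := hΨ.exists_openPartialHomeomorph_contDiffOn_symm he
  have hΨa : Ψ a = ((y₀, 0), 0) := by
    simp [Ψ, a]
  let ι : E × C(I, F) → (E × C(I, F)) × C(I, E) := fun p => (p, 0)
  have hι : ContDiff ℝ ∞ ι := by fun_prop
  let S : E × C(I, F) → C(I, E) := fun p => (h.symm (ι p)).2
  have hSsm : ContDiffOn ℝ ∞ S (ι ⁻¹' h.target) :=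
    contDiff_snd.comp_contDiffOn (hsymm.comp hι.contDiffOn fun _ hp => hp)
  have hN₀ : IsOpen (ι ⁻¹' h.target) := h.open_target.preimage hι.continuous
  have hmem : (y₀, 0) ∈ ι ⁻¹' h.target := by
    have := h.map_source hah
    rwa [hh, hΨa] at this
  have hSa : S (y₀, 0) = cst y₀ := by
    have := h.left_inv hah
    rw [hh, hΨa] at this
    exact congrArg Prod.snd this
  obtain ⟨r, hr, hrO⟩ := Metric.mem_nhds_iff.1 hO
  refine ⟨ι ⁻¹' h.target ∩ S ⁻¹' Metric.ball (cst y₀) r, S,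
    hSsm.continuousOn.isOpen_inter_preimage hN₀ Metric.isOpen_ball,
    ⟨hmem, by rw [mem_preimage, hSa]; exact Metric.mem_ball_self hr⟩,
    hSsm.mono inter_subset_left, ?_⟩
  rintro p ⟨hp, hpr⟩
  have hq := h.right_inv hp
  rw [hh] at hq
  have hq1 : (h.symm (ι p)).1 = p := congrArg Prod.fst hq
  have hq2 : S p - cst p.1 - volterra E (ContinuousMap.applyL I F E (Lc.comp (S p)) p.2) = 0 := by
    have := congrArg Prod.snd hq
    simp only [Ψ, hq1] at this
    exact this
  have hint : S p = cst p.1 + volterra E (ContinuousMap.applyL I F E (Lc.comp (S p)) p.2) := by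
    rw [sub_sub, sub_eq_zero] at hq2
    exact hq2
  refine ⟨?_, fun τ => ⟨hrO ?_, ?_⟩⟩
  · rw [hint, ContinuousMap.add_apply, volterra_zero, add_zero]
    rfl
  · exact (ContinuousMap.dist_apply_le_dist τ).trans_lt hpr
  · have h3 := (hasDerivWithinAt_volterra (ContinuousMap.applyL I F E (Lc.comp (S p)) p.2)
      τ.2).const_add p.1
    rw [projIcc_val] at h3
    refine h3.congr_of_mem (fun r _ => ?_) τ.2
    conv_lhs => rw [hint]
    rfl

end Volterra

/-! ### Submersions and retractions onto their fibres -/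

section Submersion

variable {E : Type*} [NormedAddCommGroup E] [NormedSpace ℝ E]
  {M : Type*} [TopologicalSpace M] [ChartedSpace E M]
  {E' : Type*} [NormedAddCommGroup E'] [NormedSpace ℝ E']
  {N : Type*} [TopologicalSpace N] [ChartedSpace E' N]
  {f : M → N}

/-- A submersion is locally trivial as a family of fibres: there is a smooth local map `r` moving
the points near `x` into the fibres over the points near `f x`, which is the identity on points
that already lie in the prescribed fibre. -/
theorem Manifold.IsSubmersionAt.exists_retraction {x : M}
    (hf : IsSubmersionAt 𝓘(ℝ, E) 𝓘(ℝ, E') ∞ f x) :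
    ∃ (r : N × M → M) (U : Set (N × M)), IsOpen U ∧ (f x, x) ∈ U ∧
      ContMDiffOn (𝓘(ℝ, E').prod 𝓘(ℝ, E)) 𝓘(ℝ, E) ∞ r U ∧
      ∀ p ∈ U, f (r p) = p.1 ∧ (f p.2 = p.1 → r p = p.2) := by
  obtain ⟨F, _, _, h⟩ := hf
  let d := h.domChart
  let c := h.codChart
  let e := h.equiv
  have hd : d ∈ IsManifold.maximalAtlas 𝓘(ℝ, E) ∞ M := h.domChart_mem_maximalAtlas
  have hc : c ∈ IsManifold.maximalAtlas 𝓘(ℝ, E') ∞ N := h.codChart_mem_maximalAtlas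
  have hw : ∀ z ∈ d.source, c (f z) = (e (d z)).1 := fun z hz => by
    have := h.writtenInCharts (show d z ∈ (d.extend 𝓘(ℝ, E)).target by
      simpa using d.map_source hz)
    simpa [d, c, e, d.left_inv hz] using this
  have hmaps : ∀ z ∈ d.source, f z ∈ c.source := h.mapsto_domChart_source_codChart_source
  let q : N × M → E := fun p => e.symm (c p.1, (e (d p.2)).2)
  let U₀ : Set (N × M) := c.source ×ˢ d.source
  have hU₀ : IsOpen U₀ := c.open_source.prod d.open_source
  have hq : ContMDiffOn (𝓘(ℝ, E').prod 𝓘(ℝ, E)) 𝓘(ℝ, E) ∞ q U₀ := by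
    have h1 : ContMDiffOn (𝓘(ℝ, E').prod 𝓘(ℝ, E)) 𝓘(ℝ, E') ∞ (fun p : N × M => c p.1) U₀ :=
      (contMDiffOn_of_mem_maximalAtlas hc).comp contMDiffOn_fst fun p hp => hp.1
    have h2 : ContMDiffOn (𝓘(ℝ, E').prod 𝓘(ℝ, E)) 𝓘(ℝ, E) ∞ (fun p : N × M => d p.2) U₀ :=
      (contMDiffOn_of_mem_maximalAtlas hd).comp contMDiffOn_snd fun p hp => hp.2
    have h3 : ContDiff ℝ ∞ fun z : E' × E => e.symm (z.1, (e z.2).2) := by fun_prop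
    exact h3.contMDiff.comp_contMDiffOn (h1.prodMk_space h2)
  refine ⟨fun p => d.symm (q p), U₀ ∩ q ⁻¹' d.target,
    hq.continuousOn.isOpen_inter_preimage hU₀ d.open_target, ?_, ?_, ?_⟩
  · refine ⟨⟨h.mem_codChart_source, h.mem_domChart_source⟩, ?_⟩
    have : q (f x, x) = d x := by
      simp only [q, hw x h.mem_domChart_source]
      simp
    rw [mem_preimage, this]
    exact d.map_source h.mem_domChart_source
  · exact (contMDiffOn_symm_of_mem_maximalAtlas hd).comp (hq.mono inter_subset_left)
      fun p hp => hp.2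
  · rintro p ⟨⟨hp1, hp2⟩, hp3⟩
    have hs := d.map_target hp3
    refine ⟨?_, fun hfp => ?_⟩
    · apply c.injOn (hmaps _ hs) hp1
      rw [hw _ hs, d.right_inv hp3]
      simp [q]
    · have : q p = d p.2 := by
        simp only [q, ← hfp, hw p.2 hp2]
        simp
      simp only [this]
      exact d.left_inv hp2

theorem Manifold.IsSubmersionAt.surjective_mfderiv {x : M}
    (hf : IsSubmersionAt 𝓘(ℝ, E) 𝓘(ℝ, E') ∞ f x) :
    Function.Surjective (mfderiv 𝓘(ℝ, E) 𝓘(ℝ, E') f x) := by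
  obtain ⟨r, U, hU, hxU, hr, hrU⟩ := hf.exists_retraction
  have hfd : MDifferentiableAt 𝓘(ℝ, E) 𝓘(ℝ, E') f x := by
    obtain ⟨F, _, _, h⟩ := hf
    exact h.contMDiffAt.mdifferentiableAt (by simp)
  have hsec : ContMDiffAt 𝓘(ℝ, E') (𝓘(ℝ, E').prod 𝓘(ℝ, E)) ∞ (fun y : N => (y, x)) (f x) :=
    contMDiffAt_id.prodMk contMDiffAt_const
  have hs : MDifferentiableAt 𝓘(ℝ, E') 𝓘(ℝ, E) (fun y => r (y, x)) (f x) :=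
    ((hr.contMDiffAt (hU.mem_nhds hxU)).comp (f x) hsec).mdifferentiableAt (by simp)
  have hrx : r (f x, x) = x := (hrU _ hxU).2 rfl
  have h1 : (fun y => f (r (y, x))) =ᶠ[𝓝 (f x)] id := by
    filter_upwards [hsec.continuousAt.preimage_mem_nhds (hU.mem_nhds hxU)] with y hy
    exact (hrU _ hy).1
  have h2 := h1.mfderiv_eq (I := 𝓘(ℝ, E')) (I' := 𝓘(ℝ, E'))
  rw [mfderiv_id] at h2
  intro w
  refine ⟨mfderiv 𝓘(ℝ, E') 𝓘(ℝ, E) (fun y => r (y, x)) (f x) w, ?_⟩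
  have h3 := mfderiv_comp_apply_of_eq (f := fun y => r (y, x)) (g := f) _ hfd hs hrx w
  have h4 := congrArg (fun A => A w) h2
  exact h3.symm.trans h4

end Submersion

/-! ### A connection in charts -/

section ChartDerivative

variable {E : Type*} [NormedAddCommGroup E] [NormedSpace ℝ E]
  {M : Type*} [TopologicalSpace M] [ChartedSpace E M] [IsManifold 𝓘(ℝ, E) ∞ M]

theorem contMDiffOn_extChartAt_source (x : M) :
    ContMDiffOn 𝓘(ℝ, E) 𝓘(ℝ, E) ∞ (extChartAt 𝓘(ℝ, E) x) (extChartAt 𝓘(ℝ, E) x).source := by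
  rw [extChartAt_source 𝓘(ℝ, E)]
  exact contMDiffOn_extChartAt

theorem extChartAt_mfderiv_injective {x y : M} (hy : y ∈ (extChartAt 𝓘(ℝ, E) x).source) :
    Function.Injective (mfderiv 𝓘(ℝ, E) 𝓘(ℝ, E) (extChartAt 𝓘(ℝ, E) x) y) :=
  (isInvertible_mfderiv_extChartAt hy).injective

theorem extChartAt_mfderiv_surjective {x y : M} (hy : y ∈ (extChartAt 𝓘(ℝ, E) x).source) :
    Function.Surjective (mfderiv 𝓘(ℝ, E) 𝓘(ℝ, E) (extChartAt 𝓘(ℝ, E) x) y) :=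
  (isInvertible_mfderiv_extChartAt hy).surjective

/-- A smooth vector field is smooth when read in a chart. -/
theorem ContMDiffOn.mfderiv_extChartAt_section {X : ∀ y : M, TangentSpace 𝓘(ℝ, E) y} {U : Set M}
    (hU : IsOpen U)
    (hX : ContMDiffOn 𝓘(ℝ, E) 𝓘(ℝ, E).tangent ∞
      (fun y => (⟨y, X y⟩ : TangentBundle 𝓘(ℝ, E) M)) U) (x : M) :
    ContMDiffOn 𝓘(ℝ, E) 𝓘(ℝ, E) ∞
      (fun y => (mfderiv 𝓘(ℝ, E) 𝓘(ℝ, E) (extChartAt 𝓘(ℝ, E) x) y (X y) : E))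
      (U ∩ (extChartAt 𝓘(ℝ, E) x).source) := by
  let e := trivializationAt E (TangentSpace 𝓘(ℝ, E) (M := M)) x
  have hb : e.baseSet = (extChartAt 𝓘(ℝ, E) x).source := by
    rw [extChartAt_source]; rfl
  have h1 : ContMDiffOn 𝓘(ℝ, E) 𝓘(ℝ, E) ∞ (fun y => (e ⟨y, X y⟩).2)
      (U ∩ (extChartAt 𝓘(ℝ, E) x).source) :=
    (e.contMDiffOn_section_iff (hU.inter (isOpen_extChartAt_source x))
      (by rw [hb]; exact inter_subset_right)).1 (hX.mono inter_subset_left)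
  refine h1.congr fun y hy => ?_
  have hy2 : y ∈ (chartAt E x).source := by simpa using hy.2
  have h2 : mfderiv 𝓘(ℝ, E) 𝓘(ℝ, E) (extChartAt 𝓘(ℝ, E) x) y (X y) =
      e.continuousLinearMapAt ℝ y (X y) :=
    (DFunLike.congr_fun (TangentBundle.continuousLinearMapAt_trivializationAt hy2) (X y)).symm
  refine h2.trans ?_
  rw [Bundle.Trivialization.continuousLinearMapAt_apply,
    Bundle.Trivialization.coe_linearMapAt_of_mem _ (by rw [hb]; exact hy.2)]

end ChartDerivative

namespace LieGroupoid

variable {EM : Type*} [NormedAddCommGroup EM] [NormedSpace ℝ EM]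
  {EG : Type*} [NormedAddCommGroup EG] [NormedSpace ℝ EG] [FiniteDimensional ℝ EG]
  {EH : Type*} [NormedAddCommGroup EH] [NormedSpace ℝ EH]
  {M : Type*} [TopologicalSpace M] [ChartedSpace EM M]
  {G : Type*} [TopologicalSpace G] [ChartedSpace EG G] [IsManifold 𝓘(ℝ, EG) ∞ G]
  {H : Type*} [TopologicalSpace H] [ChartedSpace EH H] [IsManifold 𝓘(ℝ, EH) ∞ H]
  {𝒢 : LieGroupoid (EM := EM) (EG := EG) M G} {ℋ : LieGroupoid (EM := EM) (EG := EH) M H}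
  {Φ : Hom 𝒢 ℋ}

/-- A connection in charts: near `g₀`, its horizontal vectors are the vectors `L(y) w`, where
`L(y)` is the horizontal lift of the coordinate vector `w` of the base, which depends smoothly on
the point. -/
theorem MultiplicativeConnection.exists_lift_in_charts (E : MultiplicativeConnection Φ)
    (hΦ : ∀ g, Function.Surjective (mfderiv 𝓘(ℝ, EG) 𝓘(ℝ, EH) Φ.toFun g)) (g₀ : G) :
    ∃ L : EG → EH →L[ℝ] EG, ContDiff ℝ ∞ L ∧ ∀ᶠ g in 𝓝 g₀,
      (∀ w : EH, ∃ v ∈ E.horizontal g,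
        mfderiv 𝓘(ℝ, EG) 𝓘(ℝ, EG) (extChartAt 𝓘(ℝ, EG) g₀) g v =
          L (extChartAt 𝓘(ℝ, EG) g₀ g) w ∧
        mfderiv 𝓘(ℝ, EG) 𝓘(ℝ, EH) (extChartAt 𝓘(ℝ, EH) (Φ.toFun g₀) ∘ Φ.toFun) g v = w) ∧
      ∀ v ∈ E.horizontal g, mfderiv 𝓘(ℝ, EG) 𝓘(ℝ, EG) (extChartAt 𝓘(ℝ, EG) g₀) g v =
          L (extChartAt 𝓘(ℝ, EG) g₀ g)
            (mfderiv 𝓘(ℝ, EG) 𝓘(ℝ, EH) (extChartAt 𝓘(ℝ, EH) (Φ.toFun g₀) ∘ Φ.toFun) g v) := by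
  let φ := extChartAt 𝓘(ℝ, EG) g₀
  let ψ := extChartAt 𝓘(ℝ, EH) (Φ.toFun g₀)
  -- the domain of the coordinate expression of `Φ`, in `G` and in the chart
  let W : Set G := φ.source ∩ Φ.toFun ⁻¹' ψ.source
  have hW : IsOpen W := (isOpen_extChartAt_source g₀).inter
    ((isOpen_extChartAt_source _).preimage Φ.contMDiff.continuous)
  have hg₀ : g₀ ∈ W := ⟨mem_extChartAt_source g₀, mem_extChartAt_source (Φ.toFun g₀)⟩
  let f : EG → EH := ψ ∘ Φ.toFun ∘ φ.symm
  have hsymm : ContMDiffOn 𝓘(ℝ, EG) 𝓘(ℝ, EG) ∞ φ.symm φ.target := contMDiffOn_extChartAt_symm g₀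
  have himg : ∀ V : Set G, IsOpen V → IsOpen (φ.target ∩ φ.symm ⁻¹' V) := fun V hV =>
    hsymm.continuousOn.isOpen_inter_preimage (isOpen_extChartAt_target g₀) hV
  have hψ : ContMDiffOn 𝓘(ℝ, EH) 𝓘(ℝ, EH) ∞ ψ ψ.source := contMDiffOn_extChartAt_source _
  have hψΦ : ContMDiffOn 𝓘(ℝ, EG) 𝓘(ℝ, EH) ∞ (ψ ∘ Φ.toFun) W :=
    hψ.comp Φ.contMDiff.contMDiffOn fun _ h => h.2
  have hf : ContDiffOn ℝ ∞ f (φ.target ∩ φ.symm ⁻¹' W) :=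
    (hψΦ.comp (hsymm.mono inter_subset_left) fun _ h => h.2).contDiffOn
  -- derivatives in the chart
  have hDf : ∀ g ∈ W, ∀ v : TangentSpace 𝓘(ℝ, EG) g,
      mfderiv 𝓘(ℝ, EG) 𝓘(ℝ, EH) (ψ ∘ Φ.toFun) g v =
        fderiv ℝ f (φ g) (mfderiv 𝓘(ℝ, EG) 𝓘(ℝ, EG) φ g v) := by
    intro g hg v
    have hg' : g ∈ (chartAt EG g₀).source := by simpa [φ] using hg.1
    have h1 : (ψ ∘ Φ.toFun) =ᶠ[𝓝 g] f ∘ φ := by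
      filter_upwards [hW.mem_nhds hg] with g' hg'
      simp only [f, Function.comp, φ.left_inv hg'.1]
    have h2 : MDifferentiableAt 𝓘(ℝ, EG) 𝓘(ℝ, EH) f (φ g) := by
      refine ((hf.contDiffAt ((himg W hW).mem_nhds ⟨φ.map_source hg.1, ?_⟩)).differentiableAt
        (by simp)).mdifferentiableAt
      rw [mem_preimage, φ.left_inv hg.1]; exact hg
    refine (DFunLike.congr_fun h1.mfderiv_eq v).trans
      ((mfderiv_comp_apply g h2 (mdifferentiableAt_extChartAt hg') v).trans ?_)
    exact DFunLike.congr_fun mfderiv_eq_fderiv _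
  -- a local frame of the connection
  have : FiniteDimensional ℝ (TangentSpace 𝓘(ℝ, EG) g₀) := inferInstanceAs (FiniteDimensional ℝ EG)
  let b := Module.finBasis ℝ (E.horizontal g₀)
  choose U hU hgU X hXs hXE hXb using fun i => E.smooth g₀ (b i) (b i).2
  let V : Set G := W ∩ ⋂ i, U i
  have hV : IsOpen V := hW.inter (isOpen_iInter_of_finite hU)
  have hg₀V : g₀ ∈ V := ⟨hg₀, mem_iInter.2 hgU⟩
  let Y : Fin (Module.finrank ℝ (E.horizontal g₀)) → EG → EG := fun i y =>
    mfderiv 𝓘(ℝ, EG) 𝓘(ℝ, EG) φ (φ.symm y) (X i (φ.symm y))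
  have hY : ∀ i, ContDiffOn ℝ ∞ (Y i) (φ.target ∩ φ.symm ⁻¹' V) := fun i =>
    (((hXs i).mfderiv_extChartAt_section (hU i) g₀).comp (hsymm.mono inter_subset_left)
      fun y hy => ⟨mem_iInter.1 hy.2.2 i, hy.2.1.1⟩).contDiffOn
  let B : EG → (Fin (Module.finrank ℝ (E.horizontal g₀)) → ℝ) →L[ℝ] EG := fun y =>
    ∑ i, (ContinuousLinearMap.proj i : (Fin _ → ℝ) →L[ℝ] ℝ).smulRight (Y i y)
  have hB : ContDiffOn ℝ ∞ B (φ.target ∩ φ.symm ⁻¹' V) :=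
    ContDiffOn.sum fun i _ => contDiffOn_const.smulRight (hY i)
  have hBX : ∀ g ∈ V, ∀ a, B (φ g) a = mfderiv 𝓘(ℝ, EG) 𝓘(ℝ, EG) φ g (∑ i, a i • X i g) := by
    intro g hg a
    have h1 : ∀ i, Y i (φ g) = mfderiv 𝓘(ℝ, EG) 𝓘(ℝ, EG) φ g (X i g) := fun i => by
      have h : ∀ g', g' = g → (mfderiv 𝓘(ℝ, EG) 𝓘(ℝ, EG) φ g' (X i g') : EG) =
          mfderiv 𝓘(ℝ, EG) 𝓘(ℝ, EG) φ g (X i g) := by rintro _ rfl; rfl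
      exact h _ (φ.left_inv hg.1.1)
    rw [map_sum]
    simp only [map_smul, ← h1]
    simp [B]
    rfl
  let A : EG → (Fin (Module.finrank ℝ (E.horizontal g₀)) → ℝ) →L[ℝ] EH := fun y =>
    (fderiv ℝ f y) ∘L (B y)
  have hVW : φ.target ∩ φ.symm ⁻¹' V ⊆ φ.target ∩ φ.symm ⁻¹' W := fun y hy => ⟨hy.1, hy.2.1⟩
  have hA : ContDiffOn ℝ ∞ A (φ.target ∩ φ.symm ⁻¹' V) :=
    ((hf.mono hVW).fderiv_of_isOpen (himg V hV) (by simp)).clm_comp hB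
  have hAX : ∀ g ∈ V, ∀ a, A (φ g) a =
      mfderiv 𝓘(ℝ, EG) 𝓘(ℝ, EH) (ψ ∘ Φ.toFun) g (∑ i, a i • X i g) := by
    intro g hg a
    rw [hDf g hg.1, ← hBX g hg]
    rfl
  have hcomp : ∀ g ∈ W, ∀ v : TangentSpace 𝓘(ℝ, EG) g,
      mfderiv 𝓘(ℝ, EG) 𝓘(ℝ, EH) (ψ ∘ Φ.toFun) g v =
      mfderiv 𝓘(ℝ, EH) 𝓘(ℝ, EH) ψ (Φ.toFun g) (mfderiv 𝓘(ℝ, EG) 𝓘(ℝ, EH) Φ.toFun g v) := by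
    intro g hg v
    exact mfderiv_comp_apply g (mdifferentiableAt_extChartAt (by simpa [ψ] using hg.2))
      (Φ.contMDiff.mdifferentiableAt (by simp)) v
  -- a horizontal vector that is mapped to zero vanishes
  have hinj : ∀ g ∈ W, ∀ v ∈ E.horizontal g,
      mfderiv 𝓘(ℝ, EG) 𝓘(ℝ, EH) (ψ ∘ Φ.toFun) g v = 0 → v = 0 := by
    intro g hg v hv h0
    rw [hcomp g hg] at h0
    have h1 := extChartAt_mfderiv_injective hg.2 (h0.trans (map_zero _).symm)
    exact Submodule.disjoint_def.1 (E.isCompl g).disjoint v h1 hv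
  have hbij : Function.Bijective (A (φ g₀)) := by
    constructor
    · rw [injective_iff_map_eq_zero]
      intro a ha
      rw [hAX g₀ hg₀V] at ha
      have h1 := hinj g₀ hg₀ _ (Submodule.sum_mem _ fun i _ =>
        Submodule.smul_mem _ _ (hXE i g₀ (hgU i))) ha
      simp only [hXb] at h1
      have h2 : ∑ i, a i • b i = 0 := Subtype.ext (by simpa using h1)
      funext i
      exact Fintype.linearIndependent_iff.1 b.linearIndependent a h2 i
    · intro w
      obtain ⟨u, hu⟩ := extChartAt_mfderiv_surjective hg₀.2 w
      obtain ⟨v, hv⟩ := hΦ g₀ u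
      obtain ⟨k, hk, h, hh, rfl⟩ := Submodule.mem_sup.1
        ((E.isCompl g₀).sup_eq_top ▸ Submodule.mem_top : v ∈ _)
      refine ⟨b.repr ⟨h, hh⟩, ?_⟩
      rw [hAX g₀ hg₀V]
      have h1 : ∑ i, (b.repr ⟨h, hh⟩) i • X i g₀ = h := by
        simp only [hXb]
        refine Eq.trans ?_ (congrArg Subtype.val (b.sum_repr ⟨h, hh⟩))
        rw [Submodule.coe_sum]
        rfl
      rw [h1, hcomp g₀ hg₀]
      rw [map_add, show mfderiv 𝓘(ℝ, EG) 𝓘(ℝ, EH) Φ.toFun g₀ k = 0 from hk, zero_add] at hv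
      rw [hv, hu]
  let e₀ := (LinearEquiv.ofBijective (A (φ g₀)).toLinearMap hbij).toContinuousLinearEquiv
  have he₀ : (e₀ : _ →L[ℝ] EH) = A (φ g₀) := by ext; rfl
  have hφV : φ.target ∩ φ.symm ⁻¹' V ∈ 𝓝 (φ g₀) := by
    refine (himg V hV).mem_nhds ⟨φ.map_source hg₀.1, ?_⟩
    rw [mem_preimage, φ.left_inv hg₀.1]
    exact hg₀V
  -- the points of the chart at which the frame is mapped to a frame
  let T : Set EG := (φ.target ∩ φ.symm ⁻¹' V) ∩ A ⁻¹'
    (range ((↑) : ((Fin (Module.finrank ℝ (E.horizontal g₀)) → ℝ) ≃L[ℝ] EH) → _ →L[ℝ] EH))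
  have hT : IsOpen T :=
    hA.continuousOn.isOpen_inter_preimage (himg V hV) ContinuousLinearEquiv.isOpen
  have hT₀ : φ g₀ ∈ T := ⟨mem_of_mem_nhds hφV, e₀, he₀⟩
  have hL₀ : ContDiffOn ℝ ∞ (fun y => (B y) ∘L (A y).inverse) T := by
    refine (hB.mono inter_subset_left).clm_comp fun y hy => ?_
    obtain ⟨e, he⟩ := hy.2
    have h1 : ContDiffAt ℝ ∞ A y := hA.contDiffAt ((himg V hV).mem_nhds hy.1)
    have h2 : ContDiffAt ℝ ∞ ContinuousLinearMap.inverse (A y) := he ▸ contDiffAt_map_inverse e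
    exact (h2.comp y h1).contDiffWithinAt
  obtain ⟨L, hL, hLeq⟩ := hL₀.exists_contDiff_eventuallyEq (hT.mem_nhds hT₀)
  refine ⟨L, hL, ?_⟩
  have hφc : ContinuousAt φ g₀ := continuousAt_extChartAt g₀
  filter_upwards [hV.mem_nhds hg₀V, hφc.eventually hLeq, hφc.eventually (hT.mem_nhds hT₀)]
    with g hg hLg hTg
  have hex : ∀ w : EH, ∃ v ∈ E.horizontal g,
      mfderiv 𝓘(ℝ, EG) 𝓘(ℝ, EG) φ g v = L (φ g) w ∧
      mfderiv 𝓘(ℝ, EG) 𝓘(ℝ, EH) (ψ ∘ Φ.toFun) g v = w := by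
    intro w
    obtain ⟨e, he⟩ := hTg.2
    refine ⟨∑ i, e.symm w i • X i g, Submodule.sum_mem _ fun i _ =>
      Submodule.smul_mem _ _ (hXE i g (mem_iInter.1 hg.2 i)), ?_, ?_⟩
    · rw [← hBX g hg, hLg, ← he]
      simp
      rfl
    · rw [← hAX g hg, ← he]
      simp
      rfl
  refine ⟨hex, fun v hv => ?_⟩
  obtain ⟨v', hv', h1, h2⟩ := hex (mfderiv 𝓘(ℝ, EG) 𝓘(ℝ, EH) (ψ ∘ Φ.toFun) g v)
  have h3 : v - v' = 0 := hinj g hg.1 _ (Submodule.sub_mem _ hv hv') (by rw [map_sub, h2, sub_self])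
  rw [sub_eq_zero] at h3
  conv_lhs => rw [h3]
  exact h1

end LieGroupoid

/-! ### Velocities of curves in manifolds -/

section Velocity

variable {E : Type*} [NormedAddCommGroup E] [NormedSpace ℝ E]
  {M : Type*} [TopologicalSpace M] [ChartedSpace E M]
  {E' : Type*} [NormedAddCommGroup E'] [NormedSpace ℝ E']
  {M' : Type*} [TopologicalSpace M'] [ChartedSpace E' M']

/-- The curve `γ` has velocity `v` at time `t`, within the set `s` of times. -/
def HasVelocityWithinAt (γ : ℝ → M) (s : Set ℝ) (t : ℝ) (v : TangentSpace 𝓘(ℝ, E) (γ t)) : Prop :=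
  HasMFDerivWithinAt 𝓘(ℝ, ℝ) 𝓘(ℝ, E) γ s t (ContinuousLinearMap.toSpanSingleton ℝ v)

namespace HasVelocityWithinAt

variable {γ : ℝ → M} {s s' : Set ℝ} {t : ℝ} {v v' : TangentSpace 𝓘(ℝ, E) (γ t)}

theorem continuousWithinAt (h : HasVelocityWithinAt γ s t v) : ContinuousWithinAt γ s t :=
  HasMFDerivWithinAt.continuousWithinAt h

theorem mono (h : HasVelocityWithinAt γ s t v) (hs : s' ⊆ s) : HasVelocityWithinAt γ s' t v :=
  HasMFDerivWithinAt.mono h hs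

theorem union (h : HasVelocityWithinAt γ s t v) (h' : HasVelocityWithinAt γ s' t v) :
    HasVelocityWithinAt γ (s ∪ s') t v :=
  HasMFDerivWithinAt.union h h'

theorem of_mem_nhdsWithin (h : HasVelocityWithinAt γ s t v) (hs : s ∈ 𝓝[s'] t) :
    HasVelocityWithinAt γ s' t v :=
  HasMFDerivWithinAt.mono_of_mem_nhdsWithin h hs

theorem comp {f : M → M'} {u : Set M}
    {D : TangentSpace 𝓘(ℝ, E) (γ t) →L[ℝ] TangentSpace 𝓘(ℝ, E') (f (γ t))}
    (hf : HasMFDerivWithinAt 𝓘(ℝ, E) 𝓘(ℝ, E') f u (γ t) D) (h : HasVelocityWithinAt γ s t v)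
    (hu : MapsTo γ s u) : HasVelocityWithinAt (f ∘ γ) s t (D v) := by
  have h1 := HasMFDerivWithinAt.comp t hf h hu
  refine h1.congr_mfderiv ?_
  ext
  exact (congrArg D (one_smul ℝ v)).trans (one_smul ℝ (D v)).symm

theorem comp_mfderiv {f : M → M'} (hf : MDifferentiableAt 𝓘(ℝ, E) 𝓘(ℝ, E') f (γ t))
    (h : HasVelocityWithinAt γ s t v) :
    HasVelocityWithinAt (f ∘ γ) s t (mfderiv 𝓘(ℝ, E) 𝓘(ℝ, E') f (γ t) v) :=
  h.comp hf.hasMFDerivAt.hasMFDerivWithinAt (mapsTo_univ _ _)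

theorem mfderivWithin (h : HasVelocityWithinAt γ s t v) (hs : UniqueDiffWithinAt ℝ s t) :
    mfderivWithin 𝓘(ℝ, ℝ) 𝓘(ℝ, E) γ s t (1 : ℝ) = v := by
  have h1 := HasMFDerivWithinAt.mfderivWithin h hs.uniqueMDiffWithinAt
  refine (DFunLike.congr_fun h1 (1 : ℝ)).trans ?_
  exact one_smul ℝ v

theorem unique (h : HasVelocityWithinAt γ s t v) (h' : HasVelocityWithinAt γ s t v')
    (hs : UniqueDiffWithinAt ℝ s t) : v = v' :=
  (h.mfderivWithin hs).symm.trans (h'.mfderivWithin hs)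

theorem comp_time {θ : ℝ → ℝ} {c : ℝ} {w : TangentSpace 𝓘(ℝ, E) (γ (θ t))}
    (h : HasVelocityWithinAt γ s (θ t) w) (hθ : HasDerivWithinAt θ c s' t) (hs : MapsTo θ s' s) :
    HasVelocityWithinAt (γ ∘ θ) s' t (c • w) := by
  have h1 := HasMFDerivWithinAt.comp t h hθ.hasFDerivWithinAt.hasMFDerivWithinAt hs
  refine h1.congr_mfderiv ?_
  ext
  exact smul_assoc (1 : ℝ) c w

theorem congr {γ' : ℝ → M} {w : TangentSpace 𝓘(ℝ, E) (γ' t)} (h : HasVelocityWithinAt γ s t v)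
    (hγ : EqOn γ' γ s) (ht : t ∈ s) (hw : (w : E) = v) : HasVelocityWithinAt γ' s t w := by
  have h1 := HasMFDerivWithinAt.congr_mono h hγ (hγ ht) Subset.rfl
  refine h1.congr_mfderiv ?_
  rw [← hw]
  rfl

end HasVelocityWithinAt

theorem hasVelocityWithinAt_iff_hasDerivWithinAt {γ : ℝ → E} {s : Set ℝ} {t : ℝ} {v : E} :
    HasVelocityWithinAt (E := E) γ s t v ↔ HasDerivWithinAt γ v s t :=
  hasMFDerivWithinAt_iff_hasFDerivWithinAt

theorem MDifferentiableWithinAt.hasVelocityWithinAt {γ : ℝ → M} {s : Set ℝ} {t : ℝ}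
    (h : MDifferentiableWithinAt 𝓘(ℝ, ℝ) 𝓘(ℝ, E) γ s t) :
    HasVelocityWithinAt γ s t (mfderivWithin 𝓘(ℝ, ℝ) 𝓘(ℝ, E) γ s t (1 : ℝ)) := by
  refine h.hasMFDerivWithinAt.congr_mfderiv ?_
  ext
  exact (one_smul ℝ _).symm

end Velocity

/-- Induction along an interval: a property of times that propagates to the right over short
intervals around every time propagates over the whole interval. -/
theorem interval_induction {a b : ℝ} (hab : a ≤ b) {Q : ℝ → Prop} (ha : Q a)
    (h : ∀ t ∈ Icc a b, ∃ ε > 0, ∀ s ∈ Icc a b, ∀ s' ∈ Icc a b, s ≤ s' → |s - t| < ε →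
      |s' - t| < ε → Q s → Q s') : Q b := by
  choose! ε hε hQ using h
  obtain ⟨τ, hτ0, hτm, ⟨m, hm⟩, hτ⟩ := exists_monotone_Icc_subset_open_cover_Icc hab
    (c := fun t : Icc a b => Metric.ball t (ε t)) (fun _ => Metric.isOpen_ball)
    fun t _ => mem_iUnion.2 ⟨t, Metric.mem_ball_self (hε t t.2)⟩
  have key : ∀ n, Q (τ n) := by
    intro n
    induction n with
    | zero => rwa [hτ0]
    | succ n ih =>
      obtain ⟨t, ht⟩ := hτ n
      exact hQ t t.2 _ (τ n).2 _ (τ (n + 1)).2 (hτm n.le_succ)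
        (ht (left_mem_Icc.2 (hτm n.le_succ))) (ht (right_mem_Icc.2 (hτm n.le_succ))) ih
  rw [← hm m le_rfl]
  exact key m

namespace LieGroupoid

/-! ### Horizontal lifts of paths -/

variable {EM : Type*} [NormedAddCommGroup EM] [NormedSpace ℝ EM]
  {EG : Type*} [NormedAddCommGroup EG] [NormedSpace ℝ EG]
  {EH : Type*} [NormedAddCommGroup EH] [NormedSpace ℝ EH]
  {M : Type*} [TopologicalSpace M] [ChartedSpace EM M]
  {G : Type*} [TopologicalSpace G] [ChartedSpace EG G] [IsManifold 𝓘(ℝ, EG) ∞ G]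
  {H : Type*} [TopologicalSpace H] [ChartedSpace EH H]
  {𝒢 : LieGroupoid (EM := EM) (EG := EG) M G} {ℋ : LieGroupoid (EM := EM) (EG := EH) M H}
  {Φ : Hom 𝒢 ℋ}

/-- The curve `γ` is a horizontal lift of `η` over the interval `[a, b]`. Only differentiability is
asked for; a lift of a smooth path is smooth. -/
def IsLift (E : MultiplicativeConnection Φ) (η : ℝ → H) (γ : ℝ → G) (a b : ℝ) : Prop :=
  ∀ t ∈ Icc a b, Φ.toFun (γ t) = η t ∧
    ∃ v ∈ E.horizontal (γ t), HasVelocityWithinAt γ (Icc a b) t v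

/-- `L` is the horizontal lift operator of the connection in the charts at `g₀` and `Φ g₀`, on the
open set `V`. -/
structure IsChartLift [IsManifold 𝓘(ℝ, EH) ∞ H] (E : MultiplicativeConnection Φ) (g₀ : G)
    (L : EG → EH →L[ℝ] EG) (V : Set G) : Prop where
  contDiff : ContDiff ℝ ∞ L
  isOpen : IsOpen V
  mem : g₀ ∈ V
  subset_source : V ⊆ (extChartAt 𝓘(ℝ, EG) g₀).source
  mapsTo : MapsTo Φ.toFun V (extChartAt 𝓘(ℝ, EH) (Φ.toFun g₀)).source
  exists_horizontal : ∀ g ∈ V, ∀ w : EH, ∃ v ∈ E.horizontal g,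
    mfderiv 𝓘(ℝ, EG) 𝓘(ℝ, EG) (extChartAt 𝓘(ℝ, EG) g₀) g v = L (extChartAt 𝓘(ℝ, EG) g₀ g) w ∧
    mfderiv 𝓘(ℝ, EG) 𝓘(ℝ, EH) (extChartAt 𝓘(ℝ, EH) (Φ.toFun g₀) ∘ Φ.toFun) g v = w
  eq_lift : ∀ g ∈ V, ∀ v ∈ E.horizontal g,
    mfderiv 𝓘(ℝ, EG) 𝓘(ℝ, EG) (extChartAt 𝓘(ℝ, EG) g₀) g v = L (extChartAt 𝓘(ℝ, EG) g₀ g)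
      (mfderiv 𝓘(ℝ, EG) 𝓘(ℝ, EH) (extChartAt 𝓘(ℝ, EH) (Φ.toFun g₀) ∘ Φ.toFun) g v)

theorem exists_isChartLift [IsManifold 𝓘(ℝ, EH) ∞ H] [FiniteDimensional ℝ EG]
    (E : MultiplicativeConnection Φ)
    (hΦ : ∀ g, Function.Surjective (mfderiv 𝓘(ℝ, EG) 𝓘(ℝ, EH) Φ.toFun g)) (g₀ : G) :
    ∃ L V, IsChartLift E g₀ L V := by
  obtain ⟨L, hL, h⟩ := E.exists_lift_in_charts hΦ g₀
  obtain ⟨U, hU, hUo, hgU⟩ := eventually_nhds_iff.1 h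
  refine ⟨L, U ∩ ((extChartAt 𝓘(ℝ, EG) g₀).source ∩
    Φ.toFun ⁻¹' (extChartAt 𝓘(ℝ, EH) (Φ.toFun g₀)).source), hL, ?_, ?_, ?_, ?_, ?_, ?_⟩
  · exact hUo.inter ((isOpen_extChartAt_source g₀).inter
      ((isOpen_extChartAt_source _).preimage Φ.contMDiff.continuous))
  · exact ⟨hgU, mem_extChartAt_source g₀, mem_extChartAt_source (Φ.toFun g₀)⟩
  · exact fun g hg => hg.2.1
  · exact fun g hg => hg.2.2
  · exact fun g hg => (hU g hg.1).1
  · exact fun g hg => (hU g hg.1).2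

namespace IsLift

variable {E : MultiplicativeConnection Φ} {η : ℝ → H} {γ : ℝ → G} {a b : ℝ}

theorem continuousOn (h : IsLift E η γ a b) : ContinuousOn γ (Icc a b) := fun t ht =>
  let ⟨_, _, hv⟩ := (h t ht).2
  hv.continuousWithinAt

theorem mono {a' b' : ℝ} (h : IsLift E η γ a b) (ha : a ≤ a') (hb : b' ≤ b) :
    IsLift E η γ a' b' := fun t ht =>
  let ⟨v, hv, hvt⟩ := (h t (Icc_subset_Icc ha hb ht)).2
  ⟨(h t (Icc_subset_Icc ha hb ht)).1, v, hv, hvt.mono (Icc_subset_Icc ha hb)⟩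

theorem congr {γ' : ℝ → G} (h : IsLift E η γ a b) (hγ : EqOn γ' γ (Icc a b)) :
    IsLift E η γ' a b := by
  intro t ht
  obtain ⟨h1, v, hv, hvt⟩ := h t ht
  have key : ∀ g, g = γ t → ∃ w : TangentSpace 𝓘(ℝ, EG) g, w ∈ E.horizontal g ∧ (w : EG) = v := by
    rintro _ rfl
    exact ⟨v, hv, rfl⟩
  obtain ⟨w, hw, hwv⟩ := key _ (hγ ht)
  exact ⟨by rw [hγ ht, h1], w, hw, hvt.congr hγ ht hwv⟩

end IsLift

section Chart

variable [IsManifold 𝓘(ℝ, EH) ∞ H] {E : MultiplicativeConnection Φ} {η : ℝ → H} {γ : ℝ → G}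
  {a b : ℝ} {g₀ : G} {L : EG → EH →L[ℝ] EG} {V : Set G}

/-- In a chart, a horizontal lift solves an ordinary differential equation. -/
theorem IsLift.hasDerivWithinAt (h : IsLift E η γ a b) (hL : IsChartLift E g₀ L V)
    (hab : a < b) {t : ℝ} (ht : t ∈ Icc a b) (hV : γ t ∈ V) {c : EH}
    (hc : HasDerivWithinAt (extChartAt 𝓘(ℝ, EH) (Φ.toFun g₀) ∘ η) c (Icc a b) t) :
    HasDerivWithinAt (extChartAt 𝓘(ℝ, EG) g₀ ∘ γ) (L (extChartAt 𝓘(ℝ, EG) g₀ (γ t)) c)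
      (Icc a b) t := by
  obtain ⟨_, v, hv, hvt⟩ := h t ht
  have h1 : MDifferentiableAt 𝓘(ℝ, EG) 𝓘(ℝ, EG) (extChartAt 𝓘(ℝ, EG) g₀) (γ t) :=
    mdifferentiableAt_extChartAt (by simpa using hL.subset_source hV)
  have h2 : MDifferentiableAt 𝓘(ℝ, EG) 𝓘(ℝ, EH)
      (extChartAt 𝓘(ℝ, EH) (Φ.toFun g₀) ∘ Φ.toFun) (γ t) :=
    MDifferentiableAt.comp _ (mdifferentiableAt_extChartAt (by simpa using hL.mapsTo hV))
      (Φ.contMDiff.mdifferentiableAt (by simp))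
  have h3 : HasDerivWithinAt ((extChartAt 𝓘(ℝ, EH) (Φ.toFun g₀) ∘ Φ.toFun) ∘ γ) _ (Icc a b) t :=
    hasVelocityWithinAt_iff_hasDerivWithinAt.1 (hvt.comp_mfderiv h2)
  have h4 : HasDerivWithinAt ((extChartAt 𝓘(ℝ, EH) (Φ.toFun g₀) ∘ Φ.toFun) ∘ γ) c (Icc a b) t :=
    hc.congr_of_mem (fun r hr => by simp [(h r hr).1]) ht
  have h5 := (uniqueDiffOn_Icc hab t ht).eq_deriv _ h3 h4
  have h6 := hasVelocityWithinAt_iff_hasDerivWithinAt.1 (hvt.comp_mfderiv h1)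
  have h7 := hL.eq_lift _ hV v hv
  refine h6.congr_deriv (h7.trans ?_)
  exact congrArg _ h5

/-- A solution of the differential equation in the chart is a horizontal lift. -/
theorem IsChartLift.isLift (hL : IsChartLift E g₀ L V) {y : ℝ → EG} {c : ℝ → EH}
    (hy : ∀ t ∈ Icc a b, y t ∈ (extChartAt 𝓘(ℝ, EG) g₀).target ∧
      (extChartAt 𝓘(ℝ, EG) g₀).symm (y t) ∈ V)
    (hyd : ∀ t ∈ Icc a b, HasDerivWithinAt y (L (y t) (c t)) (Icc a b) t)
    (hη : ∀ t ∈ Icc a b, η t ∈ (extChartAt 𝓘(ℝ, EH) (Φ.toFun g₀)).source)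
    (hc : ∀ t ∈ Icc a b,
      HasDerivWithinAt (extChartAt 𝓘(ℝ, EH) (Φ.toFun g₀) ∘ η) (c t) (Icc a b) t)
    (h0 : Φ.toFun ((extChartAt 𝓘(ℝ, EG) g₀).symm (y a)) = η a) :
    IsLift E η ((extChartAt 𝓘(ℝ, EG) g₀).symm ∘ y) a b := by
  set φ := extChartAt 𝓘(ℝ, EG) g₀ with hφ
  set ψ := extChartAt 𝓘(ℝ, EH) (Φ.toFun g₀) with hψ
  have hvel : ∀ t ∈ Icc a b, ∃ v ∈ E.horizontal (φ.symm (y t)),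
      HasVelocityWithinAt (φ.symm ∘ y) (Icc a b) t v ∧
      mfderiv 𝓘(ℝ, EG) 𝓘(ℝ, EH) (ψ ∘ Φ.toFun) (φ.symm (y t)) v = c t := by
    intro t ht
    obtain ⟨v, hv, hv1, hv2⟩ := hL.exists_horizontal _ (hy t ht).2 (c t)
    refine ⟨v, hv, ?_, hv2⟩
    have h1 : MDifferentiableAt 𝓘(ℝ, EG) 𝓘(ℝ, EG) φ.symm (y t) :=
      ((contMDiffOn_extChartAt_symm (n := ∞) g₀).contMDiffAt
        ((isOpen_extChartAt_target g₀).mem_nhds (hy t ht).1)).mdifferentiableAt (by simp)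
    have h2 := (hasVelocityWithinAt_iff_hasDerivWithinAt.2 (hyd t ht)).comp_mfderiv h1
    refine h2.congr (fun _ _ => rfl) ht ?_
    have h3 := DFunLike.congr_fun (mfderivWithin_extChartAt_symm_comp_mfderiv_extChartAt
      (I := 𝓘(ℝ, EG)) (hy t ht).1) v
    rw [ModelWithCorners.range_eq_univ, mfderivWithin_univ] at h3
    refine h3.symm.trans ?_
    refine congrArg (mfderiv 𝓘(ℝ, EG) 𝓘(ℝ, EG) φ.symm (y t)) ?_
    refine hv1.trans ?_
    rw [φ.right_inv (hy t ht).1]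
  have hder : ∀ t ∈ Icc a b,
      HasDerivWithinAt (ψ ∘ Φ.toFun ∘ φ.symm ∘ y) (c t) (Icc a b) t := by
    intro t ht
    obtain ⟨v, hv, hvt, hvc⟩ := hvel t ht
    have h2 : MDifferentiableAt 𝓘(ℝ, EG) 𝓘(ℝ, EH) (ψ ∘ Φ.toFun) (φ.symm (y t)) :=
      MDifferentiableAt.comp _
        (mdifferentiableAt_extChartAt (by simpa using hL.mapsTo (hy t ht).2))
        (Φ.contMDiff.mdifferentiableAt (by simp))
    have h3 : HasDerivWithinAt ((ψ ∘ Φ.toFun) ∘ φ.symm ∘ y) _ (Icc a b) t :=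
      hasVelocityWithinAt_iff_hasDerivWithinAt.1 (hvt.comp_mfderiv h2)
    exact h3.congr_deriv hvc
  -- both sides have the same coordinate derivative and the same initial value
  have heq : ∀ t ∈ Icc a b, (ψ ∘ Φ.toFun ∘ φ.symm ∘ y) t = (ψ ∘ η) t := by
    refine eq_of_has_deriv_right_eq (f' := c)
      (fun t ht => ?_) (fun t ht => ?_) (fun t ht => (hder t ht).continuousWithinAt)
      (fun t ht => (hc t ht).continuousWithinAt) (by simp [h0])
    · exact (hder t (Ico_subset_Icc_self ht)).mono_of_mem_nhdsWithin
        (Icc_mem_nhdsGE_of_mem ht)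
    · exact (hc t (Ico_subset_Icc_self ht)).mono_of_mem_nhdsWithin
        (Icc_mem_nhdsGE_of_mem ht)
  intro t ht
  obtain ⟨v, hv, hvt, -⟩ := hvel t ht
  exact ⟨ψ.injOn (hL.mapsTo (hy t ht).2) (hη t ht) (heq t ht), v, hv, hvt⟩

end Chart

end LieGroupoid

/-! ### Uniqueness, smoothness and products of horizontal lifts -/

namespace LieGroupoid

variable {EM : Type*} [NormedAddCommGroup EM] [NormedSpace ℝ EM]
  {EG : Type*} [NormedAddCommGroup EG] [NormedSpace ℝ EG]
  {EH : Type*} [NormedAddCommGroup EH] [NormedSpace ℝ EH]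
  {M : Type*} [TopologicalSpace M] [ChartedSpace EM M]
  {G : Type*} [TopologicalSpace G] [ChartedSpace EG G] [IsManifold 𝓘(ℝ, EG) ∞ G]
  {H : Type*} [TopologicalSpace H] [ChartedSpace EH H]
  {𝒢 : LieGroupoid (EM := EM) (EG := EG) M G} {ℋ : LieGroupoid (EM := EM) (EG := EH) M H}
  {Φ : Hom 𝒢 ℋ}

/-- A smooth path in the domain of a chart has a smooth coordinate derivative. -/
theorem exists_hasDerivWithinAt_extChartAt [IsManifold 𝓘(ℝ, EH) ∞ H] {η : ℝ → H} {a b : ℝ}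
    (hab : a < b) (hη : ContMDiffOn 𝓘(ℝ, ℝ) 𝓘(ℝ, EH) ∞ η (Icc a b)) {h₀ : H}
    (hs : ∀ t ∈ Icc a b, η t ∈ (extChartAt 𝓘(ℝ, EH) h₀).source) :
    ∃ c : ℝ → EH, ContDiffOn ℝ ∞ c (Icc a b) ∧ ∀ t ∈ Icc a b,
      HasDerivWithinAt (extChartAt 𝓘(ℝ, EH) h₀ ∘ η) (c t) (Icc a b) t := by
  have h1 : ContDiffOn ℝ ∞ (extChartAt 𝓘(ℝ, EH) h₀ ∘ η) (Icc a b) :=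
    ((contMDiffOn_extChartAt_source h₀).comp hη hs).contDiffOn
  exact ⟨derivWithin (extChartAt 𝓘(ℝ, EH) h₀ ∘ η) (Icc a b),
    h1.derivWithin (uniqueDiffOn_Icc hab) (by simp),
    fun t ht => (h1.differentiableOn (by simp) t ht).hasDerivWithinAt⟩

variable {E : MultiplicativeConnection Φ} {η : ℝ → H} {γ : ℝ → G} {a b : ℝ}

theorem IsLift.eventually_mem (h : IsLift E η γ a b) {t : ℝ} (ht : t ∈ Icc a b) {W : Set G}
    (hW : W ∈ 𝓝 (γ t)) : ∃ ε > 0, ∀ s ∈ Icc a b, |s - t| < ε → γ s ∈ W := by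
  obtain ⟨ε, hε, hεW⟩ := Metric.mem_nhdsWithin_iff.1 (h.continuousOn t ht hW)
  exact ⟨ε, hε, fun s hs hst => hεW ⟨hst, hs⟩⟩

/-- Horizontal lifts are determined by their initial point: near times at which two lifts differ
they stay different, as `G` is Hausdorff, and near times at which they agree they solve the same
Lipschitz equation in a chart. -/
theorem IsLift.eqOn [IsManifold 𝓘(ℝ, EH) ∞ H] [FiniteDimensional ℝ EG] [T2Space G]
    (hΦ : ∀ g, Function.Surjective (mfderiv 𝓘(ℝ, EG) 𝓘(ℝ, EH) Φ.toFun g))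
    (hη : ContMDiffOn 𝓘(ℝ, ℝ) 𝓘(ℝ, EH) ∞ η (Icc a b)) {γ' : ℝ → G}
    (h : IsLift E η γ a b) (h' : IsLift E η γ' a b) (ha : γ a = γ' a) :
    EqOn γ γ' (Icc a b) := by
  intro b' hb'
  replace h := h.mono le_rfl hb'.2
  replace h' := h'.mono le_rfl hb'.2
  replace hη := hη.mono (Icc_subset_Icc_right hb'.2)
  refine interval_induction (Q := fun t => γ t = γ' t) hb'.1 ha fun t ht => ?_
  by_cases hne : γ t = γ' t
  swap
  · obtain ⟨U, U', hU, hU', htU, htU', hd⟩ := t2_separation hne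
    obtain ⟨ε, hε, h1⟩ := h.eventually_mem ht (hU.mem_nhds htU)
    obtain ⟨ε', hε', h2⟩ := h'.eventually_mem ht (hU'.mem_nhds htU')
    refine ⟨min ε ε', lt_min hε hε', fun s hs _ _ _ hst _ hss => ?_⟩
    exact (disjoint_left.1 hd (h1 s hs (hst.trans_le (min_le_left _ _)))
      (hss ▸ h2 s hs (hst.trans_le (min_le_right _ _)))).elim
  obtain ⟨L, V, hL⟩ := exists_isChartLift E hΦ (γ t)
  obtain ⟨K, S, hS, hK⟩ := (hL.contDiff.contDiffAt (x := extChartAt 𝓘(ℝ, EG) (γ t) (γ t))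
    |>.of_le (by simp : (1 : WithTop ℕ∞) ≤ ∞)).exists_lipschitzOnWith
  have hW : V ∩ extChartAt 𝓘(ℝ, EG) (γ t) ⁻¹' S ∈ 𝓝 (γ t) :=
    Filter.inter_mem (hL.isOpen.mem_nhds hL.mem) (continuousAt_extChartAt (γ t) hS)
  obtain ⟨ε, hε, h1⟩ := h.eventually_mem ht hW
  obtain ⟨ε', hε', h2⟩ := h'.eventually_mem ht
    (W := V ∩ extChartAt 𝓘(ℝ, EG) (γ t) ⁻¹' S) (by rw [← hne]; exact hW)
  refine ⟨min ε ε', lt_min hε hε', fun s hs s' hs' hss' hst hst' heq => ?_⟩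
  rcases hss'.eq_or_lt with rfl | hlt
  · exact heq
  have hsub : Icc s s' ⊆ Icc a b' := Icc_subset_Icc hs.1 hs'.2
  have hnear : ∀ r ∈ Icc s s', |r - t| < min ε ε' := fun r hr =>
    abs_sub_lt_iff.2 ⟨by linarith [(abs_sub_lt_iff.1 hst').1, hr.2],
      by linarith [(abs_sub_lt_iff.1 hst).2, hr.1]⟩
  have g1 := fun r hr => h1 r (hsub hr) ((hnear r hr).trans_le (min_le_left _ _))
  have g2 := fun r hr => h2 r (hsub hr) ((hnear r hr).trans_le (min_le_right _ _))
  obtain ⟨c, hcs, hc⟩ := exists_hasDerivWithinAt_extChartAt hlt (hη.mono hsub)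
    (h₀ := Φ.toFun (γ t)) fun r hr => by
      rw [← (h r (hsub hr)).1]; exact hL.mapsTo (g1 r hr).1
  obtain ⟨C, hC⟩ := isCompact_Icc.exists_bound_of_continuousOn hcs.continuousOn
  have hd1 := fun r hr => (h.mono hs.1 hs'.2).hasDerivWithinAt hL hlt hr (g1 r hr).1 (hc r hr)
  have hd2 := fun r hr => (h'.mono hs.1 hs'.2).hasDerivWithinAt hL hlt hr (g2 r hr).1 (hc r hr)
  have hsol := ODE_solution_unique_of_mem_Icc_right (a := s) (b := s')
    (v := fun r y => L y (c r)) (s := fun _ => S) (K := K * C.toNNReal)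
    (f := extChartAt 𝓘(ℝ, EG) (γ t) ∘ γ) (g := extChartAt 𝓘(ℝ, EG) (γ t) ∘ γ')
    (fun r hr => by
      refine LipschitzOnWith.of_dist_le_mul fun y hy z hz => ?_
      rw [dist_eq_norm, ← sub_apply]
      refine (ContinuousLinearMap.le_opNorm _ _).trans ?_
      have e1 := hK.dist_le_mul y hy z hz
      rw [dist_eq_norm] at e1
      have e2 : ‖c r‖ ≤ C.toNNReal := (hC r (Ico_subset_Icc_self hr)).trans (Real.le_coe_toNNReal C)
      calc _ ≤ (K * dist y z) * C.toNNReal :=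
            mul_le_mul e1 e2 (norm_nonneg _) (by positivity)
        _ = _ := by push_cast; ring)
    (fun r hr => (hd1 r hr).continuousWithinAt)
    (fun r hr => (hd1 r (Ico_subset_Icc_self hr)).mono_of_mem_nhdsWithin
      (Icc_mem_nhdsGE_of_mem hr))
    (fun r hr => (g1 r (Ico_subset_Icc_self hr)).2)
    (fun r hr => (hd2 r hr).continuousWithinAt)
    (fun r hr => (hd2 r (Ico_subset_Icc_self hr)).mono_of_mem_nhdsWithin
      (Icc_mem_nhdsGE_of_mem hr))
    (fun r hr => (g2 r (Ico_subset_Icc_self hr)).2)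
    (by simp [heq])
  have hs'' : s' ∈ Icc s s' := right_mem_Icc.2 hss'
  exact (extChartAt 𝓘(ℝ, EG) (γ t)).injOn (hL.subset_source (g1 s' hs'').1)
    (hL.subset_source (g2 s' hs'').1) (hsol hs'')

/-- Horizontal lifts of smooth paths are smooth, as solutions of an equation with smooth
coefficients in charts. -/
theorem IsLift.contMDiffOn [IsManifold 𝓘(ℝ, EH) ∞ H] [FiniteDimensional ℝ EG]
    (hΦ : ∀ g, Function.Surjective (mfderiv 𝓘(ℝ, EG) 𝓘(ℝ, EH) Φ.toFun g)) (hab : a < b)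
    (hη : ContMDiffOn 𝓘(ℝ, ℝ) 𝓘(ℝ, EH) ∞ η (Icc a b)) (h : IsLift E η γ a b) :
    ContMDiffOn 𝓘(ℝ, ℝ) 𝓘(ℝ, EG) ∞ γ (Icc a b) := by
  intro t ht
  obtain ⟨L, V, hL⟩ := exists_isChartLift E hΦ (γ t)
  obtain ⟨ε, hε, h1⟩ := h.eventually_mem ht (hL.isOpen.mem_nhds hL.mem)
  let a' := max a (t - ε / 2)
  let b' := min b (t + ε / 2)
  have ha : a ≤ a' := le_max_left _ _
  have hb : b' ≤ b := min_le_left _ _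
  have hab' : a' < b' := by
    apply max_lt <;> apply lt_min <;> linarith [ht.1, ht.2]
  have hI : Icc a' b' = Icc a b ∩ Icc (t - ε / 2) (t + ε / 2) := Icc_inter_Icc.symm
  have hsub : Icc a' b' ⊆ Icc a b := hI ▸ inter_subset_left
  have hmem : t ∈ Icc a' b' := by rw [hI]; exact ⟨ht, by linarith, by linarith⟩
  have hnhds : Icc a' b' ∈ 𝓝[Icc a b] t := by
    rw [hI]
    exact inter_mem_nhdsWithin _ (Icc_mem_nhds (by linarith) (by linarith))
  have hV : ∀ r ∈ Icc a' b', γ r ∈ V := fun r hr => h1 r (hsub hr) (by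
    rw [hI] at hr
    exact abs_sub_lt_iff.2 ⟨by linarith [hr.2.2], by linarith [hr.2.1]⟩)
  obtain ⟨c, hcs, hc⟩ := exists_hasDerivWithinAt_extChartAt hab' (hη.mono hsub)
    (h₀ := Φ.toFun (γ t)) fun r hr => by
      rw [← (h r (hsub hr)).1]; exact hL.mapsTo (hV r hr)
  have hode : ContDiffOn ℝ ∞ (extChartAt 𝓘(ℝ, EG) (γ t) ∘ γ) (Icc a' b') := by
    refine ODE.contDiffOn_enat_Icc_of_hasDerivWithinAt (f := fun r y => L y (c r)) (u := univ)
      (n := ⊤) ?_ (fun r hr => (h.mono ha hb).hasDerivWithinAt hL hab' hr (hV r hr) (hc r hr))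
      (mapsTo_univ _ _)
    exact (hL.contDiff.comp contDiff_snd).contDiffOn.clm_apply
      (hcs.comp contDiffOn_fst fun p hp => hp.1)
  have hsm : ContMDiffOn 𝓘(ℝ, ℝ) 𝓘(ℝ, EG) ∞ γ (Icc a' b') := by
    refine ((contMDiffOn_extChartAt_symm (n := ∞) (γ t)).comp hode.contMDiffOn
      fun r hr => ?_).congr fun r hr => ?_
    · exact (extChartAt 𝓘(ℝ, EG) (γ t)).map_source (hL.subset_source (hV r hr))
    · exact ((extChartAt 𝓘(ℝ, EG) (γ t)).left_inv (hL.subset_source (hV r hr))).symm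
  exact (hsm t hmem).mono_of_mem_nhdsWithin hnhds

/-- The velocity of a lift projects to that of the path. -/
theorem IsLift.hasVelocityWithinAt_base (h : IsLift E η γ a b) {t : ℝ} (ht : t ∈ Icc a b)
    {v : TangentSpace 𝓘(ℝ, EG) (γ t)} (hv : HasVelocityWithinAt γ (Icc a b) t v)
    {u : TangentSpace 𝓘(ℝ, EH) (η t)} (hu : HasVelocityWithinAt η (Icc a b) t u) (hab : a < b) :
    (mfderiv 𝓘(ℝ, EG) 𝓘(ℝ, EH) Φ.toFun (γ t) v : EH) = u := by
  have h1 := hv.comp_mfderiv (Φ.contMDiff.mdifferentiableAt (by simp))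
  have h2 : HasVelocityWithinAt η (Icc a b) t
      (mfderiv 𝓘(ℝ, EG) 𝓘(ℝ, EH) Φ.toFun (γ t) v : EH) :=
    h1.congr (fun r hr => (h r hr).1.symm) ht rfl
  exact h2.unique hu (uniqueDiffOn_Icc hab t ht)

/-- Two consecutive pieces of a curve that are horizontal lifts form a horizontal lift: at the
common point the one-sided velocities agree, being horizontal with the same projection. -/
theorem IsLift.append {c : ℝ} (hη : ContMDiffOn 𝓘(ℝ, ℝ) 𝓘(ℝ, EH) ∞ η (Icc a c))
    (h : IsLift E η γ a b) (h' : IsLift E η γ b c) (hab : a ≤ b) (hbc : b ≤ c) :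
    IsLift E η γ a c := by
  rcases hab.eq_or_lt with rfl | hab
  · exact h'
  rcases hbc.eq_or_lt with rfl | hbc
  · exact h
  intro t ht
  rcases lt_trichotomy t b with htb | rfl | htb
  · obtain ⟨h1, v, hv, hvt⟩ := h t ⟨ht.1, htb.le⟩
    refine ⟨h1, v, hv, hvt.of_mem_nhdsWithin ?_⟩
    filter_upwards [self_mem_nhdsWithin, mem_nhdsWithin_of_mem_nhds (Iio_mem_nhds htb)]
      with r hr hr'
    exact ⟨hr.1, le_of_lt hr'⟩
  · obtain ⟨h1, v, hv, hvt⟩ := h t ⟨ht.1, le_rfl⟩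
    obtain ⟨-, w, hw, hwt⟩ := h' t ⟨le_rfl, ht.2⟩
    have hu := ((hη t ht).mdifferentiableWithinAt (by simp)).hasVelocityWithinAt
    have e1 := h.hasVelocityWithinAt_base ⟨ht.1, le_rfl⟩ hvt
      (hu.mono (Icc_subset_Icc_right ht.2)) hab
    have e2 := h'.hasVelocityWithinAt_base ⟨le_rfl, ht.2⟩ hwt
      (hu.mono (Icc_subset_Icc_left ht.1)) hbc
    have e3 : v - w = 0 := Submodule.disjoint_def.1 (E.isCompl (γ t)).disjoint _
      (by
        change mfderiv 𝓘(ℝ, EG) 𝓘(ℝ, EH) Φ.toFun (γ t) (v - w) = 0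
        rw [map_sub]
        exact sub_eq_zero.2 (e1.trans e2.symm)) (Submodule.sub_mem _ hv hw)
    rw [sub_eq_zero] at e3
    subst e3
    refine ⟨h1, v, hv, ?_⟩
    rw [← Icc_union_Icc_eq_Icc hab.le hbc.le]
    exact hvt.union hwt
  · obtain ⟨h1, v, hv, hvt⟩ := h' t ⟨htb.le, ht.2⟩
    refine ⟨h1, v, hv, hvt.of_mem_nhdsWithin ?_⟩
    filter_upwards [self_mem_nhdsWithin, mem_nhdsWithin_of_mem_nhds (Ioi_mem_nhds htb)]
      with r hr hr'
    exact ⟨le_of_lt hr', hr.2⟩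

theorem IsLift.exists_append {c : ℝ} (hη : ContMDiffOn 𝓘(ℝ, ℝ) 𝓘(ℝ, EH) ∞ η (Icc a c))
    {γ' : ℝ → G} (h : IsLift E η γ a b) (h' : IsLift E η γ' b c) (hab : a ≤ b) (hbc : b ≤ c)
    (hb : γ b = γ' b) :
    ∃ γ'', IsLift E η γ'' a c ∧ EqOn γ'' γ (Icc a b) ∧ EqOn γ'' γ' (Icc b c) := by
  let δ : ℝ → G := fun t => if t ≤ b then γ t else γ' t
  have h1 : EqOn δ γ (Icc a b) := fun t ht => by simp [δ, ht.2]
  have h2 : EqOn δ γ' (Icc b c) := fun t ht => by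
    rcases ht.1.eq_or_lt with rfl | hlt
    · simp [δ, hb]
    · simp [δ, not_le.2 hlt]
  exact ⟨δ, (h.congr h1).append hη (h'.congr h2) hab hbc, h1, h2⟩

theorem IsLift.reverse (h : IsLift E η γ a b) (d : ℝ) :
    IsLift E (fun t => η (d - t)) (fun t => γ (d - t)) (d - b) (d - a) := by
  intro t ht
  have ht' : d - t ∈ Icc a b := ⟨by linarith [ht.2], by linarith [ht.1]⟩
  obtain ⟨h1, v, hv, hvt⟩ := h _ ht'
  refine ⟨h1, (-1 : ℝ) • v, Submodule.smul_mem _ _ hv, ?_⟩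
  exact hvt.comp_time ((hasDerivWithinAt_id t _).const_sub d) fun r hr =>
    ⟨by linarith [hr.2], by linarith [hr.1]⟩

/-- The product of horizontal lifts is a horizontal lift of the product, by multiplicativity. -/
theorem IsLift.mul {η₁ η₂ : ℝ → H} {γ₁ γ₂ : ℝ → G} (h₁ : IsLift E η₁ γ₁ a b)
    (h₂ : IsLift E η₂ γ₂ a b) (hab : a < b)
    (hs : ∀ t ∈ Icc a b, 𝒢.src (γ₁ t) = 𝒢.tgt (γ₂ t))
    (hη : ∀ t ∈ Icc a b, η t = ℋ.mul (η₁ t) (η₂ t)) :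
    IsLift E η (fun t => 𝒢.mul (γ₁ t) (γ₂ t)) a b := by
  intro t ht
  obtain ⟨e1, v, hv, hvt⟩ := h₁ t ht
  obtain ⟨e2, w, hw, hwt⟩ := h₂ t ht
  refine ⟨by rw [Φ.map_mul _ _ (hs t ht), e1, e2, hη t ht], ?_⟩
  let A : TangentBundle 𝓘(ℝ, EG) G := ⟨γ₁ t, v⟩
  let B : TangentBundle 𝓘(ℝ, EG) G := ⟨γ₂ t, w⟩
  have hsv := hvt.comp_mfderiv (𝒢.isSubmersion_src.contMDiff.mdifferentiableAt (by simp))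
  have htw := hwt.comp_mfderiv (𝒢.isSubmersion_tgt.contMDiff.mdifferentiableAt (by simp))
  have hAB : tangentMap 𝓘(ℝ, EG) 𝓘(ℝ, EM) 𝒢.src A = tangentMap 𝓘(ℝ, EG) 𝓘(ℝ, EM) 𝒢.tgt B := by
    have key : ∀ (x y : M) (u u' : EM), x = y → u = u' →
        (⟨x, u⟩ : TangentBundle 𝓘(ℝ, EM) M) = ⟨y, u'⟩ := by
      rintro x _ u _ rfl rfl
      rfl
    refine key _ _ _ _ (hs t ht) ?_
    have hsv' : HasVelocityWithinAt (𝒢.tgt ∘ γ₂) (Icc a b) t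
        (mfderiv 𝓘(ℝ, EG) 𝓘(ℝ, EM) 𝒢.src (γ₁ t) v : EM) :=
      hsv.congr (fun r hr => (hs r hr).symm) ht rfl
    exact hsv'.unique htw (uniqueDiffOn_Icc hab t ht)
  refine ⟨(𝒢.tangentMul A B).2, E.mul_mem A B hv hw hAB, ?_⟩
  have hpair := HasMFDerivWithinAt.prodMk hvt hwt
  have hmul : HasMFDerivWithinAt (𝓘(ℝ, EG).prod 𝓘(ℝ, EG)) 𝓘(ℝ, EG)
      (fun p : G × G => 𝒢.mul p.1 p.2) 𝒢.composable (γ₁ t, γ₂ t) _ :=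
    ((𝒢.contMDiffOn_mul (γ₁ t, γ₂ t) (hs t ht)).mdifferentiableWithinAt
      (by simp)).hasMFDerivWithinAt
  have hcomp := HasMFDerivWithinAt.comp t hmul hpair
    (show Icc a b ⊆ (fun r => (γ₁ r, γ₂ r)) ⁻¹' 𝒢.composable from fun r hr => hs r hr)
  refine hcomp.congr_mfderiv ?_
  ext
  have e : ((ContinuousLinearMap.toSpanSingleton ℝ v).prod
      (ContinuousLinearMap.toSpanSingleton ℝ w)) (1 : ℝ) = (v, w) :=
    Prod.ext (one_smul ℝ v) (one_smul ℝ w)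
  refine (congrArg (mfderivWithin (𝓘(ℝ, EG).prod 𝓘(ℝ, EG)) 𝓘(ℝ, EG)
    (fun p : G × G => 𝒢.mul p.1 p.2) 𝒢.composable (γ₁ t, γ₂ t)) e).trans ?_
  exact (one_smul ℝ _).symm

end LieGroupoid

/-! ### Horizontal transport and its smoothness -/

namespace LieGroupoid

section Transport

open unitInterval

variable {EM : Type*} [NormedAddCommGroup EM] [NormedSpace ℝ EM]
  {EG : Type*} [NormedAddCommGroup EG] [NormedSpace ℝ EG] [FiniteDimensional ℝ EG]
  {EH : Type*} [NormedAddCommGroup EH] [NormedSpace ℝ EH] [FiniteDimensional ℝ EH]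
  {M : Type*} [TopologicalSpace M] [ChartedSpace EM M]
  {G : Type*} [TopologicalSpace G] [ChartedSpace EG G] [IsManifold 𝓘(ℝ, EG) ∞ G]
  {H : Type*} [TopologicalSpace H] [ChartedSpace EH H] [IsManifold 𝓘(ℝ, EH) ∞ H]
  {𝒢 : LieGroupoid (EM := EM) (EG := EG) M G} {ℋ : LieGroupoid (EM := EM) (EG := EH) M H}
  {Φ : Hom 𝒢 ℋ} {E : MultiplicativeConnection Φ}

/-- Transport near `g₀` along short paths: the end point of the horizontal lift is a smooth
function of the initial point and of the coordinate derivative `C` of the path, rescaled to the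
unit interval. -/
theorem IsChartLift.exists_transport {g₀ : G} {L : EG → EH →L[ℝ] EG} {V : Set G}
    (hL : IsChartLift E g₀ L V) :
    ∃ (N : Set (C(I, EH) × G)) (T : C(I, EH) × G → G), IsOpen N ∧ (0, g₀) ∈ N ∧
      ContMDiffOn (𝓘(ℝ, C(I, EH)).prod 𝓘(ℝ, EG)) 𝓘(ℝ, EG) ∞ T N ∧
      ∀ (η : ℝ → H) (a b : ℝ) (c : ℝ → EH) (C : C(I, EH)), a < b →
        (∀ t ∈ Icc a b, η t ∈ (extChartAt 𝓘(ℝ, EH) (Φ.toFun g₀)).source) →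
        (∀ t ∈ Icc a b,
          HasDerivWithinAt (extChartAt 𝓘(ℝ, EH) (Φ.toFun g₀) ∘ η) (c t) (Icc a b) t) →
        (∀ τ : I, C τ = (b - a) • c (a + τ * (b - a))) →
        ∀ g, (C, g) ∈ N → Φ.toFun g = η a →
          ∃ γ, IsLift E η γ a b ∧ γ a = g ∧ γ b = T (C, g) := by
  have := FiniteDimensional.complete ℝ EG
  have := FiniteDimensional.complete ℝ EH
  set φ := extChartAt 𝓘(ℝ, EG) g₀ with hφ
  have hsymm : ContMDiffOn 𝓘(ℝ, EG) 𝓘(ℝ, EG) ∞ φ.symm φ.target := contMDiffOn_extChartAt_symm g₀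
  let O : Set EG := φ.target ∩ φ.symm ⁻¹' V
  have hO : O ∈ 𝓝 (φ g₀) := by
    refine (hsymm.continuousOn.isOpen_inter_preimage (isOpen_extChartAt_target g₀)
      hL.isOpen).mem_nhds ⟨mem_extChartAt_target g₀, ?_⟩
    rw [mem_preimage, extChartAt_to_inv]
    exact hL.mem
  obtain ⟨N, S, hN, hyN, hS, hSN⟩ := exists_contDiffOn_solution hL.contDiff (φ g₀) hO
  let κ : C(I, EH) × G → EG × C(I, EH) := fun q => (φ q.2, q.1)
  have hφs : ContMDiffOn 𝓘(ℝ, EG) 𝓘(ℝ, EG) ∞ φ φ.source := contMDiffOn_extChartAt_source g₀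
  have hκ : ContMDiffOn (𝓘(ℝ, C(I, EH)).prod 𝓘(ℝ, EG)) 𝓘(ℝ, EG × C(I, EH)) ∞ κ
      (univ ×ˢ φ.source) :=
    (hφs.comp contMDiffOn_snd fun q hq => hq.2).prodMk_space contMDiffOn_fst
  have hopen : IsOpen ((univ : Set C(I, EH)) ×ˢ φ.source) :=
    isOpen_univ.prod (isOpen_extChartAt_source g₀)
  refine ⟨(univ ×ˢ φ.source) ∩ κ ⁻¹' N, fun q => φ.symm (S (κ q) 1),
    hκ.continuousOn.isOpen_inter_preimage hopen hN, ⟨⟨mem_univ _, mem_extChartAt_source g₀⟩, hyN⟩,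
    ?_, ?_⟩
  · have h1 : ContMDiffOn (𝓘(ℝ, C(I, EH)).prod 𝓘(ℝ, EG)) 𝓘(ℝ, C(I, EG)) ∞ (S ∘ κ)
        ((univ ×ˢ φ.source) ∩ κ ⁻¹' N) :=
      hS.contMDiffOn.comp (hκ.mono inter_subset_left) fun q hq => hq.2
    have h2 : ContMDiff 𝓘(ℝ, C(I, EG)) 𝓘(ℝ, EG) ∞ fun u : C(I, EG) => u 1 :=
      (ContinuousMap.evalCLM ℝ (1 : I) : C(I, EG) →L[ℝ] EG).contDiff.contMDiff
    exact hsymm.comp (h2.comp_contMDiffOn h1) fun q hq => ((hSN _ hq.2).2 1).1.1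
  · intro η a b c C hab hη hc hC g hg hgη
    obtain ⟨hS0, hSτ⟩ := hSN _ hg.2
    let θ : ℝ → ℝ := fun t => (t - a) / (b - a)
    have hba : 0 < b - a := sub_pos.2 hab
    have hθ : ∀ t ∈ Icc a b, θ t ∈ Icc (0 : ℝ) 1 := fun t ht =>
      ⟨div_nonneg (by linarith [ht.1]) hba.le, (div_le_one hba).2 (by linarith [ht.2])⟩
    let y : ℝ → EG := fun t => S (κ (C, g)) (projIcc 0 1 zero_le_one (θ t))
    have hya : y a = φ g := by
      have : projIcc (0 : ℝ) 1 zero_le_one (θ a) = 0 := by simp [θ]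
      simp only [y, this, hS0, κ]
    have hyb : y b = S (κ (C, g)) 1 := by
      have : projIcc (0 : ℝ) 1 zero_le_one (θ b) = 1 := by simp [θ, div_self hba.ne']
      simp only [y, this]
    have hyd : ∀ t ∈ Icc a b, HasDerivWithinAt y (L (y t) (c t)) (Icc a b) t := by
      intro t ht
      have h1 : HasDerivWithinAt θ (1 / (b - a)) (Icc a b) t :=
        (((hasDerivAt_id t).sub_const a).div_const (b - a)).hasDerivWithinAt
      have h2 := (hSτ ⟨θ t, hθ t ht⟩).2.scomp t h1 hθ
      have h3 : projIcc (0 : ℝ) 1 zero_le_one (θ t) = ⟨θ t, hθ t ht⟩ := projIcc_of_mem _ (hθ t ht)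
      refine h2.congr_deriv ?_
      have h4 : a + θ t * (b - a) = t := by simp only [θ]; field_simp; ring
      have h5 : (κ (C, g)).2 ⟨θ t, hθ t ht⟩ = (b - a) • c t := by
        rw [show (κ (C, g)).2 = C from rfl, hC, h4]
      simp only [y, h3, h5, map_smul, smul_smul]
      rw [one_div, inv_mul_cancel₀ hba.ne', one_smul]
    refine ⟨φ.symm ∘ y, hL.isLift (fun t _ => (hSτ _).1) hyd hη hc ?_, ?_, ?_⟩
    · rw [hya, φ.left_inv hg.1.2, hgη]
    · simp only [Function.comp, hya, φ.left_inv hg.1.2]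
    · simp only [Function.comp, hyb]

variable {P : Type*} [NormedAddCommGroup P] [NormedSpace ℝ P]

/-- Horizontal transport over `[a, b]` along the paths `η p` is defined for the parameters `p` near
`p₀` and the initial points near `g₀`, and its end point is given there by a smooth map. -/
def HasTransport (E : MultiplicativeConnection Φ) (η : P → ℝ → H) (p₀ : P) (a b : ℝ) (g₀ : G) :
    Prop :=
  ∃ (N : Set (P × G)) (T : P × G → G), IsOpen N ∧ (p₀, g₀) ∈ N ∧
    ContMDiffOn (𝓘(ℝ, P).prod 𝓘(ℝ, EG)) 𝓘(ℝ, EG) ∞ T N ∧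
    ∀ q ∈ N, Φ.toFun q.2 = η q.1 a → ∃ γ, IsLift E (η q.1) γ a b ∧ γ a = q.2 ∧ γ b = T q

omit [FiniteDimensional ℝ EG] [FiniteDimensional ℝ EH] [IsManifold 𝓘(ℝ, EH) ∞ H] in
theorem HasTransport.exists_isLift {η : P → ℝ → H} {p₀ : P} {a b : ℝ} {g₀ : G}
    (h : HasTransport E η p₀ a b g₀) (hg₀ : Φ.toFun g₀ = η p₀ a) :
    ∃ γ, IsLift E (η p₀) γ a b ∧ γ a = g₀ := by
  obtain ⟨N, T, -, hN, -, h⟩ := h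
  obtain ⟨γ, h1, h2, -⟩ := h _ hN hg₀
  exact ⟨γ, h1, h2⟩

omit [FiniteDimensional ℝ EG] [FiniteDimensional ℝ EH] [IsManifold 𝓘(ℝ, EH) ∞ H] in
theorem IsLift.const (g : G) {η : ℝ → H} {a : ℝ} (h : Φ.toFun g = η a) :
    IsLift E η (fun _ => g) a a := by
  intro t ht
  rw [Icc_self, mem_singleton_iff] at ht
  subst ht
  refine ⟨h, 0, Submodule.zero_mem _, ?_⟩
  refine (hasMFDerivWithinAt_const g _ t).congr_mfderiv ?_
  ext
  exact (smul_zero (1 : ℝ)).symm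

omit [FiniteDimensional ℝ EH] in
/-- Transport along a given lift, from transport over short intervals. -/
theorem HasTransport.of_local [T2Space G]
    (hΦ : ∀ g, Function.Surjective (mfderiv 𝓘(ℝ, EG) 𝓘(ℝ, EH) Φ.toFun g))
    {η : P → ℝ → H} {p₀ : P} {a b : ℝ} (hab : a ≤ b)
    (hη : ∀ᶠ p in 𝓝 p₀, ContMDiffOn 𝓘(ℝ, ℝ) 𝓘(ℝ, EH) ∞ (η p) (Icc a b)) {γ : ℝ → G}
    (hγ : IsLift E (η p₀) γ a b)
    (hloc : ∀ t ∈ Icc a b, ∃ ε > 0, ∀ s ∈ Icc a b, ∀ s' ∈ Icc a b, s < s' → |s - t| < ε →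
      |s' - t| < ε → HasTransport E η p₀ s s' (γ s)) :
    HasTransport E η p₀ a b (γ a) := by
  obtain ⟨U, hU, hUo, hpU⟩ := eventually_nhds_iff.1 hη
  refine interval_induction (Q := fun t => HasTransport E η p₀ a t (γ a)) hab ?_ fun t ht => ?_
  · exact ⟨univ, Prod.snd, isOpen_univ, mem_univ _, contMDiffOn_snd, fun q _ hq =>
      ⟨fun _ => q.2, IsLift.const q.2 hq, rfl, rfl⟩⟩
  obtain ⟨ε, hε, h⟩ := hloc t ht
  refine ⟨ε, hε, fun s hs s' hs' hss' hst hst' hQ => ?_⟩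
  rcases hss'.eq_or_lt with rfl | hlt
  · exact hQ
  obtain ⟨N₂, T₂, hN₂, hmem₂, hT₂, h₂⟩ := h s hs s' hs' hlt hst hst'
  obtain ⟨N₁, T₁, hN₁, hmem₁, hT₁, h₁⟩ := hQ
  have hT₁γ : T₁ (p₀, γ a) = γ s := by
    obtain ⟨δ, hδ, hδa, hδs⟩ := h₁ _ hmem₁ (hγ a (left_mem_Icc.2 hab)).1
    rw [← hδs]
    exact hδ.eqOn hΦ ((hU p₀ hpU).mono (Icc_subset_Icc_right hs.2)) (hγ.mono le_rfl hs.2) hδa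
      (right_mem_Icc.2 hs.1)
  let κ : P × G → P × G := fun q => (q.1, T₁ q)
  have hκ : ContMDiffOn (𝓘(ℝ, P).prod 𝓘(ℝ, EG)) (𝓘(ℝ, P).prod 𝓘(ℝ, EG)) ∞ κ N₁ :=
    contMDiffOn_fst.prodMk hT₁
  refine ⟨(N₁ ∩ κ ⁻¹' N₂) ∩ Prod.fst ⁻¹' U, T₂ ∘ κ,
    (hκ.continuousOn.isOpen_inter_preimage hN₁ hN₂).inter (hUo.preimage continuous_fst),
    ⟨⟨hmem₁, ?_⟩, hpU⟩, ?_, ?_⟩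
  · rw [mem_preimage]
    simp only [κ, hT₁γ]
    exact hmem₂
  · exact hT₂.comp (hκ.mono fun q hq => hq.1.1) fun q hq => hq.1.2
  · rintro q ⟨⟨hq₁, hq₂⟩, hqU⟩ hqη
    obtain ⟨δ₁, hδ₁, hδ₁a, hδ₁s⟩ := h₁ q hq₁ hqη
    obtain ⟨δ₂, hδ₂, hδ₂s, hδ₂s'⟩ := h₂ (κ q) hq₂
      (by rw [← (hδ₁ s (right_mem_Icc.2 hs.1)).1, hδ₁s])
    obtain ⟨δ, hδ, e₁, e₂⟩ := hδ₁.exists_append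
      ((hU q.1 hqU).mono (Icc_subset_Icc_right hs'.2)) hδ₂ hs.1 hss' (by rw [hδ₁s, hδ₂s])
    refine ⟨δ, hδ, ?_, ?_⟩
    · rw [e₁ (left_mem_Icc.2 hs.1), hδ₁a]
    · rw [e₂ (right_mem_Icc.2 hss'), hδ₂s']
      rfl

/-- Over short intervals, transport along a smooth path exists near every point. -/
theorem exists_hasTransport_of_contMDiffOn
    (E : MultiplicativeConnection Φ)
    (hΦ : ∀ g, Function.Surjective (mfderiv 𝓘(ℝ, EG) 𝓘(ℝ, EH) Φ.toFun g))
    {η : ℝ → H} {a b : ℝ} (hη : ContMDiffOn 𝓘(ℝ, ℝ) 𝓘(ℝ, EH) ∞ η (Icc a b)) (p₀ : P)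
    {t : ℝ} (ht : t ∈ Icc a b) {g₀ : G} (hg₀ : Φ.toFun g₀ = η t) :
    ∃ ε > 0, ∃ W ∈ 𝓝 g₀, ∀ s ∈ Icc a b, ∀ s' ∈ Icc a b, s < s' → |s - t| < ε → |s' - t| < ε →
      ∀ g ∈ W, HasTransport E (fun _ : P => η) p₀ s s' g := by
  obtain ⟨L, V, hL⟩ := exists_isChartLift E hΦ g₀
  obtain ⟨N, T, hN, hN₀, hT, h⟩ := hL.exists_transport
  have hsrc : (extChartAt 𝓘(ℝ, EH) (Φ.toFun g₀)).source ∈ 𝓝 (η t) := by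
    rw [hg₀]; exact extChartAt_source_mem_nhds _
  obtain ⟨ε, hε, hεs⟩ := Metric.mem_nhdsWithin_iff.1 (hη.continuousOn t ht hsrc)
  obtain ⟨B, hB, W, hW, hBW⟩ := mem_nhds_prod_iff.1 (hN.mem_nhds hN₀)
  obtain ⟨r, hr, hrB⟩ := Metric.mem_nhds_iff.1 hB
  rcases (ht.1.trans ht.2).eq_or_lt with rfl | hab
  · exact ⟨1, one_pos, W, hW, fun s hs s' hs' hlt => absurd (hs'.2.trans hs.1) (not_le.2 hlt)⟩
  -- a closed interval around `t` on which `η` stays in the chart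
  have hab' : max a (t - ε / 2) < min b (t + ε / 2) := by
    apply max_lt <;> apply lt_min <;> linarith [ht.1, ht.2]
  have hI : Icc (max a (t - ε / 2)) (min b (t + ε / 2)) =
    Icc a b ∩ Icc (t - ε / 2) (t + ε / 2) := Icc_inter_Icc.symm
  obtain ⟨c, hcs, hc⟩ := exists_hasDerivWithinAt_extChartAt hab'
    (hη.mono (hI ▸ inter_subset_left)) (h₀ := Φ.toFun g₀) fun q hq => by
      rw [hI] at hq
      refine hεs ⟨?_, hq.1⟩
      rw [Metric.mem_ball, Real.dist_eq]
      exact abs_sub_lt_iff.2 ⟨by linarith [hq.2.2], by linarith [hq.2.1]⟩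
  obtain ⟨K, hK⟩ := isCompact_Icc.exists_bound_of_continuousOn hcs.continuousOn
  let K' := max K 1
  have hK' : 0 < K' := lt_max_of_lt_right one_pos
  -- `K'` bounds the coordinate derivative, so that the rescaled one is at most `(s' - s) K' < r`
  refine ⟨min (ε / 2) (r / (2 * K')), by positivity, W, hW, fun s hs s' hs' hlt hst hst' g hg => ?_⟩
  have hsI : Icc s s' ⊆ Icc (max a (t - ε / 2)) (min b (t + ε / 2)) := by
    rw [hI]
    intro q hq
    have h1 := abs_sub_lt_iff.1 (hst.trans_le (min_le_left _ _))
    have h2 := abs_sub_lt_iff.1 (hst'.trans_le (min_le_left _ _))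
    exact ⟨⟨hs.1.trans hq.1, hq.2.trans hs'.2⟩, by linarith [hq.1], by linarith [hq.2]⟩
  have hmem : ∀ τ : I, s + τ * (s' - s) ∈ Icc s s' := fun τ =>
    ⟨by nlinarith [τ.2.1], by nlinarith [τ.2.2]⟩
  let C : C(I, EH) := ⟨fun τ => (s' - s) • c (s + τ * (s' - s)),
    continuous_const.smul ((hcs.continuousOn.mono hsI).comp_continuous (by fun_prop) hmem)⟩
  have hC : ‖C‖ < r := by
    have h1 := abs_sub_lt_iff.1 (hst.trans_le (min_le_right _ _))
    have h2 := abs_sub_lt_iff.1 (hst'.trans_le (min_le_right _ _))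
    have h3 : (s' - s) * K' < r := by
      have : s' - s < r / K' := by
        have : r / K' = r / (2 * K') + r / (2 * K') := by field_simp; ring
        linarith
      rwa [lt_div_iff₀ hK'] at this
    refine lt_of_le_of_lt ((ContinuousMap.norm_le _ (by nlinarith)).2 fun τ => ?_) h3
    change ‖(s' - s) • c (s + τ * (s' - s))‖ ≤ _
    rw [norm_smul, Real.norm_of_nonneg (by linarith)]
    exact mul_le_mul_of_nonneg_left ((hK _ (hsI (hmem τ))).trans (le_max_left _ _)) (by linarith)
  have hsub : ∀ g ∈ W, (C, g) ∈ N := fun g hg =>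
    hBW ⟨hrB (by rwa [mem_ball_zero_iff]), hg⟩
  have hκ : ContMDiff (𝓘(ℝ, P).prod 𝓘(ℝ, EG)) (𝓘(ℝ, C(I, EH)).prod 𝓘(ℝ, EG)) ∞
      (fun q : P × G => (C, q.2)) := contMDiff_const.prodMk contMDiff_snd
  refine ⟨(fun q : P × G => (C, q.2)) ⁻¹' N, fun q => T (C, q.2), hN.preimage hκ.continuous,
    hsub g hg, hT.comp hκ.contMDiffOn fun _ hq => hq, fun q hq hqη => ?_⟩
  exact h η s s' c C hlt (fun x hx => by
      have := hsI hx
      rw [hI] at this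
      refine hεs ⟨?_, this.1⟩
      rw [Metric.mem_ball, Real.dist_eq]
      exact abs_sub_lt_iff.2 ⟨by linarith [this.2.2], by linarith [this.2.1]⟩)
    (fun x hx => (hc x (hsI hx)).mono hsI) (fun τ => rfl) q.2 hq hqη

/-- Over short intervals, transport along a smooth family of paths exists near every point. -/
theorem exists_hasTransport_of_family [FiniteDimensional ℝ P]
    (E : MultiplicativeConnection Φ)
    (hΦ : ∀ g, Function.Surjective (mfderiv 𝓘(ℝ, EG) 𝓘(ℝ, EH) Φ.toFun g))
    {η : P → ℝ → H} {p₀ : P} {t : ℝ} {Ω : Set (P × ℝ)} (hΩ : IsOpen Ω) (hpt : (p₀, t) ∈ Ω)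
    (hη : ContMDiffOn 𝓘(ℝ, P × ℝ) 𝓘(ℝ, EH) ∞ (fun q : P × ℝ => η q.1 q.2) Ω)
    {g₀ : G} (hg₀ : Φ.toFun g₀ = η p₀ t) :
    ∃ ε > 0, ∃ W ∈ 𝓝 g₀, ∀ s s', s < s' → |s - t| < ε → |s' - t| < ε →
      ∀ g ∈ W, HasTransport E η p₀ s s' g := by
  obtain ⟨L, V, hL⟩ := exists_isChartLift E hΦ g₀
  obtain ⟨N, T, hN, hN₀, hT, h⟩ := hL.exists_transport
  set ψ := extChartAt 𝓘(ℝ, EH) (Φ.toFun g₀) with hψ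
  let Ω' : Set (P × ℝ) := Ω ∩ (fun q : P × ℝ => η q.1 q.2) ⁻¹' ψ.source
  have hΩ' : IsOpen Ω' :=
    hη.continuousOn.isOpen_inter_preimage hΩ (isOpen_extChartAt_source _)
  have hptΩ' : (p₀, t) ∈ Ω' := ⟨hpt, by
    rw [mem_preimage, ← hg₀]; exact mem_extChartAt_source (Φ.toFun g₀)⟩
  have hψs : ContMDiffOn 𝓘(ℝ, EH) 𝓘(ℝ, EH) ∞ ψ ψ.source := contMDiffOn_extChartAt_source _
  have hψη : ContDiffOn ℝ ∞ (fun q : P × ℝ => ψ (η q.1 q.2)) Ω' :=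
    (hψs.comp (hη.mono inter_subset_left) fun q hq => hq.2).contDiffOn
  obtain ⟨f, hf, hfη⟩ := hψη.exists_contDiff_eventuallyEq (hΩ'.mem_nhds hptΩ')
  obtain ⟨U, hU, J, hJ, hUJ⟩ := mem_nhds_prod_iff.1 (Filter.inter_mem hfη (hΩ'.mem_nhds hptΩ'))
  obtain ⟨U', hU'U, hU', hpU'⟩ := mem_nhds_iff.1 hU
  obtain ⟨ε, hε, hεJ⟩ := Metric.mem_nhds_iff.1 hJ
  obtain ⟨B, hB, W, hW, hBW⟩ := mem_nhds_prod_iff.1 (hN.mem_nhds hN₀)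
  obtain ⟨r, hr, hrB⟩ := Metric.mem_nhds_iff.1 hB
  -- the time derivative of the coordinate expression of the family
  let D : C(P × ℝ, EH) := ⟨fun q => fderiv ℝ f q (0, 1),
    (hf.continuous_fderiv (by simp)).clm_apply continuous_const⟩
  have hD : ContDiff ℝ ∞ D := (hf.fderiv_right (by simp)).clm_apply contDiff_const
  have hDf : ∀ p x, HasDerivAt (fun x => f (p, x)) (D (p, x)) x := fun p x => by
    have h1 := (hf.differentiable (by simp) (p, x)).hasFDerivAt.comp_hasDerivAt x
      ((hasDerivAt_const x p).prodMk (hasDerivAt_id x))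
    exact h1
  obtain ⟨K, hK⟩ := (isCompact_Icc (a := t - ε) (b := t + ε)).exists_bound_of_continuousOn
    (f := fun x => D (p₀, x)) (by fun_prop)
  let K' := max K 1
  have hK' : 0 < K' := lt_max_of_lt_right one_pos
  -- `K'` bounds the derivative for `p = p₀`, so that the rescaled one is at most `(s' - s) K' < r`
  refine ⟨min ε (r / (2 * K')), by positivity, W, hW, fun s s' hlt hst hst' g hg => ?_⟩
  have hnear : ∀ x ∈ Icc s s', |x - t| < ε := fun x hx => by
    have h1 := abs_sub_lt_iff.1 (hst.trans_le (min_le_left _ _))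
    have h2 := abs_sub_lt_iff.1 (hst'.trans_le (min_le_left _ _))
    exact abs_sub_lt_iff.2 ⟨by linarith [hx.2], by linarith [hx.1]⟩
  have hmem : ∀ τ : I, s + τ * (s' - s) ∈ Icc s s' := fun τ =>
    ⟨by nlinarith [τ.2.1], by nlinarith [τ.2.2]⟩
  -- the rescaled derivative `C p` is the composition of `D` with the affine family of curves `u p`
  let u₀ : C(I, P × ℝ) := ⟨fun τ => (0, s + τ * (s' - s)), by fun_prop⟩
  let u : P → C(I, P × ℝ) := fun p => ContinuousLinearMap.const ℝ I (p, (0 : ℝ)) + u₀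
  have hu : ContDiff ℝ ∞ u := by
    have : ContDiff ℝ ∞ fun p : P =>
        (ContinuousLinearMap.const ℝ I : P × ℝ →L[ℝ] C(I, P × ℝ)) (p, (0 : ℝ)) := by fun_prop
    exact this.add contDiff_const
  have huτ : ∀ p τ, u p τ = (p, s + τ * (s' - s)) := fun p τ => by
    change (p, (0 : ℝ)) + (0, s + τ * (s' - s)) = _
    simp
  let C : P → C(I, EH) := fun p => (s' - s) • D.comp (u p)
  have hCs : ContDiff ℝ ∞ C :=
    ((ContinuousMap.contDiff_comp_left D hD).comp hu).const_smul (s' - s)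
  have hCτ : ∀ p τ, C p τ = (s' - s) • D (p, s + τ * (s' - s)) := fun p τ => by
    rw [← huτ]; rfl
  have hC : ‖C p₀‖ < r := by
    have h1 := abs_sub_lt_iff.1 (hst.trans_le (min_le_right _ _))
    have h2 := abs_sub_lt_iff.1 (hst'.trans_le (min_le_right _ _))
    have h3 : (s' - s) * K' < r := by
      have : s' - s < r / K' := by
        have : r / K' = r / (2 * K') + r / (2 * K') := by field_simp; ring
        linarith
      rwa [lt_div_iff₀ hK'] at this
    refine lt_of_le_of_lt ((ContinuousMap.norm_le _ (by nlinarith)).2 fun τ => ?_) h3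
    rw [hCτ, norm_smul, Real.norm_of_nonneg (by linarith)]
    refine mul_le_mul_of_nonneg_left ((hK _ ?_).trans (le_max_left _ _)) (by linarith)
    have := abs_sub_lt_iff.1 (hnear _ (hmem τ))
    exact ⟨by linarith, by linarith⟩
  let κ : P × G → C(I, EH) × G := fun q => (C q.1, q.2)
  have hκ : ContMDiff (𝓘(ℝ, P).prod 𝓘(ℝ, EG)) (𝓘(ℝ, C(I, EH)).prod 𝓘(ℝ, EG)) ∞ κ :=
    (hCs.contMDiff.comp contMDiff_fst).prodMk contMDiff_snd
  refine ⟨κ ⁻¹' N ∩ Prod.fst ⁻¹' U', T ∘ κ,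
    (hN.preimage hκ.continuous).inter (hU'.preimage continuous_fst),
    ⟨hBW ⟨hrB (by rwa [mem_ball_zero_iff]), hg⟩, hpU'⟩,
    hT.comp hκ.contMDiffOn fun _ hq => hq.1, fun q hq hqη => ?_⟩
  have hq' : ∀ x ∈ Icc s s', f (q.1, x) = ψ (η q.1 x) ∧ (q.1, x) ∈ Ω' := fun x hx =>
    hUJ ⟨hU'U hq.2, hεJ (by rw [Metric.mem_ball, Real.dist_eq]; exact hnear x hx)⟩
  exact h (η q.1) s s' (fun x => D (q.1, x)) (C q.1) hlt (fun x hx => (hq' x hx).2.2)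
    (fun x hx => (hDf q.1 x).hasDerivWithinAt.congr_of_mem
      (fun z hz => (hq' z hz).1.symm) hx) (hCτ q.1) q.2 hq.1 hqη

end Transport

end LieGroupoid

namespace LieGroupoid

/-! ### Completeness implies local triviality of the kernel -/

variable {EM : Type*} [NormedAddCommGroup EM] [NormedSpace ℝ EM]
  {EG : Type*} [NormedAddCommGroup EG] [NormedSpace ℝ EG]
  {EH : Type*} [NormedAddCommGroup EH] [NormedSpace ℝ EH]
  {M : Type*} [TopologicalSpace M] [ChartedSpace EM M]
  {G : Type*} [TopologicalSpace G] [ChartedSpace EG G]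
  {H : Type*} [TopologicalSpace H] [ChartedSpace EH H]
  {𝒢 : LieGroupoid (EM := EM) (EG := EG) M G} {ℋ : LieGroupoid (EM := EM) (EG := EH) M H}
  {Φ : Hom 𝒢 ℋ}

theorem one_mul_one (𝒢 : LieGroupoid (EM := EM) (EG := EG) M G) (x : M) :
    𝒢.mul (𝒢.one x) (𝒢.one x) = 𝒢.one x := by
  have := 𝒢.mul_one (𝒢.one x)
  rwa [𝒢.src_one] at this

theorem inv_mul_cancel_left (𝒢 : LieGroupoid (EM := EM) (EG := EG) M G) {g h : G}
    (hgh : 𝒢.src g = 𝒢.tgt h) : 𝒢.mul (𝒢.inv g) (𝒢.mul g h) = h := by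
  rw [← 𝒢.mul_assoc _ _ _ (𝒢.src_inv g) hgh, 𝒢.inv_mul, hgh, 𝒢.one_mul]

theorem mul_inv_cancel_left (𝒢 : LieGroupoid (EM := EM) (EG := EG) M G) {g h : G}
    (hgh : 𝒢.tgt g = 𝒢.tgt h) : 𝒢.mul g (𝒢.mul (𝒢.inv g) h) = h := by
  rw [← 𝒢.mul_assoc _ _ _ (𝒢.tgt_inv g).symm ((𝒢.src_inv g).trans hgh), 𝒢.mul_inv, hgh,
    𝒢.one_mul]

namespace Hom

theorem map_one (Φ : Hom 𝒢 ℋ) (x : M) : Φ.toFun (𝒢.one x) = ℋ.one x := by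
  have hs : ℋ.src (Φ.toFun (𝒢.one x)) = x := (Φ.src_map _).trans (𝒢.src_one x)
  have ht : ℋ.tgt (Φ.toFun (𝒢.one x)) = x := (Φ.tgt_map _).trans (𝒢.tgt_one x)
  have h := ℋ.inv_mul_cancel_left (hs.trans ht.symm)
  rw [← Φ.map_mul _ _ ((𝒢.src_one x).trans (𝒢.tgt_one x).symm), one_mul_one, ℋ.inv_mul, hs] at h
  exact h.symm

theorem mem_ker_iff {g : G} : g ∈ Φ.ker ↔ Φ.toFun g = ℋ.one (𝒢.src g) := by
  refine ⟨fun ⟨x, hx⟩ => ?_, fun h => ⟨_, h⟩⟩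
  rw [← Φ.src_map, hx, ℋ.src_one]

theorem src_eq_of_map_eq_one {g : G} {x : M} (h : Φ.toFun g = ℋ.one x) : 𝒢.src g = x := by
  rw [← Φ.src_map, h, ℋ.src_one]

theorem tgt_eq_of_map_eq_one {g : G} {x : M} (h : Φ.toFun g = ℋ.one x) : 𝒢.tgt g = x := by
  rw [← Φ.tgt_map, h, ℋ.tgt_one]

theorem map_mul_eq_one {g h : G} {x : M} (hg : Φ.toFun g = ℋ.one x) (hh : Φ.toFun h = ℋ.one x) :
    Φ.toFun (𝒢.mul g h) = ℋ.one x := by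
  rw [Φ.map_mul _ _ ((src_eq_of_map_eq_one hg).trans (tgt_eq_of_map_eq_one hh).symm), hg, hh,
    one_mul_one]

/-- Two arrows with the same image differ by an element of the kernel. -/
theorem map_inv_mul_eq_one {g h : G} (hgh : Φ.toFun g = Φ.toFun h) :
    Φ.toFun (𝒢.mul (𝒢.inv g) h) = ℋ.one (𝒢.src h) := by
  have ht : 𝒢.tgt g = 𝒢.tgt h := by rw [← Φ.tgt_map, hgh, Φ.tgt_map]
  have hs : 𝒢.src g = 𝒢.src h := by rw [← Φ.src_map, hgh, Φ.src_map]
  rw [Φ.map_mul _ _ ((𝒢.src_inv g).trans ht), ← hgh, ← Φ.map_mul _ _ (𝒢.src_inv g), 𝒢.inv_mul,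
    map_one, hs]

end Hom

variable [IsManifold 𝓘(ℝ, EG) ∞ G] {E : MultiplicativeConnection Φ}

theorem MultiplicativeConnection.IsComplete.exists_isLift (hE : E.IsComplete) {η : ℝ → H}
    (hη : ContMDiffOn 𝓘(ℝ, ℝ) 𝓘(ℝ, EH) ∞ η (Icc 0 1)) {g : G} (hg : Φ.toFun g = η 0) :
    ∃ γ, IsLift E η γ 0 1 ∧ γ 0 = g := by
  obtain ⟨γ, h1, h2, h3⟩ := hE η hη g hg
  exact ⟨γ, fun t ht => ⟨(h3 t ht).1, _, (h3 t ht).2,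
    ((h1 t ht).mdifferentiableWithinAt (by simp)).hasVelocityWithinAt⟩, h2⟩

variable [FiniteDimensional ℝ EG] [FiniteDimensional ℝ EH] [IsManifold 𝓘(ℝ, EH) ∞ H] [T2Space G]
  {P : Type*} [NormedAddCommGroup P] [NormedSpace ℝ P] [FiniteDimensional ℝ P]

/-- For a complete connection, the end point of the horizontal lift along a smooth family of paths
is a smooth function of the parameter and the initial point. -/
theorem MultiplicativeConnection.IsComplete.exists_contMDiffOn_transport (hE : E.IsComplete)
    (hΦ : ∀ g, Function.Surjective (mfderiv 𝓘(ℝ, EG) 𝓘(ℝ, EH) Φ.toFun g))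
    {η : P → ℝ → H} {Ω : Set (P × ℝ)} (hΩ : IsOpen Ω) {B : Set P} (hB : IsOpen B)
    (hBΩ : B ×ˢ Icc 0 1 ⊆ Ω)
    (hη : ContMDiffOn 𝓘(ℝ, P × ℝ) 𝓘(ℝ, EH) ∞ (fun q : P × ℝ => η q.1 q.2) Ω) :
    ∃ T : P × G → G,
      ContMDiffOn (𝓘(ℝ, P).prod 𝓘(ℝ, EG)) 𝓘(ℝ, EG) ∞ T {q | q.1 ∈ B ∧ Φ.toFun q.2 = η q.1 0} ∧
      ∀ p ∈ B, ∀ g, Φ.toFun g = η p 0 → ∃ γ, IsLift E (η p) γ 0 1 ∧ γ 0 = g ∧ γ 1 = T (p, g) := by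
  have hηp : ∀ p ∈ B, ContMDiffOn 𝓘(ℝ, ℝ) 𝓘(ℝ, EH) ∞ (η p) (Icc 0 1) := fun p hp => by
    have h1 : ContMDiff 𝓘(ℝ, ℝ) 𝓘(ℝ, P × ℝ) ∞ (fun t : ℝ => (p, t)) :=
      (contDiff_const.prodMk contDiff_id).contMDiff
    exact hη.comp h1.contMDiffOn fun t ht => hBΩ ⟨hp, ht⟩
  have hlift : ∀ p : P, ∀ g : G, ∃ γ : ℝ → G, p ∈ B → Φ.toFun g = η p 0 →
      IsLift E (η p) γ 0 1 ∧ γ 0 = g := fun p g => by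
    by_cases h : p ∈ B ∧ Φ.toFun g = η p 0
    · obtain ⟨γ, hγ⟩ := hE.exists_isLift (hηp p h.1) h.2
      exact ⟨γ, fun _ _ => hγ⟩
    · exact ⟨fun _ => g, fun h1 h2 => absurd ⟨h1, h2⟩ h⟩
  choose γ hγ using hlift
  refine ⟨fun q => γ q.1 q.2 1, ?_, fun p hp g hg => ⟨γ p g, (hγ p g hp hg).1, (hγ p g hp hg).2,
    rfl⟩⟩
  rintro ⟨p₀, g₀⟩ ⟨hp₀, hg₀⟩
  obtain ⟨hγ₀, hγ₀0⟩ := hγ p₀ g₀ hp₀ hg₀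
  have htr : HasTransport E η p₀ 0 1 (γ p₀ g₀ 0) := by
    refine HasTransport.of_local hΦ zero_le_one ?_ hγ₀ fun t ht => ?_
    · filter_upwards [hB.mem_nhds hp₀] with p hp using hηp p hp
    · obtain ⟨ε, hε, W, hW, h⟩ := exists_hasTransport_of_family E hΦ hΩ (hBΩ ⟨hp₀, ht⟩) hη
        (hγ₀ t ht).1
      obtain ⟨ε', hε', h'⟩ := hγ₀.eventually_mem ht hW
      exact ⟨min ε ε', lt_min hε hε', fun s hs s' _ hlt hst hst' =>
        h s s' hlt (hst.trans_le (min_le_left _ _)) (hst'.trans_le (min_le_left _ _)) _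
          (h' s hs (hst.trans_le (min_le_right _ _)))⟩
  rw [hγ₀0] at htr
  obtain ⟨N, T, hN, hmem, hT, h⟩ := htr
  have h1 : ContMDiffWithinAt (𝓘(ℝ, P).prod 𝓘(ℝ, EG)) 𝓘(ℝ, EG) ∞ T
      {q | q.1 ∈ B ∧ Φ.toFun q.2 = η q.1 0} (p₀, g₀) :=
    (hT.contMDiffAt (hN.mem_nhds hmem)).contMDiffWithinAt
  have heq : ∀ q ∈ N, q.1 ∈ B → Φ.toFun q.2 = η q.1 0 → γ q.1 q.2 1 = T q := by
    intro q hq hqB hqη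
    obtain ⟨δ, hδ, hδ0, hδ1⟩ := h q hq hqη
    obtain ⟨hγq, hγq0⟩ := hγ q.1 q.2 hqB hqη
    rw [← hδ1]
    exact hγq.eqOn hΦ (hηp q.1 hqB) hδ (hγq0.trans hδ0.symm) (right_mem_Icc.2 zero_le_one)
  refine h1.congr_of_eventuallyEq ?_ (heq _ hmem hp₀ hg₀)
  filter_upwards [nhdsWithin_le_nhds (hN.mem_nhds hmem), self_mem_nhdsWithin] with q hq hq'
  exact heq q hq hq'.1 hq'.2

/-- Transport along the units over the radii of a chart ball trivialises the kernel. -/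
theorem MultiplicativeConnection.IsComplete.isLocallyTrivial [FiniteDimensional ℝ EM]
    [IsManifold 𝓘(ℝ, EM) ∞ M] (hE : E.IsComplete)
    (hΦ : ∀ g, Function.Surjective (mfderiv 𝓘(ℝ, EG) 𝓘(ℝ, EH) Φ.toFun g)) :
    𝒢.IsLocallyTrivial Φ.ker := by
  intro x₀
  set c := extChartAt 𝓘(ℝ, EM) x₀ with hc
  let c₀ := c x₀
  obtain ⟨r, hr, hrc⟩ := Metric.mem_nhds_iff.1 (extChartAt_target_mem_nhds (I := 𝓘(ℝ, EM)) x₀)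
  let B := Metric.ball c₀ r
  -- the path of units over the radius of the ball with end point `p`
  let β : EM → ℝ → H := fun p t => ℋ.one (c.symm (c₀ + t • (p - c₀)))
  have hball : ∀ p ∈ B, ∀ t ∈ Icc (0 : ℝ) 1, c₀ + t • (p - c₀) ∈ B := fun p hp t ht => by
    rw [mem_ball_iff_norm] at hp ⊢
    rw [add_sub_cancel_left, norm_smul, Real.norm_of_nonneg ht.1]
    exact lt_of_le_of_lt (mul_le_of_le_one_left (norm_nonneg _) ht.2) hp
  have hsm : ∀ f : EM × ℝ → EM, ContDiff ℝ ∞ f →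
      ContMDiffOn 𝓘(ℝ, EM × ℝ) 𝓘(ℝ, EH) ∞ (fun q => ℋ.one (c.symm (f q))) (f ⁻¹' B) :=
    fun f hf => ℋ.contMDiff_one.comp_contMDiffOn
      ((contMDiffOn_extChartAt_symm x₀).comp hf.contMDiff.contMDiffOn fun q hq => hrc hq)
  have hf₁ : ContDiff ℝ ∞ fun q : EM × ℝ => c₀ + q.2 • (q.1 - c₀) := by fun_prop
  have hf₂ : ContDiff ℝ ∞ fun q : EM × ℝ => c₀ + (1 - q.2) • (q.1 - c₀) := by fun_prop
  have hflip : ∀ t ∈ Icc (0 : ℝ) 1, 1 - t ∈ Icc (0 : ℝ) 1 := fun t ht =>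
    ⟨by linarith [ht.2], by linarith [ht.1]⟩
  obtain ⟨T, hT, hTl⟩ := hE.exists_contMDiffOn_transport hΦ (η := β)
    (Metric.isOpen_ball.preimage hf₁.continuous) (B := B) Metric.isOpen_ball
    (fun q hq => hball q.1 hq.1 q.2 hq.2) (hsm _ hf₁)
  -- transport along the reversed radii provides the inverse
  obtain ⟨T', hT', hTl'⟩ := hE.exists_contMDiffOn_transport hΦ (η := fun p t => β p (1 - t))
    (Metric.isOpen_ball.preimage hf₂.continuous) (B := B) Metric.isOpen_ball
    (fun q hq => hball q.1 hq.1 _ (hflip _ hq.2)) (hsm _ hf₂)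
  have hβ0 : ∀ p, β p 0 = ℋ.one x₀ := fun p => by
    simp only [β, zero_smul, add_zero, c₀, hc, extChartAt_to_inv]
  have hβ1 : ∀ p, β p 1 = ℋ.one (c.symm p) := fun p => by simp [β]
  have hβs : ∀ p ∈ B, ContMDiffOn 𝓘(ℝ, ℝ) 𝓘(ℝ, EH) ∞ (β p) (Icc 0 1) := fun p hp => by
    have h1 : ContMDiff 𝓘(ℝ, ℝ) 𝓘(ℝ, EM × ℝ) ∞ (fun t : ℝ => (p, t)) :=
      (contDiff_const.prodMk contDiff_id).contMDiff
    exact (hsm _ hf₁).comp h1.contMDiffOn fun t ht => hball p hp t ht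
  have hβs' : ∀ p ∈ B, ContMDiffOn 𝓘(ℝ, ℝ) 𝓘(ℝ, EH) ∞ (fun t => β p (1 - t)) (Icc 0 1) :=
    fun p hp => by
      have h1 : ContMDiff 𝓘(ℝ, ℝ) 𝓘(ℝ, EM × ℝ) ∞ (fun t : ℝ => (p, t)) :=
        (contDiff_const.prodMk contDiff_id).contMDiff
      exact (hsm _ hf₂).comp h1.contMDiffOn fun t ht => hball p hp _ (hflip t ht)
  have hrev : ∀ {p γ}, IsLift E (β p) γ 0 1 →
      IsLift E (fun t => β p (1 - t)) (fun t => γ (1 - t)) 0 1 := fun h => by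
    simpa using h.reverse 1
  have hrev' : ∀ {p γ}, IsLift E (fun t => β p (1 - t)) γ 0 1 →
      IsLift E (β p) (fun t => γ (1 - t)) 0 1 := fun h => by
    simpa using h.reverse 1
  have h1 : (1 : ℝ) ∈ Icc (0 : ℝ) 1 := right_mem_Icc.2 zero_le_one
  have hk₀ : ∀ {p k}, k ∈ Φ.ker → 𝒢.src k = x₀ → Φ.toFun k = β p 0 := fun {p k} hk hks => by
    rw [Hom.mem_ker_iff.1 hk, hks, hβ0]
  have hk₁ : ∀ {k}, k ∈ Φ.ker → 𝒢.src k ∈ c.source → Φ.toFun k = β (c (𝒢.src k)) (1 - 0) :=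
    fun {k} hk hks => by
      rw [sub_zero, hβ1, c.left_inv hks, Hom.mem_ker_iff.1 hk]
  have hcs : ContMDiffOn 𝓘(ℝ, EM) 𝓘(ℝ, EM) ∞ c c.source := contMDiffOn_extChartAt_source x₀
  have hsrc : ContMDiff 𝓘(ℝ, EG) 𝓘(ℝ, EM) ∞ 𝒢.src := 𝒢.isSubmersion_src.contMDiff
  refine ⟨c.source ∩ c ⁻¹' B, hcs.continuousOn.isOpen_inter_preimage
    (isOpen_extChartAt_source x₀) Metric.isOpen_ball,
    ⟨mem_extChartAt_source x₀, Metric.mem_ball_self hr⟩, fun x k => T (c x, k),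
    fun k => T' (c (𝒢.src k), k), ?_, ?_, ?_, ?_, ?_⟩
  · refine hT.comp (((hcs.comp contMDiffOn_fst fun q hq => hq.1.1)).prodMk contMDiffOn_snd)
      fun q hq => ⟨hq.1.2, hk₀ hq.2.1 hq.2.2⟩
  · refine hT'.comp ((hcs.comp hsrc.contMDiffOn fun k hk => hk.2.1).prodMk contMDiffOn_id)
      fun k hk => ⟨hk.2.2, hk₁ hk.1 hk.2.1⟩
  · rintro x ⟨hx, hxB⟩ k hk hks
    obtain ⟨γ, hγ, hγ0, hγ1⟩ := hTl (c x) hxB k (hk₀ hk hks)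
    have e := (hγ 1 h1).1
    rw [hβ1, c.left_inv hx, hγ1] at e
    have hs := Hom.src_eq_of_map_eq_one e
    refine ⟨⟨x, e⟩, hs, ?_⟩
    obtain ⟨γ', hγ', hγ'0, hγ'1⟩ := hTl' (c x) hxB (T (c x, k)) (by
      simp only [sub_zero, hβ1, c.left_inv hx, e])
    have e' := hγ'.eqOn hΦ (hβs' _ hxB) (hrev hγ) (by rw [hγ'0]; simp [hγ1]) h1
    simp only [hs]
    rw [← hγ'1, e']
    simp only [sub_self, hγ0]
  · rintro k hk ⟨hx, hxB⟩
    obtain ⟨γ, hγ, hγ0, hγ1⟩ := hTl' _ hxB k (hk₁ hk hx)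
    have e := (hγ 1 h1).1
    simp only [sub_self] at e
    rw [hβ0, hγ1] at e
    have hs := Hom.src_eq_of_map_eq_one e
    refine ⟨⟨x₀, e⟩, hs, ?_⟩
    obtain ⟨γ', hγ', hγ'0, hγ'1⟩ := hTl _ hxB _ (e.trans (hβ0 (c (𝒢.src k))).symm)
    have e' := hγ'.eqOn hΦ (hβs _ hxB) (hrev' hγ) (by rw [hγ'0]; simp [hγ1]) h1
    change T (c (𝒢.src k), T' (c (𝒢.src k), k)) = k
    rw [← hγ'1, e']
    simp only [sub_self, hγ0]
  · rintro x ⟨hx, hxB⟩ k hk k' hk' hks hks'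
    obtain ⟨γ, hγ, hγ0, hγ1⟩ := hTl (c x) hxB k (hk₀ hk hks)
    obtain ⟨γ', hγ', hγ'0, hγ'1⟩ := hTl (c x) hxB k' (hk₀ hk' hks')
    have hkk : Φ.toFun (𝒢.mul k k') = β (c x) 0 := by
      rw [hβ0]
      exact Hom.map_mul_eq_one ((hk₀ (p := c x) hk hks).trans (hβ0 _))
        ((hk₀ (p := c x) hk' hks').trans (hβ0 _))
    obtain ⟨δ, hδ, hδ0, hδ1⟩ := hTl (c x) hxB _ hkk
    have hmul := hγ.mul hγ' (η := β (c x)) one_pos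
      (fun t ht => (Hom.src_eq_of_map_eq_one (hγ t ht).1).trans
        (Hom.tgt_eq_of_map_eq_one (hγ' t ht).1).symm)
      fun t _ => (ℋ.one_mul_one _).symm
    change T (c x, 𝒢.mul k k') = 𝒢.mul (T (c x, k)) (T (c x, k'))
    rw [← hδ1, ← hγ1, ← hγ'1]
    exact hδ.eqOn hΦ (hβs _ hxB) hmul (by rw [hδ0, hγ0, hγ'0]) h1

end LieGroupoid

namespace LieGroupoid

/-! ### Local triviality of the kernel implies completeness -/

variable {EM : Type*} [NormedAddCommGroup EM] [NormedSpace ℝ EM]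
  {EG : Type*} [NormedAddCommGroup EG] [NormedSpace ℝ EG] [FiniteDimensional ℝ EG]
  {EH : Type*} [NormedAddCommGroup EH] [NormedSpace ℝ EH] [FiniteDimensional ℝ EH]
  {M : Type*} [TopologicalSpace M] [ChartedSpace EM M]
  {G : Type*} [TopologicalSpace G] [ChartedSpace EG G] [IsManifold 𝓘(ℝ, EG) ∞ G]
  {H : Type*} [TopologicalSpace H] [ChartedSpace EH H] [IsManifold 𝓘(ℝ, EH) ∞ H]
  {𝒢 : LieGroupoid (EM := EM) (EG := EG) M G} {ℋ : LieGroupoid (EM := EM) (EG := EH) M H}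
  {Φ : Hom 𝒢 ℋ} {E : MultiplicativeConnection Φ} {η : ℝ → H} {γ : ℝ → G} {a b : ℝ}

/-- Forward in time, a horizontal lift exists over a short interval. -/
theorem exists_isLift_right (E : MultiplicativeConnection Φ)
    (hΦ : ∀ g, Function.Surjective (mfderiv 𝓘(ℝ, EG) 𝓘(ℝ, EH) Φ.toFun g))
    (hη : ContMDiffOn 𝓘(ℝ, ℝ) 𝓘(ℝ, EH) ∞ η (Icc a b)) {t : ℝ} (ht : t ∈ Icc a b) {g : G}
    (hg : Φ.toFun g = η t) : ∃ ε > 0, ∃ γ, IsLift E η γ t (min b (t + ε)) ∧ γ t = g := by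
  obtain ⟨ε, hε, W, hW, h⟩ := exists_hasTransport_of_contMDiffOn E hΦ hη (0 : ℝ) ht hg
  refine ⟨ε / 2, half_pos hε, ?_⟩
  rcases ht.2.eq_or_lt with rfl | htb
  · rw [min_eq_left (by linarith)]
    exact ⟨fun _ => g, IsLift.const g hg, rfl⟩
  · have h1 : t < min b (t + ε / 2) := lt_min htb (by linarith)
    refine (h t ht _ ⟨ht.1.trans h1.le, min_le_left _ _⟩ h1 (by simpa using hε) ?_ g
      (mem_of_mem_nhds hW)).exists_isLift hg
    rw [abs_of_pos (sub_pos.2 h1)]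
    linarith [min_le_right b (t + ε / 2)]

/-- Through every point over a smooth path there is a horizontal lift over a short interval. -/
theorem exists_isLift_nhds (E : MultiplicativeConnection Φ)
    (hΦ : ∀ g, Function.Surjective (mfderiv 𝓘(ℝ, EG) 𝓘(ℝ, EH) Φ.toFun g))
    (hη : ContMDiffOn 𝓘(ℝ, ℝ) 𝓘(ℝ, EH) ∞ η (Icc a b)) {t : ℝ} (ht : t ∈ Icc a b) {g : G}
    (hg : Φ.toFun g = η t) :
    ∃ ε > 0, ∃ γ, IsLift E η γ (max a (t - ε)) (min b (t + ε)) ∧ γ t = g := by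
  obtain ⟨ε₁, hε₁, γ₁, h₁, h₁t⟩ := exists_isLift_right E hΦ hη ht hg
  -- the backward half is the reversal of a forward lift of the reversed path
  have hη' : ContMDiffOn 𝓘(ℝ, ℝ) 𝓘(ℝ, EH) ∞ (fun s => η (0 - s)) (Icc (0 - b) (0 - a)) :=
    hη.comp (contDiff_const.sub contDiff_id).contMDiff.contMDiffOn fun s hs =>
      ⟨by linarith [hs.2], by linarith [hs.1]⟩
  obtain ⟨ε₂, hε₂, γ₂, h₂, h₂t⟩ := exists_isLift_right E hΦ hη' (t := 0 - t)
    ⟨by linarith [ht.2], by linarith [ht.1]⟩ (g := g) (by rw [hg, sub_sub_cancel])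
  have h₂' := h₂.reverse 0
  simp only [sub_sub_cancel] at h₂'
  have h3 : max a (t - min ε₁ ε₂) ≤ t := max_le ht.1 (by linarith [lt_min hε₁ hε₂])
  have h4 : t ≤ min b (t + min ε₁ ε₂) := le_min ht.2 (by linarith [lt_min hε₁ hε₂])
  obtain ⟨γ, hγ, -, e⟩ := (h₂'.mono (a' := max a (t - min ε₁ ε₂)) (b' := t) (by
      rw [sub_le_iff_le_add, ← sub_le_iff_le_add']
      apply le_min
      · linarith [le_max_left a (t - min ε₁ ε₂)]
      · linarith [le_max_right a (t - min ε₁ ε₂), min_le_right ε₁ ε₂]) le_rfl).exists_append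
    (hη.mono (Icc_subset_Icc (le_max_left _ _) (min_le_left _ _)))
    (h₁.mono le_rfl (min_le_min_left b (by linarith [min_le_left ε₁ ε₂]))) h3 h4
    (h₂t.trans h₁t.symm)
  exact ⟨min ε₁ ε₂, lt_min hε₁ hε₂, γ, hγ, (e (left_mem_Icc.2 h4)).trans h₁t⟩

variable [T2Space G]

/-- The initial points that lift a given path form an open subset of the fibre. -/
theorem IsLift.eventually_exists_isLift
    (hΦ : ∀ g, Function.Surjective (mfderiv 𝓘(ℝ, EG) 𝓘(ℝ, EH) Φ.toFun g)) (hab : a ≤ b)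
    (hη : ContMDiffOn 𝓘(ℝ, ℝ) 𝓘(ℝ, EH) ∞ η (Icc a b)) (hγ : IsLift E η γ a b) :
    ∀ᶠ g in 𝓝 (γ a), Φ.toFun g = η a → ∃ δ, IsLift E η δ a b ∧ δ a = g := by
  have htr : HasTransport E (fun _ : ℝ => η) 0 a b (γ a) := by
    refine HasTransport.of_local hΦ hab (Filter.Eventually.of_forall fun _ => hη) hγ fun t ht => ?_
    obtain ⟨ε, hε, W, hW, h⟩ := exists_hasTransport_of_contMDiffOn E hΦ hη (0 : ℝ) ht (hγ t ht).1
    obtain ⟨ε', hε', h'⟩ := hγ.eventually_mem ht hW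
    exact ⟨min ε ε', lt_min hε hε', fun s hs s' hs' hlt hst hst' =>
      h s hs s' hs' hlt (hst.trans_le (min_le_left _ _)) (hst'.trans_le (min_le_left _ _)) _
        (h' s hs (hst.trans_le (min_le_right _ _)))⟩
  obtain ⟨N, T, hN, hmem, -, h⟩ := htr
  have hc : Continuous fun g : G => ((0 : ℝ), g) := by fun_prop
  filter_upwards [hc.continuousAt.preimage_mem_nhds (hN.mem_nhds hmem)] with g hg hgη
  obtain ⟨δ, h1, h2, -⟩ := h _ hg hgη
  exact ⟨δ, h1, h2⟩

omit [FiniteDimensional ℝ EG] [FiniteDimensional ℝ EH] [IsManifold 𝓘(ℝ, EH) ∞ H] [T2Space G] in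
/-- The units over a smooth path form a horizontal lift. -/
theorem isLift_one (E : MultiplicativeConnection Φ) {ξ : ℝ → M}
    (hξ : ContMDiffOn 𝓘(ℝ, ℝ) 𝓘(ℝ, EM) ∞ ξ (Icc a b)) :
    IsLift E (fun t => ℋ.one (ξ t)) (fun t => 𝒢.one (ξ t)) a b := fun t ht =>
  ⟨Φ.map_one _, _, E.one_mem _ _,
    ((hξ t ht).mdifferentiableWithinAt (by simp)).hasVelocityWithinAt.comp_mfderiv
      (𝒢.contMDiff_one.mdifferentiableAt (by simp))⟩

omit [FiniteDimensional ℝ EG] [IsManifold 𝓘(ℝ, EG) ∞ G] [T2Space G] in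
theorem continuousOn_mul_left (𝒢 : LieGroupoid (EM := EM) (EG := EG) M G) {X : Type*}
    [TopologicalSpace X] {f f' : X → G} {S : Set X} (hf : ContinuousOn f S)
    (hf' : ContinuousOn f' S) (h : ∀ x ∈ S, 𝒢.src (f x) = 𝒢.tgt (f' x)) :
    ContinuousOn (fun x => 𝒢.mul (f x) (f' x)) S :=
  𝒢.contMDiffOn_mul.continuousOn.comp (hf.prodMk hf') h

/-- Over the units along a path, horizontal lifts exist from every initial point that a connected
part of the kernel joins to a unit: the set of these initial points is open, and it is closed since
it is a subgroup. -/
theorem exists_isLift_of_isPreconnected (E : MultiplicativeConnection Φ)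
    (hΦ : ∀ g, Function.Surjective (mfderiv 𝓘(ℝ, EG) 𝓘(ℝ, EH) Φ.toFun g)) {ξ : ℝ → M}
    (hab : a < b) (hξ : ContMDiffOn 𝓘(ℝ, ℝ) 𝓘(ℝ, EM) ∞ ξ (Icc a b)) {S : Set G}
    (hS : IsPreconnected S) (hSk : ∀ k ∈ S, Φ.toFun k = ℋ.one (ξ a)) (hS1 : 𝒢.one (ξ a) ∈ S)
    {k : G} (hk : k ∈ S) : ∃ γ, IsLift E (fun t => ℋ.one (ξ t)) γ a b ∧ γ a = k := by
  have hη : ContMDiffOn 𝓘(ℝ, ℝ) 𝓘(ℝ, EH) ∞ (fun t => ℋ.one (ξ t)) (Icc a b) :=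
    ℋ.contMDiff_one.comp_contMDiffOn hξ
  have hopen : ∀ {k}, (∃ γ, IsLift E (fun t => ℋ.one (ξ t)) γ a b ∧ γ a = k) →
      ∀ᶠ g in 𝓝 k, Φ.toFun g = ℋ.one (ξ a) →
        ∃ δ, IsLift E (fun t => ℋ.one (ξ t)) δ a b ∧ δ a = g := by
    rintro _ ⟨γ, hγ, rfl⟩
    exact hγ.eventually_exists_isLift hΦ hab.le hη
  have := isPreconnected_iff_preconnectedSpace.1 hS
  let A : Set S := {k | ∃ γ, IsLift E (fun t => ℋ.one (ξ t)) γ a b ∧ γ a = k}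
  have hA : IsClopen A := by
    refine ⟨isClosed_of_closure_subset fun k hk => ?_, isOpen_iff_mem_nhds.2 fun k hk => ?_⟩
    -- a limit point `k` is the product of a nearby `k' ∈ A` with the element `k'⁻¹k` near the unit
    · have hcomp : ∀ k k' : S, 𝒢.src (𝒢.inv k) = 𝒢.tgt k' := fun k k' => by
        rw [𝒢.src_inv, Hom.tgt_eq_of_map_eq_one (hSk _ k.2),
          Hom.tgt_eq_of_map_eq_one (hSk _ k'.2)]
      have hc : Continuous fun k' : S => 𝒢.mul (𝒢.inv k') k :=
        continuousOn_univ.1 (𝒢.continuousOn_mul_left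
          (𝒢.contMDiff_inv.continuous.comp continuous_subtype_val).continuousOn
          continuousOn_const fun k' _ => hcomp k' k)
      have h1 : 𝒢.mul (𝒢.inv k) k = 𝒢.one (ξ a) := by
        rw [𝒢.inv_mul, Hom.src_eq_of_map_eq_one (hSk _ k.2)]
      have h2 := hopen ⟨_, isLift_one E hξ, rfl⟩
      simp only [← h1] at h2
      obtain ⟨k', h3, γ', hγ', hγ'a⟩ := mem_closure_iff_nhds.1 hk _ (hc.continuousAt h2)
      have hkk : Φ.toFun k' = Φ.toFun k := (hSk _ k'.2).trans (hSk _ k.2).symm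
      obtain ⟨δ, hδ, hδa⟩ := h3 ((Hom.map_inv_mul_eq_one hkk).trans (by
        rw [Hom.src_eq_of_map_eq_one (hSk _ k.2)]))
      refine ⟨_, hγ'.mul hδ (η := fun t => ℋ.one (ξ t)) hab (fun t ht =>
        (Hom.src_eq_of_map_eq_one (hγ' t ht).1).trans
          (Hom.tgt_eq_of_map_eq_one (hδ t ht).1).symm) fun t _ => (ℋ.one_mul_one _).symm, ?_⟩
      simp only [hγ'a, hδa]
      exact 𝒢.mul_inv_cancel_left (by rw [← Φ.tgt_map, hkk, Φ.tgt_map])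
    · exact continuous_subtype_val.continuousAt.eventually (hopen hk) |>.mono
        fun k' h => h (hSk _ k'.2)
  have hk' : (⟨k, hk⟩ : S) ∈ A := by
    rw [hA.eq_univ ⟨⟨_, hS1⟩, _, isLift_one E hξ, rfl⟩]
    trivial
  exact hk'

omit [T2Space G] in
/-- If the units over smooth paths in the base lift horizontally from every initial point, then the
connection is complete: a lift of an arbitrary path is the product of a local lift, which exists
since `Φ` is surjective, with a lift of units. -/
theorem MultiplicativeConnection.isComplete_of_exists_isLift_one
    (E : MultiplicativeConnection Φ) (hsurj : Function.Surjective Φ.toFun)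
    (hΦ : ∀ g, Function.Surjective (mfderiv 𝓘(ℝ, EG) 𝓘(ℝ, EH) Φ.toFun g))
    (h : ∀ (ξ : ℝ → M) (a b : ℝ), a < b → ContMDiffOn 𝓘(ℝ, ℝ) 𝓘(ℝ, EM) ∞ ξ (Icc a b) →
      ∀ k, Φ.toFun k = ℋ.one (ξ a) → ∃ γ, IsLift E (fun t => ℋ.one (ξ t)) γ a b ∧ γ a = k) :
    E.IsComplete := by
  intro η hη g₀ hg₀
  have key : ∃ γ, IsLift E η γ 0 1 ∧ γ 0 = g₀ := by
    refine interval_induction (Q := fun t => ∃ γ, IsLift E η γ 0 t ∧ γ 0 = g₀) zero_le_one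
      ⟨_, IsLift.const g₀ hg₀, rfl⟩ fun t ht => ?_
    obtain ⟨g, hg⟩ := hsurj (η t)
    obtain ⟨ε, hε, δ, hδ, -⟩ := exists_isLift_nhds E hΦ hη ht hg
    refine ⟨ε, hε, fun s hs s' hs' hss' hst hst' ⟨γ, hγ, hγ0⟩ => ?_⟩
    rcases hss'.eq_or_lt with rfl | hlt
    · exact ⟨γ, hγ, hγ0⟩
    have h1 := abs_sub_lt_iff.1 hst
    have h2 := abs_sub_lt_iff.1 hst'
    replace hδ := hδ.mono (a' := s) (b' := s') (max_le hs.1 (by linarith))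
      (le_min hs'.2 (by linarith))
    have hsl : s ∈ Icc s s' := left_mem_Icc.2 hss'
    have hγs := (hγ s (right_mem_Icc.2 hs.1)).1
    have hδγ : Φ.toFun (δ s) = Φ.toFun (γ s) := (hδ s hsl).1.trans hγs.symm
    obtain ⟨κ, hκ, hκs⟩ := h (fun r => ℋ.src (η r)) s s' hlt
      (ℋ.isSubmersion_src.contMDiff.comp_contMDiffOn (hη.mono (Icc_subset_Icc hs.1 hs'.2)))
      _ ((Hom.map_inv_mul_eq_one hδγ).trans (by rw [← hγs, Φ.src_map]))
    have hmul := hδ.mul hκ (η := η) hlt (fun r hr => by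
        rw [Hom.tgt_eq_of_map_eq_one (hκ r hr).1, ← Φ.src_map, (hδ r hr).1])
      fun r _ => (ℋ.mul_one _).symm
    obtain ⟨γ', hγ', e, -⟩ := hγ.exists_append (hη.mono (Icc_subset_Icc_right hs'.2)) hmul hs.1
      hss' (by
        simp only [hκs]
        exact (𝒢.mul_inv_cancel_left (by rw [← Φ.tgt_map, hδγ, Φ.tgt_map])).symm)
    exact ⟨γ', hγ', (e (left_mem_Icc.2 hs.1)).trans hγ0⟩
  obtain ⟨γ, hγ, hγ0⟩ := key
  refine ⟨γ, hγ.contMDiffOn hΦ one_pos hη, hγ0, fun t ht => ⟨(hγ t ht).1, ?_⟩⟩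
  obtain ⟨v, hv, hvt⟩ := (hγ t ht).2
  rw [hvt.mfderivWithin (uniqueDiffOn_Icc one_pos t ht)]
  exact hv

/-- Over a path in the domain of a trivialization of the kernel, the units lift from every initial
point: the trivialization identifies the components of the fibres along the path, each component
meets a local lift, and the quotient of two points of one component lies in a connected part of the
kernel containing a unit. -/
theorem exists_isLift_of_trivialization (E : MultiplicativeConnection Φ)
    (hΦ : ∀ g, Function.Surjective (mfderiv 𝓘(ℝ, EG) 𝓘(ℝ, EH) Φ.toFun g))
    {x₀ : M} {U : Set M} {φ : M → G → G} {ψ : G → G}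
    (hφ : ContinuousOn (fun p : M × G => φ p.1 p.2) (U ×ˢ {k | k ∈ Φ.ker ∧ 𝒢.src k = x₀}))
    (hψ : ContinuousOn ψ {k | k ∈ Φ.ker ∧ 𝒢.src k ∈ U})
    (hφψ : ∀ x ∈ U, ∀ k ∈ Φ.ker, 𝒢.src k = x₀ →
      φ x k ∈ Φ.ker ∧ 𝒢.src (φ x k) = x ∧ ψ (φ x k) = k)
    (hψφ : ∀ k ∈ Φ.ker, 𝒢.src k ∈ U → ψ k ∈ Φ.ker ∧ 𝒢.src (ψ k) = x₀ ∧ φ (𝒢.src k) (ψ k) = k)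
    {ξ : ℝ → M} (hab : a ≤ b) (hξ : ContMDiffOn 𝓘(ℝ, ℝ) 𝓘(ℝ, EM) ∞ ξ (Icc a b))
    (hξU : ∀ t ∈ Icc a b, ξ t ∈ U) {k : G} (hk : Φ.toFun k = ℋ.one (ξ a)) :
    ∃ γ, IsLift E (fun t => ℋ.one (ξ t)) γ a b ∧ γ a = k := by
  have hη : ContMDiffOn 𝓘(ℝ, ℝ) 𝓘(ℝ, EH) ∞ (fun t => ℋ.one (ξ t)) (Icc a b) :=
    ℋ.contMDiff_one.comp_contMDiffOn hξ
  have hsrc : ∀ {g : G} {t : ℝ}, Φ.toFun g = ℋ.one (ξ t) → 𝒢.src g = ξ t :=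
    Hom.src_eq_of_map_eq_one
  have hψk : ∀ {g : G} {t : ℝ}, t ∈ Icc a b → Φ.toFun g = ℋ.one (ξ t) →
      ψ g ∈ Φ.ker ∧ 𝒢.src (ψ g) = x₀ ∧ φ (ξ t) (ψ g) = g := fun {g t} ht hg => by
    have := hψφ g ⟨_, hg⟩ (by rw [hsrc hg]; exact hξU t ht)
    rwa [hsrc hg] at this
  have hφk : ∀ {κ : G} {t : ℝ}, t ∈ Icc a b → κ ∈ Φ.ker → 𝒢.src κ = x₀ →
      Φ.toFun (φ (ξ t) κ) = ℋ.one (ξ t) := fun {κ t} ht hκ hκs => by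
    obtain ⟨h1, h2, -⟩ := hφψ _ (hξU t ht) κ hκ hκs
    rw [Hom.mem_ker_iff.1 h1, h2]
  have haI : a ∈ Icc a b := left_mem_Icc.2 hab
  obtain ⟨hκ, hκs, hκφ⟩ := hψk haI hk
  refine interval_induction (Q := fun t => ∃ γ, IsLift E (fun t => ℋ.one (ξ t)) γ a t ∧ γ a = k)
    hab ⟨_, IsLift.const k hk, rfl⟩ fun t ht => ?_
  -- a local lift through the component of the fibre over `ξ t` that corresponds to that of `k`
  obtain ⟨ε, hε, δ, hδ, hδt⟩ := exists_isLift_nhds E hΦ hη ht (hφk ht hκ hκs)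
  refine ⟨ε, hε, fun s hs s' hs' hss' hst hst' ⟨γ, hγ, hγa⟩ => ?_⟩
  rcases hss'.eq_or_lt with rfl | hlt
  · exact ⟨γ, hγ, hγa⟩
  have h1 := abs_sub_lt_iff.1 hst
  have h2 := abs_sub_lt_iff.1 hst'
  set a' := max a (t - ε) with ha'
  set b' := min b (t + ε) with hb'
  have hsub : Icc a' b' ⊆ Icc a b := Icc_subset_Icc (le_max_left _ _) (min_le_left _ _)
  have hsub' : Icc a s ⊆ Icc a b := Icc_subset_Icc_right hs.2
  have hs₁ : s ∈ Icc a' b' := ⟨max_le hs.1 (by linarith), le_min hs.2 (by linarith)⟩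
  have hs₁' : s' ∈ Icc a' b' := ⟨max_le hs'.1 (by linarith), le_min hs'.2 (by linarith)⟩
  have ht₁ : t ∈ Icc a' b' := ⟨max_le ht.1 (by linarith), le_min ht.2 (by linarith)⟩
  -- both lifts stay, seen in the fibre over `x₀`, in the component of `ψ k`
  let S : Set G := (ψ ∘ γ) '' Icc a s ∪ (ψ ∘ δ) '' Icc a' b'
  have hSx : ∀ κ ∈ S, κ ∈ Φ.ker ∧ 𝒢.src κ = x₀ := by
    rintro _ (⟨r, hr, rfl⟩ | ⟨r, hr, rfl⟩)
    · exact ⟨(hψk (hsub' hr) (hγ r hr).1).1, (hψk (hsub' hr) (hγ r hr).1).2.1⟩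
    · exact ⟨(hψk (hsub hr) (hδ r hr).1).1, (hψk (hsub hr) (hδ r hr).1).2.1⟩
  have hS : IsPreconnected S := by
    refine IsPreconnected.union (ψ k) ⟨a, left_mem_Icc.2 hs.1, by simp [hγa]⟩
      ⟨t, ht₁, by simp only [Function.comp, hδt]; exact (hφψ _ (hξU t ht) _ hκ hκs).2.2⟩ ?_ ?_
    · exact isPreconnected_Icc.image _ (hψ.comp hγ.continuousOn fun r hr =>
        ⟨⟨_, (hγ r hr).1⟩, by rw [hsrc (hγ r hr).1]; exact hξU r (hsub' hr)⟩)
    · exact isPreconnected_Icc.image _ (hψ.comp hδ.continuousOn fun r hr =>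
        ⟨⟨_, (hδ r hr).1⟩, by rw [hsrc (hδ r hr).1]; exact hξU r (hsub hr)⟩)
  -- `f` carries this connected set to one that contains both the unit and the quotient of the lifts
  let f : G → G := fun κ => 𝒢.mul (𝒢.inv (δ s)) (φ (ξ s) κ)
  have hδs := (hδ s hs₁).1
  have hγs := (hγ s (right_mem_Icc.2 hs.1)).1
  have hfS : ContinuousOn f S := by
    refine 𝒢.continuousOn_mul_left continuousOn_const
      (hφ.comp (f := fun κ => (ξ s, κ)) (by fun_prop) fun κ hκ => ⟨hξU s hs, hSx κ hκ⟩) fun κ hκ => ?_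
    rw [𝒢.src_inv, Hom.tgt_eq_of_map_eq_one hδs,
      Hom.tgt_eq_of_map_eq_one (hφk hs (hSx κ hκ).1 (hSx κ hκ).2)]
  obtain ⟨κ, hκl, hκs'⟩ := exists_isLift_of_isPreconnected E hΦ hlt
    (hξ.mono (Icc_subset_Icc hs.1 hs'.2)) (hS.image f hfS) (k := f (ψ (γ s))) (by
      rintro _ ⟨κ, hκ, rfl⟩
      have h3 := hφk hs (hSx κ hκ).1 (hSx κ hκ).2
      refine (Hom.map_inv_mul_eq_one (hδs.trans h3.symm)).trans ?_
      rw [hsrc h3]) ⟨ψ (δ s), Or.inr ⟨s, hs₁, rfl⟩, by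
        simp only [f, (hψk hs hδs).2.2, 𝒢.inv_mul, hsrc hδs]⟩
    ⟨_, Or.inl ⟨s, right_mem_Icc.2 hs.1, rfl⟩, rfl⟩
  have hmul := (hδ.mono hs₁.1 hs₁'.2).mul hκl (η := fun t => ℋ.one (ξ t)) hlt
    (fun r hr => by
      rw [Hom.tgt_eq_of_map_eq_one (hκl r hr).1,
        hsrc (hδ r ⟨hs₁.1.trans hr.1, hr.2.trans hs₁'.2⟩).1])
    fun r _ => (ℋ.one_mul_one _).symm
  obtain ⟨γ', hγ', e, -⟩ := hγ.exists_append (hη.mono (Icc_subset_Icc_right hs'.2)) hmul hs.1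
    hss' (by
      simp only [hκs', f, (hψk hs hγs).2.2]
      exact (𝒢.mul_inv_cancel_left (by rw [Hom.tgt_eq_of_map_eq_one hδs,
        Hom.tgt_eq_of_map_eq_one hγs])).symm)
  exact ⟨γ', hγ', (e (left_mem_Icc.2 hs.1)).trans hγa⟩

/-- The domains of trivializations cover the path, and the lifts over its pieces are joined. -/
theorem MultiplicativeConnection.isComplete_of_isLocallyTrivial
    (E : MultiplicativeConnection Φ) (hsurj : Function.Surjective Φ.toFun)
    (hΦ : ∀ g, Function.Surjective (mfderiv 𝓘(ℝ, EG) 𝓘(ℝ, EH) Φ.toFun g))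
    (h : 𝒢.IsLocallyTrivial Φ.ker) : E.IsComplete := by
  refine E.isComplete_of_exists_isLift_one hsurj hΦ fun ξ a b hab hξ k hk => ?_
  refine interval_induction (Q := fun t => ∃ γ, IsLift E (fun t => ℋ.one (ξ t)) γ a t ∧ γ a = k)
    hab.le ⟨_, IsLift.const k hk, rfl⟩ fun t ht => ?_
  obtain ⟨U, hU, htU, φ, ψ, hφ, hψ, hφψ, hψφ, -⟩ := h (ξ t)
  obtain ⟨ε, hε, hεU⟩ := Metric.mem_nhdsWithin_iff.1 (hξ.continuousOn t ht (hU.mem_nhds htU))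
  refine ⟨ε, hε, fun s hs s' hs' hss' hst hst' ⟨γ, hγ, hγa⟩ => ?_⟩
  have h1 := abs_sub_lt_iff.1 hst
  have h2 := abs_sub_lt_iff.1 hst'
  obtain ⟨δ, hδ, hδs⟩ := exists_isLift_of_trivialization E hΦ hφ.continuousOn hψ.continuousOn hφψ
    hψφ hss' (hξ.mono (Icc_subset_Icc hs.1 hs'.2)) (fun r hr => hεU ⟨by
      rw [Metric.mem_ball, Real.dist_eq]
      exact abs_sub_lt_iff.2 ⟨by linarith [hr.2], by linarith [hr.1]⟩,
      hs.1.trans hr.1, hr.2.trans hs'.2⟩) (hγ s (right_mem_Icc.2 hs.1)).1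
  obtain ⟨γ', hγ', e, -⟩ := hγ.exists_append ((ℋ.contMDiff_one.comp_contMDiffOn hξ).mono
    (Icc_subset_Icc_right hs'.2)) hδ hs.1 hss' hδs.symm
  exact ⟨γ', hγ', (e (left_mem_Icc.2 hs.1)).trans hγa⟩

end LieGroupoid

namespace LieGroupoid

/-! ### Connections on locally trivial bundles of Lie groups -/

variable {EM : Type*} [NormedAddCommGroup EM] [NormedSpace ℝ EM]
  {EG : Type*} [NormedAddCommGroup EG] [NormedSpace ℝ EG]
  {M : Type*} [TopologicalSpace M] [ChartedSpace EM M]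
  {G : Type*} [TopologicalSpace G] [ChartedSpace EG G]
  {𝒢 : LieGroupoid (EM := EM) (EG := EG) M G}

theorem eq_one_of_mul_self (𝒢 : LieGroupoid (EM := EM) (EG := EG) M G) {g : G}
    (hg : 𝒢.src g = 𝒢.tgt g) (h : 𝒢.mul g g = g) : g = 𝒢.one (𝒢.src g) := by
  have := 𝒢.inv_mul_cancel_left hg
  rw [h, 𝒢.inv_mul] at this
  exact this.symm

theorem eq_inv_of_mul_eq_one (𝒢 : LieGroupoid (EM := EM) (EG := EG) M G) {g k : G}
    (hgk : 𝒢.src g = 𝒢.tgt k) (h : 𝒢.mul g k = 𝒢.one (𝒢.src k)) : g = 𝒢.inv k := by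
  have h1 := 𝒢.mul_assoc g k (𝒢.inv k) hgk (𝒢.tgt_inv k).symm
  rw [h, 𝒢.mul_inv, ← hgk, 𝒢.mul_one, ← 𝒢.tgt_inv, 𝒢.one_mul] at h1
  exact h1.symm

/-- A flat parallel transport over `U` for a bundle of Lie groups: `Θ x g` is the element over `x`
that corresponds to `g`. -/
structure IsTransport (𝒢 : LieGroupoid (EM := EM) (EG := EG) M G) (U : Set M) (Θ : M → G → G) :
    Prop where
  contMDiffOn : ContMDiffOn (𝓘(ℝ, EM).prod 𝓘(ℝ, EG)) 𝓘(ℝ, EG) ∞ (fun p : M × G => Θ p.1 p.2)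
    (U ×ˢ (𝒢.src ⁻¹' U))
  src_apply : ∀ x ∈ U, ∀ g, 𝒢.src g ∈ U → 𝒢.src (Θ x g) = x
  self : ∀ g, 𝒢.src g ∈ U → Θ (𝒢.src g) g = g
  map_mul : ∀ x ∈ U, ∀ g k, 𝒢.src g = 𝒢.src k → 𝒢.src g ∈ U →
    Θ x (𝒢.mul g k) = 𝒢.mul (Θ x g) (Θ x k)

theorem IsLocallyTrivial.exists_isTransport (h : 𝒢.IsGroupBundle)
    (h𝒢 : 𝒢.IsLocallyTrivial univ) (x₀ : M) : ∃ U Θ, IsOpen U ∧ x₀ ∈ U ∧ 𝒢.IsTransport U Θ := by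
  obtain ⟨U, hU, hx₀, φ, ψ, hφ, hψ, h1, h2, h3⟩ := h𝒢 x₀
  have hψφ : ∀ g, 𝒢.src g ∈ U → 𝒢.src (ψ g) = x₀ ∧ φ (𝒢.src g) (ψ g) = g := fun g hg =>
    (h2 g (mem_univ g) hg).2
  refine ⟨U, fun x g => φ x (ψ g), hU, hx₀, ?_, fun x hx g hg => ?_, fun g hg => (hψφ g hg).2,
    fun x hx g k hgk hg => ?_⟩
  · refine hφ.comp (contMDiffOn_fst.prodMk (hψ.comp contMDiffOn_snd fun p hp => ?_)) fun p hp => ?_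
    · exact ⟨mem_univ _, hp.2⟩
    · exact ⟨hp.1, mem_univ _, (hψφ p.2 hp.2).1⟩
  · exact (h1 x hx _ (mem_univ _) (hψφ g hg).1).2.1
  · have hk : 𝒢.src k ∈ U := hgk ▸ hg
    have hst : ∀ g, 𝒢.tgt g = 𝒢.src g := fun g => (congrFun h g).symm
    have hs := (hψφ g hg).1
    have hs' := (hψφ k hk).1
    have e : ψ (𝒢.mul g k) = 𝒢.mul (ψ g) (ψ k) := by
      have h4 := h3 (𝒢.src g) hg (ψ g) (mem_univ _) (ψ k) (mem_univ _) hs hs'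
      rw [(hψφ g hg).2, hgk, (hψφ k hk).2] at h4
      rw [← h4]
      refine (h1 _ hk _ (mem_univ _) ?_).2.2
      rw [𝒢.src_mul _ _ (by rw [hst, hs, hs']), hs']
    change φ x (ψ (𝒢.mul g k)) = _
    rw [e, h3 x hx _ (mem_univ _) _ (mem_univ _) hs hs']

namespace IsTransport

variable {U : Set M} {Θ : M → G → G}

theorem map_one (h : 𝒢.IsGroupBundle) (hΘ : 𝒢.IsTransport U Θ) {x y : M} (hx : x ∈ U)
    (hy : y ∈ U) : Θ x (𝒢.one y) = 𝒢.one x := by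
  have hy' : 𝒢.src (𝒢.one y) ∈ U := by rwa [𝒢.src_one]
  have h1 := hΘ.map_mul x hx _ _ rfl hy'
  rw [one_mul_one] at h1
  have h2 := 𝒢.eq_one_of_mul_self (congrFun h _) h1.symm
  rwa [hΘ.src_apply x hx _ hy'] at h2

theorem map_inv (h : 𝒢.IsGroupBundle) (hΘ : 𝒢.IsTransport U Θ) {x : M} (hx : x ∈ U) {g : G}
    (hg : 𝒢.src g ∈ U) : Θ x (𝒢.inv g) = 𝒢.inv (Θ x g) := by
  have hs : 𝒢.src (𝒢.inv g) = 𝒢.src g := (𝒢.src_inv g).trans (congrFun h g).symm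
  have hg' : 𝒢.src (𝒢.inv g) ∈ U := by rwa [hs]
  have h1 := hΘ.map_mul x hx _ _ hs hg'
  rw [𝒢.inv_mul, hΘ.map_one h hx hg] at h1
  refine 𝒢.eq_inv_of_mul_eq_one ?_ ?_
  · rw [← congrFun h (Θ x g), hΘ.src_apply x hx _ hg, hΘ.src_apply x hx _ hg']
  · rw [← h1, hΘ.src_apply x hx _ hg]

theorem contMDiffOn_left (hΘ : 𝒢.IsTransport U Θ) {g : G} (hg : 𝒢.src g ∈ U) :
    ContMDiffOn 𝓘(ℝ, EM) 𝓘(ℝ, EG) ∞ (fun x => Θ x g) U :=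
  hΘ.contMDiffOn.comp (contMDiffOn_id.prodMk contMDiffOn_const) fun _ hx => ⟨hx, hg⟩

theorem mdifferentiableAt (hΘ : 𝒢.IsTransport U Θ) (hU : IsOpen U) {x : M} (hx : x ∈ U) {g : G}
    (hg : 𝒢.src g ∈ U) : MDifferentiableAt 𝓘(ℝ, EM) 𝓘(ℝ, EG) (fun x => Θ x g) x :=
  ((hΘ.contMDiffOn_left hg).contMDiffAt (hU.mem_nhds hx)).mdifferentiableAt (by simp)

end IsTransport

/-- The lift operators `A g : T_x M → T_g G`, for `g` over `x ∈ U`, of a multiplicative connection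
on the part over `U` of a bundle of Lie groups. All conditions are affine in `A`. Tangent spaces are
written as the model spaces. -/
structure IsMultiplicativeLift [IsManifold 𝓘(ℝ, EM) ∞ M] [IsManifold 𝓘(ℝ, EG) ∞ G]
    (𝒢 : LieGroupoid (EM := EM) (EG := EG) M G) (U : Set M) (A : G → EM →L[ℝ] EG) : Prop where
  contMDiffAt : ∀ g, 𝒢.src g ∈ U → ∀ w : ∀ x, TangentSpace 𝓘(ℝ, EM) x,
    ContMDiffAt 𝓘(ℝ, EM) 𝓘(ℝ, EM).tangent ∞
      (fun x => (⟨x, w x⟩ : TangentBundle 𝓘(ℝ, EM) M)) (𝒢.src g) →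
    ContMDiffAt 𝓘(ℝ, EG) 𝓘(ℝ, EG).tangent ∞
      (fun g' => (⟨g', A g' (w (𝒢.src g'))⟩ : TangentBundle 𝓘(ℝ, EG) G)) g
  mfderiv_src : ∀ g, 𝒢.src g ∈ U → ∀ u : EM, mfderiv 𝓘(ℝ, EG) 𝓘(ℝ, EM) 𝒢.src g (A g u) = u
  one : ∀ x ∈ U, ∀ u : EM, A (𝒢.one x) u = mfderiv 𝓘(ℝ, EM) 𝓘(ℝ, EG) 𝒢.one x u
  inv : ∀ g, 𝒢.src g ∈ U → ∀ u : EM,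
    A (𝒢.inv g) u = mfderiv 𝓘(ℝ, EG) 𝓘(ℝ, EG) 𝒢.inv g (A g u)
  mul : ∀ g k, 𝒢.src g = 𝒢.src k → 𝒢.src g ∈ U → ∀ u : EM,
    A (𝒢.mul g k) u = mfderivWithin (𝓘(ℝ, EG).prod 𝓘(ℝ, EG)) 𝓘(ℝ, EG)
      (fun p : G × G => 𝒢.mul p.1 p.2) 𝒢.composable (g, k) ((A g u, A k u) : EG × EG)

variable [IsManifold 𝓘(ℝ, EM) ∞ M] [IsManifold 𝓘(ℝ, EG) ∞ G]

/-- The derivatives of the parallel sections of a flat transport are multiplicative lifts. -/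
theorem IsTransport.isMultiplicativeLift (h : 𝒢.IsGroupBundle) {U : Set M} (hU : IsOpen U)
    {Θ : M → G → G} (hΘ : 𝒢.IsTransport U Θ) :
    𝒢.IsMultiplicativeLift U
      fun g => mfderiv 𝓘(ℝ, EM) 𝓘(ℝ, EG) (fun x => Θ x g) (𝒢.src g) := by
  have hsrc : ContMDiff 𝓘(ℝ, EG) 𝓘(ℝ, EM) ∞ 𝒢.src := 𝒢.isSubmersion_src.contMDiff
  have hbase : ∀ (g : G) (x : M), 𝒢.src g = x → ∀ u : EM,
      (mfderiv 𝓘(ℝ, EM) 𝓘(ℝ, EG) (fun x => Θ x g) (𝒢.src g) u : EG) =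
        mfderiv 𝓘(ℝ, EM) 𝓘(ℝ, EG) (fun x => Θ x g) x u := by
    rintro g _ rfl u
    rfl
  constructor
  · intro g₀ hg₀ w hw
    have hopen : IsOpen (U ×ˢ (𝒢.src ⁻¹' U)) := hU.prod (hU.preimage hsrc.continuous)
    have hf : ContMDiffAt (𝓘(ℝ, EG).prod 𝓘(ℝ, EM)) 𝓘(ℝ, EG) ∞
        (Function.uncurry fun (g : G) (x : M) => Θ x g) (g₀, 𝒢.src g₀) :=
      ContMDiffAt.comp (g₀, 𝒢.src g₀) (f := fun q : G × M => (q.2, q.1))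
        (hΘ.contMDiffOn.contMDiffAt (hopen.mem_nhds ⟨hg₀, hg₀⟩))
        (contMDiffAt_snd.prodMk contMDiffAt_fst)
    have h1 := ContMDiffAt.mfderiv (m := ∞) _ 𝒢.src hf (hsrc g₀) (by simp)
    have hv : ContMDiffAt 𝓘(ℝ, EG) 𝓘(ℝ, EM).tangent ∞
        (fun g => (⟨𝒢.src g, w (𝒢.src g)⟩ : TangentBundle 𝓘(ℝ, EM) M)) g₀ :=
      ContMDiffAt.comp g₀ hw (hsrc g₀)
    have hb : ContMDiffAt 𝓘(ℝ, EG) 𝓘(ℝ, EG) ∞ (fun g => Θ (𝒢.src g) g) g₀ :=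
      ContMDiffAt.comp g₀ (f := fun g => (𝒢.src g, g))
        (hΘ.contMDiffOn.contMDiffAt (hopen.mem_nhds ⟨hg₀, hg₀⟩))
        ((hsrc g₀).prodMk contMDiffAt_id)
    have h2 := ContMDiffAt.clm_apply_of_inCoordinates
      (E₁ := TangentSpace 𝓘(ℝ, EM) (M := M)) (E₂ := TangentSpace 𝓘(ℝ, EG) (M := G))
      (ϕ := fun g => mfderiv 𝓘(ℝ, EM) 𝓘(ℝ, EG) (fun x => Θ x g) (𝒢.src g)) h1 hv hb
    refine h2.congr_of_eventuallyEq ?_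
    filter_upwards [(hU.preimage hsrc.continuous).mem_nhds hg₀] with g hg
    have key : ∀ (g' : G) (v : EG), g' = g →
        (⟨g, v⟩ : TangentBundle 𝓘(ℝ, EG) G) = ⟨g', v⟩ := by
      rintro _ v rfl
      rfl
    exact key _ _ (hΘ.self g hg)
  · intro g hg u
    have h1 := mfderiv_comp_apply_of_eq _ (hsrc.mdifferentiableAt (by simp))
      (hΘ.mdifferentiableAt hU hg hg) (hΘ.self g hg) (v := u)
    refine h1.symm.trans ?_
    have h2 : 𝒢.src ∘ (fun x => Θ x g) =ᶠ[𝓝 (𝒢.src g)] id := by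
      filter_upwards [hU.mem_nhds hg] with x hx using hΘ.src_apply x hx g hg
    refine (DFunLike.congr_fun h2.mfderiv_eq u).trans ?_
    exact DFunLike.congr_fun mfderiv_id u
  · intro x hx u
    refine (hbase _ x (𝒢.src_one x) u).trans ?_
    have h2 : (fun y => Θ y (𝒢.one x)) =ᶠ[𝓝 x] 𝒢.one := by
      filter_upwards [hU.mem_nhds hx] with y hy using hΘ.map_one h hy hx
    exact DFunLike.congr_fun h2.mfderiv_eq u
  · intro g hg u
    refine (hbase _ (𝒢.src g) ((𝒢.src_inv g).trans (congrFun h g).symm) u).trans ?_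
    have h2 : (fun y => Θ y (𝒢.inv g)) =ᶠ[𝓝 (𝒢.src g)] 𝒢.inv ∘ fun y => Θ y g := by
      filter_upwards [hU.mem_nhds hg] with y hy using hΘ.map_inv h hy hg
    refine (DFunLike.congr_fun h2.mfderiv_eq u).trans ?_
    exact mfderiv_comp_apply_of_eq _ (𝒢.contMDiff_inv.mdifferentiableAt (by simp))
      (hΘ.mdifferentiableAt hU hg hg) (hΘ.self g hg) (v := u)
  · intro g k hgk hg u
    have hk : 𝒢.src k ∈ U := hgk ▸ hg
    have hcomp : 𝒢.src g = 𝒢.tgt k := hgk.trans (congrFun h k)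
    refine (hbase _ (𝒢.src g) ((𝒢.src_mul g k hcomp).trans hgk.symm) u).trans ?_
    have hmul : ∀ g' k', g' = g → k' = k →
        HasMFDerivWithinAt (𝓘(ℝ, EG).prod 𝓘(ℝ, EG)) 𝓘(ℝ, EG)
          (fun p : G × G => 𝒢.mul p.1 p.2) 𝒢.composable (g', k')
          (mfderivWithin (𝓘(ℝ, EG).prod 𝓘(ℝ, EG)) 𝓘(ℝ, EG)
            (fun p : G × G => 𝒢.mul p.1 p.2) 𝒢.composable (g, k) : EG × EG →L[ℝ] EG) := by
      rintro _ _ rfl rfl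
      exact ((𝒢.contMDiffOn_mul (_, _) hcomp).mdifferentiableWithinAt
        (by simp)).hasMFDerivWithinAt
    have hpair := (hΘ.mdifferentiableAt hU hg hg).hasMFDerivAt.prodMk
      (hΘ.mdifferentiableAt hU hg hk).hasMFDerivAt
    have h1 := HasMFDerivWithinAt.comp (𝒢.src g)
      (hmul _ _ (hΘ.self g hg) (by rw [hgk]; exact hΘ.self k hk))
      (hpair.hasMFDerivWithinAt (s := U)) (fun x hx => by
        change 𝒢.src (Θ x g) = 𝒢.tgt (Θ x k)
        rw [← congrFun h (Θ x k), hΘ.src_apply x hx _ hg, hΘ.src_apply x hx _ hk])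
    have h2 := (h1.hasMFDerivAt (hU.mem_nhds hg)).congr_of_eventuallyEq
      (f₁ := fun y => Θ y (𝒢.mul g k)) (by
        filter_upwards [hU.mem_nhds hg] with y hy using hΘ.map_mul y hy g k hgk hg)
    refine (DFunLike.congr_fun h2.mfderiv u).trans ?_
    refine congrArg (mfderivWithin (𝓘(ℝ, EG).prod 𝓘(ℝ, EG)) 𝓘(ℝ, EG)
      (fun p : G × G => 𝒢.mul p.1 p.2) 𝒢.composable (g, k)) ?_
    exact Prod.ext rfl (hbase k _ hgk.symm u).symm

end LieGroupoid

namespace LieGroupoid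

variable {EM : Type*} [NormedAddCommGroup EM] [NormedSpace ℝ EM]
  {EG : Type*} [NormedAddCommGroup EG] [NormedSpace ℝ EG]
  {M : Type*} [TopologicalSpace M] [ChartedSpace EM M] [IsManifold 𝓘(ℝ, EM) ∞ M]
  {G : Type*} [TopologicalSpace G] [ChartedSpace EG G] [IsManifold 𝓘(ℝ, EG) ∞ G]
  {𝒢 : LieGroupoid (EM := EM) (EG := EG) M G}

/-- Multiplicative lifts are glued by a partition of unity on the base. -/
theorem IsMultiplicativeLift.sum [FiniteDimensional ℝ EM] (h : 𝒢.IsGroupBundle) {ι : Type*}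
    {U : ι → Set M} {A : ι → G → EM →L[ℝ] EG}
    (hA : ∀ i, 𝒢.IsMultiplicativeLift (U i) (A i))
    (ρ : SmoothPartitionOfUnity ι 𝓘(ℝ, EM) M univ) (hρ : ρ.IsSubordinate U) :
    𝒢.IsMultiplicativeLift univ
      fun g => ∑ i ∈ ρ.finsupport (𝒢.src g), ρ i (𝒢.src g) • A i g := by
  have hsrc : ContMDiff 𝓘(ℝ, EG) 𝓘(ℝ, EM) ∞ 𝒢.src := 𝒢.isSubmersion_src.contMDiff
  have hmem : ∀ {i x}, i ∈ ρ.finsupport x → x ∈ U i := fun hi =>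
    hρ _ (subset_tsupport _ ((ρ.mem_finsupport _).1 hi))
  have hsum : ∀ (g : G) (x : M), 𝒢.src g = x → ∀ u : EM,
      (∑ i ∈ ρ.finsupport (𝒢.src g), ρ i (𝒢.src g) • A i g) u =
        ∑ i ∈ ρ.finsupport x, ρ i x • A i g u := by
    rintro g _ rfl u
    simp
  constructor
  · intro g₀ _ w hw
    have h1 : ContMDiffAt 𝓘(ℝ, EG) 𝓘(ℝ, EG).tangent ∞
        (fun g => (⟨g, ∑ i ∈ ρ.fintsupport (𝒢.src g₀), ρ i (𝒢.src g) • A i g (w (𝒢.src g))⟩ :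
          TangentBundle 𝓘(ℝ, EG) G)) g₀ := by
      refine ContMDiffAt.sum_section (V := TangentSpace 𝓘(ℝ, EG) (M := G))
        (t := fun i g => ρ i (𝒢.src g) • A i g (w (𝒢.src g))) fun i hi => ?_
      exact ContMDiffAt.smul_section (V := TangentSpace 𝓘(ℝ, EG) (M := G))
        (((ρ i).contMDiff.comp hsrc) g₀)
        ((hA i).contMDiffAt g₀ (hρ i ((ρ.mem_fintsupport_iff _ i).1 hi)) w hw)
    refine h1.congr_of_eventuallyEq ?_
    filter_upwards [hsrc.continuous.continuousAt.eventually
      (ρ.eventually_finsupport_subset (𝒢.src g₀))] with g hg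
    refine congrArg (fun v : EG => (⟨g, v⟩ : TangentBundle 𝓘(ℝ, EG) G)) ?_
    refine (hsum g _ rfl (w (𝒢.src g))).trans (Finset.sum_subset hg fun i _ hi => ?_)
    have h0 : ρ i (𝒢.src g) = 0 := by
      by_contra h0
      exact hi ((ρ.mem_finsupport _).2 h0)
    rw [h0, zero_smul]
  -- the remaining conditions are proved for an abstract operator in place of the derivative, whose
  -- domain and codomain are tangent spaces
  · intro g _ u
    have h1 : ∀ D : EG →L[ℝ] EM, (∀ i ∈ ρ.finsupport (𝒢.src g), D (A i g u) = u) →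
        D ((∑ i ∈ ρ.finsupport (𝒢.src g), ρ i (𝒢.src g) • A i g) u) = u := fun D hD => by
      rw [hsum g _ rfl, map_sum]
      simp only [map_smul]
      rw [Finset.sum_congr rfl fun i hi => by rw [hD i hi], ← Finset.sum_smul,
        ρ.sum_finsupport _ (mem_univ _), one_smul]
    exact h1 (mfderiv 𝓘(ℝ, EG) 𝓘(ℝ, EM) 𝒢.src g) fun i hi => (hA i).mfderiv_src g (hmem hi) u
  · intro x _ u
    rw [hsum _ x (𝒢.src_one x)]
    have h1 : ∀ v : EG, (∀ i ∈ ρ.finsupport x, A i (𝒢.one x) u = v) →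
        ∑ i ∈ ρ.finsupport x, ρ i x • A i (𝒢.one x) u = v := fun v hv => by
      rw [Finset.sum_congr rfl fun i hi => by rw [hv i hi], ← Finset.sum_smul,
        ρ.sum_finsupport _ (mem_univ _), one_smul]
    exact h1 _ fun i hi => (hA i).one x (hmem hi) u
  · intro g _ u
    have h1 : ∀ D : EG →L[ℝ] EG,
        (∀ i ∈ ρ.finsupport (𝒢.src g), A i (𝒢.inv g) u = D (A i g u)) →
        (∑ i ∈ ρ.finsupport (𝒢.src (𝒢.inv g)), ρ i (𝒢.src (𝒢.inv g)) • A i (𝒢.inv g)) u =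
          D ((∑ i ∈ ρ.finsupport (𝒢.src g), ρ i (𝒢.src g) • A i g) u) := fun D hD => by
      rw [hsum _ _ ((𝒢.src_inv g).trans (congrFun h g).symm), hsum g _ rfl, map_sum]
      exact Finset.sum_congr rfl fun i hi => by rw [hD i hi, map_smul]
    exact h1 (mfderiv 𝓘(ℝ, EG) 𝓘(ℝ, EG) 𝒢.inv g) fun i hi => (hA i).inv g (hmem hi) u
  · intro g k hgk _ u
    have h1 : ∀ D : EG × EG →L[ℝ] EG,
        (∀ i ∈ ρ.finsupport (𝒢.src g), A i (𝒢.mul g k) u = D (A i g u, A i k u)) →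
        (∑ i ∈ ρ.finsupport (𝒢.src (𝒢.mul g k)), ρ i (𝒢.src (𝒢.mul g k)) • A i (𝒢.mul g k)) u =
          D ((∑ i ∈ ρ.finsupport (𝒢.src g), ρ i (𝒢.src g) • A i g) u,
            (∑ i ∈ ρ.finsupport (𝒢.src k), ρ i (𝒢.src k) • A i k) u) := fun D hD => by
      rw [hsum _ _ ((𝒢.src_mul g k (hgk.trans (congrFun h k))).trans hgk.symm), hsum g _ rfl,
        hsum k _ hgk.symm, Finset.sum_congr rfl fun i hi => by rw [hD i hi, ← map_smul],
        ← map_sum]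
      congr 1
      ext <;> simp [Prod.fst_sum, Prod.snd_sum]
    exact h1 (mfderivWithin (𝓘(ℝ, EG).prod 𝓘(ℝ, EG)) 𝓘(ℝ, EG)
      (fun p : G × G => 𝒢.mul p.1 p.2) 𝒢.composable (g, k))
      fun i hi => (hA i).mul g k hgk (hmem hi) u

/-- Every tangent vector extends to a vector field that is smooth nearby. -/
theorem exists_contMDiffOn_vectorField {x : M} (u : TangentSpace 𝓘(ℝ, EM) x) :
    ∃ (W : Set M) (w : ∀ y, TangentSpace 𝓘(ℝ, EM) y), IsOpen W ∧ x ∈ W ∧ w x = u ∧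
      ContMDiffOn 𝓘(ℝ, EM) 𝓘(ℝ, EM).tangent ∞
        (fun y => (⟨y, w y⟩ : TangentBundle 𝓘(ℝ, EM) M)) W := by
  let e := trivializationAt EM (TangentSpace 𝓘(ℝ, EM) (M := M)) x
  have hx : x ∈ e.baseSet := FiberBundle.mem_baseSet_trivializationAt' x
  refine ⟨e.baseSet, fun y => e.symm y (e ⟨x, u⟩).2, e.open_baseSet, hx,
    e.symm_apply_apply_mk hx u, ?_⟩
  rw [e.contMDiffOn_section_iff e.open_baseSet Subset.rfl]
  refine (contMDiffOn_const (c := (e ⟨x, u⟩).2)).congr fun y hy => ?_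
  rw [e.apply_mk_symm hy]

/-- The images of multiplicative lift operators form a multiplicative connection. -/
theorem IsMultiplicativeLift.nonempty_multiplicativeConnection (h : 𝒢.IsGroupBundle)
    {A : G → EM →L[ℝ] EG} (hA : 𝒢.IsMultiplicativeLift univ A) :
    Nonempty (MultiplicativeConnection h.proj) := by
  refine ⟨⟨fun g => LinearMap.range (A g).toLinearMap, ?_, ?_, ?_, ?_, ?_⟩⟩
  · rintro g _ ⟨u, rfl⟩
    obtain ⟨W, w, hW, hgW, hwu, hw⟩ := exists_contMDiffOn_vectorField (x := 𝒢.src g) u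
    refine ⟨𝒢.src ⁻¹' W, hW.preimage 𝒢.isSubmersion_src.contMDiff.continuous, hgW,
      fun g' => A g' (w (𝒢.src g')), fun g' hg' => ?_, fun g' _ => ⟨_, rfl⟩, ?_⟩
    · exact (hA.contMDiffAt g' (mem_univ _) w
        (hw.contMDiffAt (hW.mem_nhds hg'))).contMDiffWithinAt
    · exact congrArg (A g) hwu
  · intro g
    have h1 : ∀ D : EG →L[ℝ] EM, (∀ u, D (A g u) = u) →
        IsCompl (LinearMap.ker D.toLinearMap) (LinearMap.range (A g).toLinearMap) := by
      intro D hD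
      constructor
      · rw [Submodule.disjoint_def]
        rintro _ hv ⟨u, rfl⟩
        have h2 : D (A g u) = 0 := hv
        rw [hD] at h2
        rw [h2, map_zero]
      · rw [codisjoint_iff, eq_top_iff]
        intro v _
        refine Submodule.mem_sup.2 ⟨v - A g (D v), ?_, A g (D v), ⟨_, rfl⟩, sub_add_cancel _ _⟩
        change D (v - A g (D v)) = 0
        rw [map_sub, hD, sub_self]
    exact h1 (mfderiv 𝓘(ℝ, EG) 𝓘(ℝ, EM) 𝒢.src g) (hA.mfderiv_src g (mem_univ _))
  · exact fun x u => ⟨u, hA.one x (mem_univ _) u⟩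
  · rintro g _ ⟨u, rfl⟩
    exact ⟨u, hA.inv g (mem_univ _) u⟩
  · rintro ⟨g, v⟩ ⟨k, v'⟩ hv hv' hab
    obtain ⟨u, rfl⟩ : ∃ u, A g u = v := hv
    obtain ⟨u', rfl⟩ : ∃ u, A k u = v' := hv'
    have hgk : 𝒢.src g = 𝒢.src k := (congrArg Bundle.TotalSpace.proj hab).trans
      (congrFun h k).symm
    have hu : u = u' := by
      have h1 : ∀ {x y : M} {v v' : EM},
          (⟨x, v⟩ : TangentBundle 𝓘(ℝ, EM) M) = ⟨y, v'⟩ → v = v' := by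
        rintro x y v v' e
        cases e
        rfl
      have h2 : (mfderiv 𝓘(ℝ, EG) 𝓘(ℝ, EM) 𝒢.src g (A g u) : EM) =
        mfderiv 𝓘(ℝ, EG) 𝓘(ℝ, EM) 𝒢.tgt k (A k u') := h1 hab
      have h3 : 𝒢.tgt = 𝒢.src := h.symm
      rw [h3] at h2
      exact (hA.mfderiv_src g (mem_univ _) u).symm.trans
        (h2.trans (hA.mfderiv_src k (mem_univ _) u'))
    subst hu
    exact ⟨u, hA.mul g k hgk (mem_univ _) u⟩

theorem IsLocallyTrivial.nonempty_multiplicativeConnection [FiniteDimensional ℝ EM] [T2Space M]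
    [SecondCountableTopology M] (h : 𝒢.IsGroupBundle) (h𝒢 : 𝒢.IsLocallyTrivial univ) :
    Nonempty (MultiplicativeConnection h.proj) := by
  have := Manifold.locallyCompact_of_finiteDimensional (M := M) 𝓘(ℝ, EM)
  choose U Θ hU hmem hΘ using h𝒢.exists_isTransport h
  obtain ⟨ρ, hρ⟩ := SmoothPartitionOfUnity.exists_isSubordinate 𝓘(ℝ, EM) (isClosed_univ (X := M))
    U hU fun x _ => mem_iUnion.2 ⟨x, hmem x⟩
  exact (IsMultiplicativeLift.sum h (fun x => (hΘ x).isMultiplicativeLift h (hU x)) ρ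
    hρ).nonempty_multiplicativeConnection h

/-! ### Bundles of connected Lie groups -/

/-- For connected fibres, every point of the kernel is joined to a unit. -/
theorem MultiplicativeConnection.isComplete_of_isConnected [FiniteDimensional ℝ EM]
    [FiniteDimensional ℝ EG] [T2Space G] (h : 𝒢.IsGroupBundle)
    (hconn : ∀ x : M, IsConnected {g : G | 𝒢.src g = x})
    (E : MultiplicativeConnection h.proj) : E.IsComplete := by
  have hΦ : ∀ g, Function.Surjective (mfderiv 𝓘(ℝ, EG) 𝓘(ℝ, EM) h.proj.toFun g) := fun g =>
    (𝒢.isSubmersion_src.isSubmersionAt g).surjective_mfderiv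
  refine E.isComplete_of_exists_isLift_one (fun x => ⟨𝒢.one x, 𝒢.src_one x⟩) hΦ
    fun ξ a b hab hξ k hk => ?_
  exact exists_isLift_of_isPreconnected E hΦ hab hξ (hconn (ξ a)).isPreconnected
    (fun _ hg => hg) (𝒢.src_one _) hk

theorem MultiplicativeConnection.IsComplete.isLocallyTrivial_univ [FiniteDimensional ℝ EM]
    [FiniteDimensional ℝ EG] [T2Space G] (h : 𝒢.IsGroupBundle)
    {E : MultiplicativeConnection h.proj} (hE : E.IsComplete) : 𝒢.IsLocallyTrivial univ := by
  have hker : h.proj.ker = univ := eq_univ_of_forall fun g => ⟨𝒢.src g, rfl⟩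
  rw [← hker]
  exact hE.isLocallyTrivial fun g => (𝒢.isSubmersion_src.isSubmersionAt g).surjective_mfderiv

end LieGroupoid

end

theorem mainTheorem3
    {EM : Type*} [NormedAddCommGroup EM] [NormedSpace ℝ EM] [FiniteDimensional ℝ EM]
    {M : Type*} [TopologicalSpace M] [ChartedSpace EM M] [IsManifold 𝓘(ℝ, EM) ∞ M] [T2Space M]
    {EG : Type*} [NormedAddCommGroup EG] [NormedSpace ℝ EG] [FiniteDimensional ℝ EG]
    {G : Type*} [TopologicalSpace G] [ChartedSpace EG G] [IsManifold 𝓘(ℝ, EG) ∞ G] [T2Space G]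
    {EH : Type*} [NormedAddCommGroup EH] [NormedSpace ℝ EH] [FiniteDimensional ℝ EH]
    {H : Type*} [TopologicalSpace H] [ChartedSpace EH H] [IsManifold 𝓘(ℝ, EH) ∞ H] [T2Space H]
    (𝒢 : LieGroupoid (EM := EM) (EG := EG) M G) :
    (∀ (ℋ : LieGroupoid (EM := EM) (EG := EH) M H) (Φ : LieGroupoid.Hom 𝒢 ℋ),
      Function.Surjective Φ.toFun → IsSubmersion 𝓘(ℝ, EG) 𝓘(ℝ, EH) ∞ Φ.toFun →
      ∀ E : LieGroupoid.MultiplicativeConnection Φ,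
        E.IsComplete ↔ 𝒢.IsLocallyTrivial Φ.ker) ∧
    (∀ h : 𝒢.IsGroupBundle, (∀ x : M, IsConnected {g : G | 𝒢.src g = x}) →
      (SecondCountableTopology M →
        (𝒢.IsLocallyTrivial Set.univ ↔
          Nonempty (LieGroupoid.MultiplicativeConnection h.proj))) ∧
      ∀ E : LieGroupoid.MultiplicativeConnection h.proj, E.IsComplete) := by
  refine ⟨fun ℋ Φ hsurj hsub E => ?_, fun h hconn => ⟨fun _ => ⟨?_, ?_⟩, ?_⟩⟩
  · have hΦ := fun g => (hsub.isSubmersionAt g).surjective_mfderiv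
    exact ⟨fun hE => hE.isLocallyTrivial hΦ, E.isComplete_of_isLocallyTrivial hsurj hΦ⟩
  · exact fun h𝒢 => h𝒢.nonempty_multiplicativeConnection h
  · exact fun ⟨E⟩ => (E.isComplete_of_isConnected h hconn).isLocallyTrivial_univ h
  · exact fun E => E.isComplete_of_isConnected h hconn
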